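/- Let $\xi=(\xi_t)_{t\ge 0}$ be a real Lévy process with characteristic triplet $(a,q^2,\Lambda)$, with characteristic exponent $$\Psi(z)=iaz-\frac{q^2}{2}z^2+\int_{\mathbb R}\big(e^{izx}-1-izx\mathbf 1_{\{|x|\le 1\}}\big)\,\Lambda(dx),\qquad \mathbb E[e^{iz\xi_1}]=e^{\Psi(z)}.$$ Let $\beta(\Lambda)=\inf\{r>0:\int_{[-1,1]}|x|^r\Lambda(dx)<\infty\}$, and put $\beta=\beta(\Lambda)$ if $q=0$ and $\beta=2$ if $q\neq 0$. Let $p\in(0,1)$ be an admissible memory parameter, that is, $p\beta<1$. For $n\ge1$ let $X^{(n)}_k=\xi_{k/n}-\xi_{(k-1)/n}$ $(k\ge 1)$ and $S^{(n)}_m=X^{(n)}_1+\dots+X^{(n)}_m$, $S^{(n)}_0=0$ (the $n$-skeleton). Let $(\epsilon_k)_{k\ge 2}$ be i.i.d. Bernoulli variables with parameter $p$ and let $U[k]$, $k\ge 1$, be independent, $U[k]$ uniform on $\{1,\dots,k\}$, the two sequences being independent of each other and of $(X^{(n)}_k)_k$ (these sequences may depend on $n$). Put $\hat X^{(n)}_1=X^{(n)}_1$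 and $$\hat X^{(n)}_{k+1}=X^{(n)}_{k+1}\mathbf 1_{\{\epsilon_{k+1}=0\}}+\hat X^{(n)}_{U[k]}\mathbf 1_{\{\epsilon_{k+1}=1\}},\qquad \hat S^{(n)}_m=\hat X^{(n)}_1+\dots+\hat X^{(n)}_m,\quad \hat S^{(n)}_0=0 .$$ Let $U$ be uniform on $[0,1]$ and let $Y$ be a Yule–Simon process with parameter $1/p$, that is, $Y(s)=\mathbf 1_{\{U\le s\}}Z_{p(\ln s-\ln U)}$, $s\in[0,1]$, with $Z$ a standard Yule process independent of $U$. Let $(\xi,\hat\xi)$ denote any pair of processes, started from $(0,0)$, whose law is determined by: for all $k\ge1$, real $\lambda_1,\dots,\lambda_k,\beta_1,\dots,\beta_k$ and $0<t_1<\dots<t_k\le t$, $$\mathbb E\Big[e^{\,i\sum_{j}(\lambda_j\xi_{t_j}+\beta_j\hat\xi_{t_j})}\Big]=\exp\Big\{tp\,\mathbb E\Big[\Psi\Big(\sum_{j}\lambda_j\mathbf 1_{\{U\le t_j/t\}}\Big)\Big]+t(1-p)\,\mathbb E\Big[\Psi\Big(\sum_{j}\big(\lambda_j\mathbf 1_{\{Y(t_j/t)\ge1\}}+\beta_jY(t_j/t)\big)\Big)\Big]\Big\}.\qquad(\ast)$$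 Then, as $n\to\infty$, $$\Big(\big(S^{(n)}_{\lfloor nt\rfloor}\big)_{t\in[0,1]},\big(\hat S^{(n)}_{\lfloor nt\rfloor}\big)_{t\in[0,1]}\Big)\longrightarrow\big((\xi_t)_{t\in[0,1]},(\hat\xi_t)_{t\in[0,1]}\big)$$ weakly in the sense of finite-dimensional distributions. Moreover, for all $k\ge 1$, real $\lambda_j,\beta_j$ and $0<t_1<\dots<t_k\le1$, the expectations of $\Psi$ in $(\ast)$ with $t=1$ are those of integrable variables, and the characteristic functions $\mathbb E\big[e^{i\sum_j(\lambda_jS^{(n)}_{\lfloor nt_j\rfloor}+\beta_j\hat S^{(n)}_{\lfloor nt_j\rfloor})}\big]$ converge to the right-hand side of $(\ast)$ with $t=1$. -/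

import Mathlib

open MeasureTheory ProbabilityTheory Filter Topology
open scoped NNReal ENNReal

noncomputable section

namespace NoiseReinforced

/-! ### Lévy processes -/

/-- `Λ` is a Lévy measure on `ℝ`: no mass at `0` and `∫ (1 ∧ x²) Λ(dx) < ∞`. -/
def IsLevyMeasure (Λ : Measure ℝ) : Prop :=
  Λ {0} = 0 ∧ ∫⁻ x, ENNReal.ofReal (min 1 (x ^ 2)) ∂Λ < ∞

/-- The Lévy-Khintchine exponent with triplet `(a, q², Λ)`:
`Ψ(z) = i a z - q² z² / 2 + ∫ (exp(i z x) - 1 - i z x 1_{|x| ≤ 1}) Λ(dx)`. -/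
def levyExponent (a q : ℝ) (Λ : Measure ℝ) (z : ℝ) : ℂ :=
  Complex.I * a * z - (q : ℂ) ^ 2 / 2 * (z : ℂ) ^ 2
    + ∫ x : ℝ, (Complex.exp (Complex.I * z * x) - 1
        - Complex.I * z * x * (if |x| ≤ 1 then 1 else 0)) ∂Λ

/-- `ξ` is a real Lévy process with characteristic triplet `(a, q², Λ)`. -/
structure IsLevyProcess {Ω : Type*} [MeasurableSpace Ω] (a q : ℝ) (Λ : Measure ℝ)
    (ξ : ℝ≥0 → Ω → ℝ) (P : Measure Ω) : Prop where
  isLevyMeasure : IsLevyMeasure Λ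
  measurable : ∀ t, Measurable (ξ t)
  start : ∀ᵐ ω ∂P, ξ 0 ω = 0
  indep_increments : HasIndepIncrements ξ P
  stationary_increments : ∀ s h, IdentDistrib (fun ω => ξ (s + h) ω - ξ s ω) (ξ h) P P
  cadlag : ∀ᵐ ω ∂P, ∀ t : ℝ≥0, ContinuousWithinAt (fun s => ξ s ω) (Set.Ici t) t ∧
    ∃ l : ℝ, Tendsto (fun s => ξ s ω) (𝓝[<] t) (𝓝 l)
  charFun_one : ∀ z : ℝ,
    ∫ ω, Complex.exp (Complex.I * z * (ξ 1 ω : ℂ)) ∂P = Complex.exp (levyExponent a q Λ z)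

/-! ### Blumenthal-Getoor index and admissible memory parameters -/

/-- The (upper) Blumenthal-Getoor index of a Lévy measure:
`inf {r > 0 : ∫_{|x| ≤ 1} |x|^r Λ(dx) < ∞}`. -/
def bgIndexMeasure (Λ : Measure ℝ) : ℝ :=
  sInf {r : ℝ | 0 < r ∧ ∫⁻ x in Set.Icc (-1) 1, ENNReal.ofReal (|x| ^ r) ∂Λ < ∞}

open Classical in
/-- The Blumenthal-Getoor index of a Lévy process with triplet `(a, q², Λ)`. -/
def bgIndex (q : ℝ) (Λ : Measure ℝ) : ℝ :=
  if q = 0 then bgIndexMeasure Λ else 2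

/-- The memory parameter `p ∈ (0,1)` is admissible for the triplet `(a, q², Λ)`. -/
def Admissible (p q : ℝ) (Λ : Measure ℝ) : Prop :=
  0 < p ∧ p < 1 ∧ p * bgIndex q Λ < 1

/-! ### Skeletons and their reinforced versions

Steps are numbered from `0`: the step `X k` is the one usually written `X_{k+1}`. -/

/-- Increments of the `n`-skeleton: `skeletonStep ξ n k = ξ_{(k+1)/n} - ξ_{k/n}`. -/
def skeletonStep {Ω : Type*} (ξ : ℝ≥0 → Ω → ℝ) (n k : ℕ) (ω : Ω) : ℝ :=
  ξ (((k : ℝ≥0) + 1) / n) ω - ξ ((k : ℝ≥0) / n) ω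

/-- The reinforcement algorithm: the first step is kept; after the steps `0, …, k`, the next
one is the fresh step `x (k+1)` if `e (k+1)` is false, and repeats the reinforced step with number
`u k ∈ {0, …, k}` if `e (k+1)` is true. -/
def reinforcedStep (x : ℕ → ℝ) (e : ℕ → Bool) (u : (k : ℕ) → Fin (k + 1)) : ℕ → ℝ
  | 0 => x 0
  | k + 1 => if e (k + 1) = true then reinforcedStep x e u (u k) else x (k + 1)
termination_by m => m
decreasing_by exact (u k).isLt

/-- The random inputs of the reinforcement algorithm: i.i.d. Bernoulli variables `ε k` with
parameter `p` and, independent of them, independent variables `U k`, uniform on the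
`k + 1` element set `{0, …, k}`. -/
structure IsReinforcementNoise {Ω : Type*} [MeasurableSpace Ω] (p : ℝ) (ε : ℕ → Ω → Bool)
    (U : (k : ℕ) → Ω → Fin (k + 1)) (P : Measure Ω) : Prop where
  measurable_bernoulli : ∀ k, Measurable (ε k)
  measurable_uniform : ∀ k, Measurable (U k)
  law_bernoulli : ∀ k, P {ω | ε k ω = true} = ENNReal.ofReal p
  law_uniform : ∀ k (i : Fin (k + 1)), P {ω | U k ω = i} = ((k : ℝ≥0∞) + 1)⁻¹
  indep_bernoulli : iIndepFun ε P
  indep_uniform : iIndepFun U P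
  indep_bernoulli_uniform : IndepFun (fun ω k => ε k ω) (fun ω k => U k ω) P

/-- The walk `S^{(n)}_m`: the sum of the first `m` increments of the `n`-skeleton. -/
def skeletonWalk {Ω : Type*} (ξ : ℝ≥0 → Ω → ℝ) (n m : ℕ) (ω : Ω) : ℝ :=
  ∑ k ∈ Finset.range m, skeletonStep ξ n k ω

/-- The noise reinforced version of the `n`-skeleton walk, built from the same increments. -/
def reinforcedWalk {Ω : Type*} (ξ : ℝ≥0 → Ω → ℝ) (ε : ℕ → Ω → Bool)
    (U : (k : ℕ) → Ω → Fin (k + 1)) (n m : ℕ) (ω : Ω) : ℝ :=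
  ∑ k ∈ Finset.range m,
    reinforcedStep (fun i => skeletonStep ξ n i ω) (fun i => ε i ω) (fun i => U i ω) k

/-! ### The Yule-Simon process -/

/-- The standard Yule process (pure birth process started from `1`, with birth rate `k` in
state `k`) with successive holding times `h 0, h 1, …`. -/
def yule (h : ℕ → ℝ) (s : ℝ) : ℕ :=
  1 + {n : ℕ | ∑ i ∈ Finset.range (n + 1), h i ≤ s}.ncard

/-- The law of `(U, h)`, where `U` is uniform on `[0,1]` and, independently, the holding times
`h k` are independent, exponential with rate `k + 1`. -/
def yuleSimonMeasure : Measure (ℝ × (ℕ → ℝ)) :=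
  ((volume : Measure ℝ).restrict (Set.Icc 0 1)).prod
    (Measure.infinitePi fun k : ℕ => expMeasure ((k : ℝ) + 1))

/-- The Yule-Simon process with parameter `1/p` on `[0,1]`:
`Y(s) = 1_{U ≤ s} Z_{p (ln s - ln U)}` with `Z` a standard Yule process independent of `U`. -/
def yuleSimon (p s : ℝ) (w : ℝ × (ℕ → ℝ)) : ℕ :=
  if w.1 ≤ s then yule w.2 (p * (Real.log s - Real.log w.1)) else 0

/-! ### The law of a Lévy process and its reinforced version -/

/-- `∑ j, l j 1_{u ≤ s j}`. -/
def discardedArg {k : ℕ} (l s : Fin k → ℝ) (u : ℝ) : ℝ :=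
  ∑ j, l j * (if u ≤ s j then 1 else 0)

/-- `∑ j, (l j 1_{Y(s j) ≥ 1} + b j Y(s j))`. -/
def sharedArg {k : ℕ} (p : ℝ) (l b s : Fin k → ℝ) (w : ℝ × (ℕ → ℝ)) : ℝ :=
  ∑ j, (l j * (if 1 ≤ yuleSimon p (s j) w then 1 else 0) + b j * (yuleSimon p (s j) w : ℝ))

/-- `exp (T p E[Ψ(∑ l j 1_{U ≤ t j / T})] + T (1-p) E[Ψ(∑ (l j 1_{Y(t j / T) ≥ 1} + b j Y(t j / T)))])`,
where `U` is uniform on `[0,1]` and `Y` is a Yule-Simon process with parameter `1/p`. -/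
def jointCharFun (a q : ℝ) (Λ : Measure ℝ) (p : ℝ) {k : ℕ} (l b : Fin k → ℝ) (t : Fin k → ℝ≥0)
    (T : ℝ≥0) : ℂ :=
  Complex.exp
    ((T : ℂ) * p * (∫ u in Set.Icc (0 : ℝ) 1,
        levyExponent a q Λ (discardedArg l (fun j => (t j : ℝ) / T) u))
      + (T : ℂ) * (1 - p) * ∫ w, levyExponent a q Λ
          (sharedArg p l b (fun j => (t j : ℝ) / T) w) ∂yuleSimonMeasure)

/-- `(ζ, ζhat)` is a pair of processes, started from `0`, with the law of a Lévy process with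
triplet `(a, q², Λ)` and its noise reinforced version with memory parameter `p`: the law is
prescribed through the characteristic functions of its finite-dimensional distributions. -/
structure IsLevyReinforcedPair {Ω : Type*} [MeasurableSpace Ω] (a q : ℝ) (Λ : Measure ℝ) (p : ℝ)
    (ζ ζhat : ℝ≥0 → Ω → ℝ) (P : Measure Ω) : Prop where
  measurable_fst : ∀ t, Measurable (ζ t)
  measurable_snd : ∀ t, Measurable (ζhat t)
  start : ∀ᵐ ω ∂P, ζ 0 ω = 0 ∧ ζhat 0 ω = 0
  charFun_eq : ∀ (k : ℕ) (l b : Fin k → ℝ) (t : Fin k → ℝ≥0) (T : ℝ≥0),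
    1 ≤ k → StrictMono t → (∀ j, 0 < t j) → (∀ j, t j ≤ T) →
    ∫ ω, Complex.exp (Complex.I * ((∑ j, (l j * ζ (t j) ω + b j * ζhat (t j) ω) : ℝ) : ℂ)) ∂P
      = jointCharFun a q Λ p l b t T

/-! ### Convergence of finite-dimensional distributions -/

/-- The processes `X n` converge to `Z` in the sense of finite-dimensional distributions. -/
def TendstoFDD {I E Ω Ω' : Type*} [MeasurableSpace Ω] [MeasurableSpace Ω']
    [TopologicalSpace E] [MeasurableSpace E] [SecondCountableTopology E] [BorelSpace E]
    (X : ℕ → I → Ω → E) (Z : I → Ω' → E) (P : Measure Ω) [IsProbabilityMeasure P]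
    (P' : Measure Ω') [IsProbabilityMeasure P'] : Prop :=
  ∀ J : Finset I, TendstoInDistribution (fun n ω (t : J) => X n t ω) atTop
    (fun ω (t : J) => Z t ω) (fun _ => P) P'

end NoiseReinforced

end

/-!
Every reinforced step repeats one of the fresh steps, so the linear combination
`∑ j, (l j S + b j Ŝ)` of the two walks at the times `⌊n t j⌋` equals `∑ i, A i * X i`, where `X i`
are the increments of the skeleton and `A i` (`coefficient`) only depends on the noise: it is
computed from the number of times step `i` has been repeated before each of these times, the size
of the family of `i` (`familySize`). The `X i` are independent with characteristic function
`exp (Ψ / n)`, and independent of the noise, so the characteristic function in question is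
`E[exp (n⁻¹ * ∑ i, Ψ (A i))]` (`integral_exp_walks`). As `Re Ψ ≤ 0` and the exponential is
`1`-Lipschitz on the left half plane, it suffices to show that the empirical mean
`n⁻¹ * ∑ i, Ψ (A i)` converges in `L¹` to the exponent of the limit
(`tendsto_integral_norm_empiricalExponent_sub`).

*Concentration.* For a bounded function in place of `Ψ`, redrawing the noise of a single step moves
a subfamily from one family to another one and so changes the sum by `O(1)`. By a bounded
differences argument its variance is `O(n)`, and the empirical mean is close to its expectation
(`integral_abs_sum_familySize_sub_le`).

*Expectation.* With probability `p` a step is not fresh, and its family is empty. Otherwise its size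
is a Markov chain which at time `m` grows from `a` to `a + 1` with probability `p a / m`
(`integral_familySize_eq`). This chain is realized from independent exponential variables `h k` of
rate `k + 1`: in state `a`, step `m` uses up the amount `-log (1 - p a / m) / a ≈ p / m` of the
current holding time (`integral_jumpCount_eq_chainValue`). Between the times `n u` and `n t` the total
amount is about `p (log t - log u)`, so for `i = ⌊n u⌋` the coupled chain is eventually equal to the
Yule-Simon process built from `(u, h)`, almost surely (`ae_eventually_coupledFamily_eq`). Averaging
over `i` amounts to taking `u` uniform on `[0, 1]` (`tendsto_integral_sum_familySize`).

*Unbounded `Ψ`.* Admissibility of `p` gives `|Ψ z| ≤ C (1 + |z| ^ γ)` for some `γ` with `p γ < 1`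
(`exists_growth_exponent`). The function `Γ (N + γ') / (Γ N Γ (1 + γ'))`, of the order of `N ^ γ'`, is
multiplied by `1 + p γ' / m` in mean by a step of the chain at time `m`, whence the moments of order
`γ'` of the families add up to `O(n)` as long as `p γ' < 1` (`sum_integral_gammaMoment_le`). With
`γ < γ' < 1 / p`, these moments control the error made by truncating `Ψ`, and by Fatou's lemma the
same holds for the Yule-Simon process.

The finite-dimensional distributions then converge by Lévy's continuity theorem, the time `0` playing
no role as all processes start from `0`.
-/


namespace NoiseReinforced

section

/-! ### The characteristic exponent -/

/-- The integrand of the Lévy-Khintchine formula. -/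
noncomputable def levyIntegrand (z x : ℝ) : ℂ :=
  Complex.exp (Complex.I * z * x) - 1 - Complex.I * z * x * (if |x| ≤ 1 then 1 else 0)

/-- Interpolation between the bounds `|y| ^ 2` for small `y` and `2 |y|` for large `y`. -/
lemma norm_exp_I_mul_sub_one_sub_le {γ : ℝ} (h1 : 1 ≤ γ) (h2 : γ ≤ 2) (y : ℝ) :
    ‖Complex.exp (Complex.I * y) - 1 - Complex.I * y‖ ≤ 2 * |y| ^ γ := by
  have hn : ‖Complex.I * (y : ℂ)‖ = |y| := by simp
  rcases le_total |y| 1 with hy | hy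
  · calc ‖Complex.exp (Complex.I * y) - 1 - Complex.I * y‖ ≤ ‖Complex.I * (y : ℂ)‖ ^ 2 :=
          Complex.norm_exp_sub_one_sub_id_le (by rw [hn]; exact hy)
      _ = |y| ^ (2 : ℝ) := by rw [hn]; norm_cast
      _ ≤ |y| ^ γ := by
          rcases (abs_nonneg y).eq_or_lt with h0 | h0
          · rw [← h0, Real.zero_rpow (by norm_num), Real.zero_rpow (by linarith)]
          · exact Real.rpow_le_rpow_of_exponent_ge h0 hy h2
      _ ≤ 2 * |y| ^ γ := by linarith [Real.rpow_nonneg (abs_nonneg y) γ]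
  · calc ‖Complex.exp (Complex.I * y) - 1 - Complex.I * y‖
          ≤ ‖Complex.exp (Complex.I * y) - 1‖ + ‖Complex.I * (y : ℂ)‖ := norm_sub_le _ _
      _ ≤ |y| + |y| := by
          rw [hn]
          gcongr
          exact Real.norm_exp_I_mul_ofReal_sub_one_le
      _ = 2 * |y| ^ (1 : ℝ) := by rw [Real.rpow_one]; ring
      _ ≤ 2 * |y| ^ γ := by gcongr

lemma norm_levyIntegrand_le {γ : ℝ} (h1 : 1 ≤ γ) (h2 : γ ≤ 2) (z x : ℝ) :
    ‖levyIntegrand z x‖ ≤ 2 * |z| ^ γ * (Set.Icc (-1) 1).indicator (fun x : ℝ => |x| ^ γ) x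
      + 2 * min 1 (x ^ 2) := by
  unfold levyIntegrand
  have hm : Complex.I * (z : ℂ) * x = Complex.I * ((z * x : ℝ) : ℂ) := by push_cast; ring
  by_cases hx : |x| ≤ 1
  · have hx' : x ∈ Set.Icc (-1 : ℝ) 1 := abs_le.1 hx
    rw [if_pos hx, mul_one, Set.indicator_of_mem hx', hm]
    have := norm_exp_I_mul_sub_one_sub_le h1 h2 (z * x)
    rw [abs_mul, Real.mul_rpow (abs_nonneg _) (abs_nonneg _)] at this
    have h0 : 0 ≤ min 1 (x ^ 2) := le_min zero_le_one (sq_nonneg x)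
    linarith
  · have hx' : x ∉ Set.Icc (-1 : ℝ) 1 := fun h => hx (abs_le.2 h)
    rw [if_neg hx, Set.indicator_of_notMem hx', mul_zero, mul_zero, sub_zero, zero_add]
    have h1x : 1 ≤ x ^ 2 := by
      rw [← sq_abs]; nlinarith [not_le.1 hx]
    rw [min_eq_left h1x, hm]
    calc ‖Complex.exp (Complex.I * ((z * x : ℝ) : ℂ)) - 1‖
        ≤ ‖Complex.exp (Complex.I * ((z * x : ℝ) : ℂ))‖ + ‖(1 : ℂ)‖ := norm_sub_le _ _
      _ = 2 * 1 := by rw [Complex.norm_exp_I_mul_ofReal]; norm_num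

lemma levyExponent_eq (a q : ℝ) (Λ : Measure ℝ) (z : ℝ) :
    levyExponent a q Λ z = Complex.I * a * z - (q : ℂ) ^ 2 / 2 * (z : ℂ) ^ 2
      + ∫ x, levyIntegrand z x ∂Λ := rfl

lemma measurable_levyIntegrand (z : ℝ) : Measurable (levyIntegrand z) := by
  unfold levyIntegrand
  refine Measurable.sub (by fun_prop) (Measurable.mul (by fun_prop) ?_)
  exact Measurable.ite (measurableSet_le (by fun_prop) (by fun_prop)) (by fun_prop) (by fun_prop)

lemma IsLevyMeasure.integrable_min {Λ : Measure ℝ} (hΛ : IsLevyMeasure Λ) :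
    Integrable (fun x : ℝ => min 1 (x ^ 2)) Λ := by
  refine ⟨(by fun_prop : Measurable fun x : ℝ => min 1 (x ^ 2)).aestronglyMeasurable, ?_⟩
  rw [hasFiniteIntegral_iff_ofReal (ae_of_all _ fun x => le_min zero_le_one (sq_nonneg x))]
  exact hΛ.2

lemma norm_levyIntegrand_le_min (z x : ℝ) :
    ‖levyIntegrand z x‖ ≤ (2 * |z| ^ 2 + 2) * min 1 (x ^ 2) := by
  have h := norm_levyIntegrand_le (γ := 2) (by norm_num) le_rfl z x
  have h2 : (Set.Icc (-1) 1).indicator (fun x : ℝ => |x| ^ (2 : ℝ)) x ≤ min 1 (x ^ 2) := by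
    by_cases hx : x ∈ Set.Icc (-1 : ℝ) 1
    · rw [Set.indicator_of_mem hx]
      have : |x| ≤ 1 := abs_le.2 hx
      simp only [Real.rpow_two, sq_abs]
      exact le_min (by nlinarith [sq_abs x, abs_nonneg x]) le_rfl
    · rw [Set.indicator_of_notMem hx]
      exact le_min zero_le_one (sq_nonneg x)
  rw [Real.rpow_two] at h
  have := mul_le_mul_of_nonneg_left h2 (by positivity : 0 ≤ 2 * |z| ^ 2)
  linarith

lemma IsLevyMeasure.integrable_levyIntegrand {Λ : Measure ℝ} (hΛ : IsLevyMeasure Λ) (z : ℝ) :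
    Integrable (levyIntegrand z) Λ :=
  (hΛ.integrable_min.const_mul (2 * |z| ^ 2 + 2)).mono'
    (measurable_levyIntegrand z).aestronglyMeasurable (ae_of_all _ fun x => norm_levyIntegrand_le_min z x)

lemma continuous_levyExponent (a q : ℝ) {Λ : Measure ℝ} (hΛ : IsLevyMeasure Λ) :
    Continuous (levyExponent a q Λ) := by
  have h : Continuous fun z => ∫ x, levyIntegrand z x ∂Λ := by
    refine continuous_iff_continuousAt.2 fun z₀ => ?_
    refine continuousAt_of_dominated (bound := fun x => (2 * (|z₀| + 1) ^ 2 + 2) * min 1 (x ^ 2))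
      (Eventually.of_forall fun z => (measurable_levyIntegrand z).aestronglyMeasurable) ?_
      (hΛ.integrable_min.const_mul _) ?_
    · filter_upwards [Metric.ball_mem_nhds z₀ one_pos] with z hz
      refine ae_of_all _ fun x => (norm_levyIntegrand_le_min z x).trans ?_
      have h0 : 0 ≤ min 1 (x ^ 2) := le_min zero_le_one (sq_nonneg x)
      have hz' : |z| ≤ |z₀| + 1 := by
        have h1 : |z - z₀| < 1 := hz
        have h2 := abs_sub_abs_le_abs_sub z z₀
        linarith
      gcongr
    · refine ae_of_all _ fun x => ?_
      unfold levyIntegrand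
      fun_prop
  have : levyExponent a q Λ = fun z : ℝ => Complex.I * a * z - (q : ℂ) ^ 2 / 2 * (z : ℂ) ^ 2
      + ∫ x, levyIntegrand z x ∂Λ := rfl
  rw [this]
  fun_prop

lemma levyExponent_zero (a q : ℝ) (Λ : Measure ℝ) : levyExponent a q Λ 0 = 0 := by
  simp [levyExponent]

lemma re_levyExponent_nonpos (a q : ℝ) {Λ : Measure ℝ} (hΛ : IsLevyMeasure Λ) (z : ℝ) :
    (levyExponent a q Λ z).re ≤ 0 := by
  have h1 : (Complex.I * a * z - (q : ℂ) ^ 2 / 2 * (z : ℂ) ^ 2).re = -(q ^ 2 / 2 * z ^ 2) := by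
    have : Complex.I * a * z - (q : ℂ) ^ 2 / 2 * (z : ℂ) ^ 2
        = ((-(q ^ 2 / 2 * z ^ 2) : ℝ) : ℂ) + ((a * z : ℝ) : ℂ) * Complex.I := by push_cast; ring
    rw [this]; simp [-Complex.ofReal_mul, -Complex.ofReal_neg]
  have h2 : (∫ x, levyIntegrand z x ∂Λ).re = ∫ x, (levyIntegrand z x).re ∂Λ :=
    (integral_re (𝕜 := ℂ) (hΛ.integrable_levyIntegrand z)).symm
  have h3 : ∀ x, (levyIntegrand z x).re ≤ 0 := fun x => by
    unfold levyIntegrand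
    have : Complex.I * (z : ℂ) * x = ((z * x : ℝ) : ℂ) * Complex.I := by push_cast; ring
    rw [this]
    split_ifs
    · simp only [Complex.sub_re, Complex.exp_ofReal_mul_I_re, Complex.one_re, mul_one,
        Complex.re_ofReal_mul, Complex.I_re, mul_zero, sub_zero]
      linarith [Real.cos_le_one (z * x)]
    · simp only [Complex.sub_re, Complex.exp_ofReal_mul_I_re, Complex.one_re, mul_zero,
        sub_zero]
      linarith [Real.cos_le_one (z * x)]
  rw [levyExponent_eq, Complex.add_re, h1, h2]
  have := integral_nonpos (μ := Λ) h3
  nlinarith [mul_nonneg (sq_nonneg q) (sq_nonneg z)]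

/-- The exponent grows at most like `|z| ^ γ` as soon as `γ ∈ [1, 2]` dominates the
Blumenthal-Getoor index. -/
lemma norm_levyExponent_le (a q : ℝ) {Λ : Measure ℝ} (hΛ : IsLevyMeasure Λ) {γ : ℝ} (h1 : 1 ≤ γ)
    (h2 : γ ≤ 2) (hq : q = 0 ∨ γ = 2)
    (hint : ∫⁻ x in Set.Icc (-1) 1, ENNReal.ofReal (|x| ^ γ) ∂Λ < ∞) :
    ∃ C : ℝ, 0 ≤ C ∧ ∀ z, ‖levyExponent a q Λ z‖ ≤ C * (1 + |z| ^ γ) := by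
  have hi : Integrable ((Set.Icc (-1) 1).indicator (fun x : ℝ => |x| ^ γ)) Λ := by
    rw [integrable_indicator_iff measurableSet_Icc]
    refine ⟨(by fun_prop : Measurable fun x : ℝ => |x| ^ γ).aestronglyMeasurable, ?_⟩
    rw [hasFiniteIntegral_iff_ofReal (ae_of_all _ fun x => Real.rpow_nonneg (abs_nonneg x) _)]
    exact hint
  set c₁ := ∫ x, (Set.Icc (-1) 1).indicator (fun x : ℝ => |x| ^ γ) x ∂Λ
  set c₂ := ∫ x : ℝ, min 1 (x ^ 2) ∂Λ
  have hc₁ : 0 ≤ c₁ := integral_nonneg fun x => Set.indicator_nonneg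
    (fun x _ => Real.rpow_nonneg (abs_nonneg x) _) x
  have hc₂ : 0 ≤ c₂ := integral_nonneg fun x => le_min zero_le_one (sq_nonneg x)
  refine ⟨|a| + q ^ 2 / 2 + 2 * c₁ + 2 * c₂, by positivity, fun z => ?_⟩
  have hI : ‖∫ x, levyIntegrand z x ∂Λ‖ ≤ 2 * |z| ^ γ * c₁ + 2 * c₂ := by
    calc ‖∫ x, levyIntegrand z x ∂Λ‖ ≤ ∫ x, (2 * |z| ^ γ *
            (Set.Icc (-1) 1).indicator (fun x : ℝ => |x| ^ γ) x + 2 * min 1 (x ^ 2)) ∂Λ :=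
          norm_integral_le_of_norm_le ((hi.const_mul _).add (hΛ.integrable_min.const_mul _))
            (ae_of_all _ fun x => norm_levyIntegrand_le h1 h2 z x)
      _ = 2 * |z| ^ γ * c₁ + 2 * c₂ := by
          rw [integral_add (hi.const_mul _) (hΛ.integrable_min.const_mul _),
            integral_const_mul, integral_const_mul]
  have hz : |z| ≤ 1 + |z| ^ γ := by
    rcases le_total |z| 1 with h | h
    · linarith [Real.rpow_nonneg (abs_nonneg z) γ]
    · have := Real.self_le_rpow_of_one_le h h1
      linarith
  have hz2 : q ^ 2 * z ^ 2 ≤ q ^ 2 * (1 + |z| ^ γ) := by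
    rcases hq with h | h
    · simp [h]
    · rw [h, Real.rpow_two, sq_abs]; nlinarith [sq_nonneg q]
  have hzn := Real.rpow_nonneg (abs_nonneg z) γ
  calc ‖levyExponent a q Λ z‖ ≤ ‖Complex.I * a * z‖ + ‖(q : ℂ) ^ 2 / 2 * (z : ℂ) ^ 2‖
        + ‖∫ x, levyIntegrand z x ∂Λ‖ := by
        rw [levyExponent_eq]
        exact (norm_add_le _ _).trans (by gcongr; exact norm_sub_le _ _)
    _ ≤ |a| * |z| + q ^ 2 / 2 * z ^ 2 + (2 * |z| ^ γ * c₁ + 2 * c₂) := by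
        gcongr
        · simp
        · simp
    _ ≤ _ := by nlinarith [abs_nonneg a]

/-- Admissibility of `p` leaves room for a growth exponent `γ ≥ 1` with `p γ < 1`. -/
lemma exists_growth_exponent (a q : ℝ) {Λ : Measure ℝ} (hΛ : IsLevyMeasure Λ) {p : ℝ}
    (hp : Admissible p q Λ) :
    ∃ γ C : ℝ, 1 ≤ γ ∧ p * γ < 1 ∧ 0 ≤ C ∧ ∀ z, ‖levyExponent a q Λ z‖ ≤ C * (1 + |z| ^ γ) := by
  obtain ⟨hp0, hp1, hpb⟩ := hp
  have hint2 : ∫⁻ x in Set.Icc (-1) 1, ENNReal.ofReal (|x| ^ (2 : ℝ)) ∂Λ < ∞ := by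
    refine lt_of_le_of_lt ?_ hΛ.2
    calc ∫⁻ x in Set.Icc (-1) 1, ENNReal.ofReal (|x| ^ (2 : ℝ)) ∂Λ
        ≤ ∫⁻ x in Set.Icc (-1) 1, ENNReal.ofReal (min 1 (x ^ 2)) ∂Λ := by
          refine setLIntegral_mono (by fun_prop) fun x hx => ENNReal.ofReal_le_ofReal ?_
          have : |x| ≤ 1 := abs_le.2 hx
          rw [Real.rpow_two, sq_abs]
          exact le_min (by nlinarith [sq_abs x, abs_nonneg x]) le_rfl
      _ ≤ _ := setLIntegral_le_lintegral _ _
  have key : ∃ γ : ℝ, 1 ≤ γ ∧ γ ≤ 2 ∧ p * γ < 1 ∧ (q = 0 ∨ γ = 2) ∧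
      ∫⁻ x in Set.Icc (-1) 1, ENNReal.ofReal (|x| ^ γ) ∂Λ < ∞ := by
    unfold bgIndex at hpb
    split_ifs at hpb with hq
    · have hne : {r : ℝ | 0 < r ∧ ∫⁻ x in Set.Icc (-1) 1, ENNReal.ofReal (|x| ^ r) ∂Λ < ∞}.Nonempty :=
        ⟨2, by norm_num, hint2⟩
      have hlt : bgIndexMeasure Λ < p⁻¹ := by
        rw [← one_div, lt_div_iff₀ hp0, mul_comm]; exact hpb
      obtain ⟨r, ⟨hr0, hr⟩, hrp⟩ := exists_lt_of_csInf_lt hne hlt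
      have hrp' : p * r < 1 := by
        have := mul_lt_mul_of_pos_left hrp hp0
        rwa [mul_inv_cancel₀ hp0.ne'] at this
      -- the integrals decrease in the exponent, so `r` may be moved into `[1, 2]`
      rcases le_total 2 r with h2 | h2
      · exact ⟨2, by norm_num, le_rfl, by nlinarith, Or.inl hq, hint2⟩
      rcases le_total r 1 with h1 | h1
      · refine ⟨1, le_rfl, by norm_num, by linarith, Or.inl hq, lt_of_le_of_lt ?_ hr⟩
        refine setLIntegral_mono (by fun_prop) fun x hx => ENNReal.ofReal_le_ofReal ?_
        have hx1 : |x| ≤ 1 := abs_le.2 hx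
        rcases (abs_nonneg x).eq_or_lt with h0 | h0
        · rw [← h0, Real.zero_rpow (by norm_num), Real.zero_rpow (by linarith)]
        · exact Real.rpow_le_rpow_of_exponent_ge h0 hx1 h1
      · exact ⟨r, h1, h2, hrp', Or.inl hq, hr⟩
    · exact ⟨2, by norm_num, le_rfl, hpb, Or.inr rfl, hint2⟩
  obtain ⟨γ, h1, h2, hpγ, hq, hint⟩ := key
  obtain ⟨C, hC, h⟩ := norm_levyExponent_le a q hΛ h1 h2 hq hint
  exact ⟨γ, C, h1, hpγ, hC, h⟩

end

section

/-! ### Increments of the skeleton -/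

/-- A continuous function on `ℝ` with value `1` at `0` whose `n`-th power is constantly `1` is
constantly `1`: its values lie in the discrete set of `n`-th roots of unity. -/
lemma eq_one_of_pow_eq_one {f : ℝ → ℂ} (hf : Continuous f) (h0 : f 0 = 1) {n : ℕ} (hn : 0 < n)
    (h : ∀ z, f z ^ n = 1) (z : ℝ) : f z = 1 := by
  have hfin : {w : ℂ | w ^ n = 1}.Finite := by
    refine ((Polynomial.nthRoots n (1 : ℂ)).toFinset.finite_toSet).subset fun w hw => ?_
    simpa [Polynomial.mem_nthRoots hn] using hw
  have hpre : (Set.range f).Subsingleton :=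
    (isPreconnected_range hf).isDiscrete_iff_subsingleton.1
      (hfin.subset (by rintro _ ⟨z, rfl⟩; exact h z)).isDiscrete
  rw [← h0]
  exact hpre ⟨z, rfl⟩ ⟨0, rfl⟩

variable {Ω : Type*} [MeasurableSpace Ω] {P : Measure Ω} {a q : ℝ} {Λ : Measure ℝ} {ξ : ℝ≥0 → Ω → ℝ}

lemma IsLevyProcess.measurable_skeletonStep (hξ : IsLevyProcess a q Λ ξ P) (n k : ℕ) :
    Measurable (skeletonStep ξ n k) :=
  (hξ.measurable _).sub (hξ.measurable _)

lemma IsLevyProcess.iIndepFun_skeletonStep (hξ : IsLevyProcess a q Λ ξ P) (n : ℕ) :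
    iIndepFun (fun k => skeletonStep ξ n k) P := by
  have hm : Monotone fun k : ℕ => (k : ℝ≥0) / n := fun i j hij => by
    dsimp only
    gcongr
  have := hξ.indep_increments.nat hm
  simp only [Nat.cast_add, Nat.cast_one] at this
  exact this

lemma IsLevyProcess.map_skeletonStep (hξ : IsLevyProcess a q Λ ξ P) (n k : ℕ) :
    P.map (skeletonStep ξ n k) = P.map (ξ (1 / n)) := by
  have := (hξ.stationary_increments ((k : ℝ≥0) / n) (1 / n)).map_eq
  rwa [← add_div] at this

lemma charFun_sum_smul [IsProbabilityMeasure P] {X : ℕ → Ω → ℝ} (hX : ∀ k, Measurable (X k))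
    (hind : iIndepFun X P) (A : ℕ → ℝ) (n : ℕ) :
    ∫ ω, Complex.exp (Complex.I * ((∑ k ∈ Finset.range n, A k * X k ω : ℝ) : ℂ)) ∂P
      = ∏ k ∈ Finset.range n, charFun (P.map (X k)) (A k) := by
  have hi : iIndepFun (fun k ω => Complex.exp (Complex.I * ((A k * X k ω : ℝ) : ℂ))) P :=
    hind.comp (fun k x => Complex.exp (Complex.I * ((A k * x : ℝ) : ℂ))) fun k => by fun_prop
  have hr := hi.precomp (g := fun k : Fin n => (k : ℕ)) Fin.val_injective
  have := hr.integral_fun_prod_eq_prod_integral (fun k => by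
    have := hX k
    exact (by fun_prop : Measurable fun ω =>
      Complex.exp (Complex.I * ((A k * X k ω : ℝ) : ℂ))).aestronglyMeasurable)
  rw [← Fin.prod_univ_eq_prod_range]
  refine Eq.trans (integral_congr_ae (ae_of_all _ fun ω => ?_))
    (this.trans (Finset.prod_congr rfl fun k _ => ?_))
  · beta_reduce
    rw [← Complex.exp_sum, ← Finset.mul_sum, ← Fin.sum_univ_eq_sum_range (fun k => A k * X k ω)]
    push_cast; rfl
  · rw [charFun_apply_real, integral_map (hX _).aemeasurable (by fun_prop)]
    refine integral_congr_ae (ae_of_all _ fun ω => ?_)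
    push_cast
    ring_nf

/-- Both sides are continuous in `z` and have the same `n`-th power, by stationarity and
independence of the increments over a time interval of length `1`. -/
lemma IsLevyProcess.charFun_one_div [IsProbabilityMeasure P] (hξ : IsLevyProcess a q Λ ξ P)
    {n : ℕ} (hn : 0 < n) (z : ℝ) :
    charFun (P.map (ξ (1 / n))) z = Complex.exp (levyExponent a q Λ z / n) := by
  have hm := hξ.measurable
  have hpr : IsProbabilityMeasure (P.map (ξ (1 / n))) :=
    Measure.isProbabilityMeasure_map (hm _).aemeasurable
  have hn' : (n : ℝ≥0) ≠ 0 := by exact_mod_cast hn.ne'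
  have hnC : (n : ℂ) ≠ 0 := by exact_mod_cast hn.ne'
  have hpow : ∀ z, charFun (P.map (ξ (1 / n))) z ^ n = Complex.exp (levyExponent a q Λ z) := by
    intro z
    have h := charFun_sum_smul (hξ.measurable_skeletonStep n) (hξ.iIndepFun_skeletonStep n)
      (fun _ => z) n
    simp_rw [hξ.map_skeletonStep, Finset.prod_const, Finset.card_range] at h
    rw [← h, ← hξ.charFun_one]
    refine integral_congr_ae ?_
    filter_upwards [hξ.start] with ω hω
    have : ∑ k ∈ Finset.range n, z * skeletonStep ξ n k ω = z * ξ 1 ω := by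
      rw [← Finset.mul_sum]
      unfold skeletonStep
      have := Finset.sum_range_sub (fun k : ℕ => ξ ((k : ℝ≥0) / n) ω) n
      push_cast at this
      rw [this, div_self hn', zero_div, hω, sub_zero]
    rw [this]
    push_cast
    ring_nf
  have key := eq_one_of_pow_eq_one
    (f := fun z => charFun (P.map (ξ (1 / n))) z * Complex.exp (-(levyExponent a q Λ z / n)))
    (by
      have := continuous_levyExponent a q hξ.isLevyMeasure
      have h2 : Continuous (charFun (P.map (ξ (1 / n)))) := by fun_prop
      fun_prop)
    (by simp [levyExponent_zero, -one_div]) hn (fun z => by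
      rw [mul_pow, hpow, ← Complex.exp_nat_mul, ← Complex.exp_add]
      rw [show levyExponent a q Λ z + n * -(levyExponent a q Λ z / n) = 0 by field_simp; ring]
      simp) z
  rw [Complex.exp_neg] at key
  exact (mul_inv_eq_one₀ (Complex.exp_ne_zero _)).1 key

/-- The characteristic function of a linear combination of increments of the `n`-skeleton. -/
lemma IsLevyProcess.charFun_sum_skeletonStep [IsProbabilityMeasure P]
    (hξ : IsLevyProcess a q Λ ξ P) {n : ℕ} (hn : 0 < n) (A : ℕ → ℝ) :
    ∫ ω, Complex.exp (Complex.I *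
        ((∑ k ∈ Finset.range n, A k * skeletonStep ξ n k ω : ℝ) : ℂ)) ∂P
      = Complex.exp ((n : ℂ)⁻¹ * ∑ k ∈ Finset.range n, levyExponent a q Λ (A k)) := by
  rw [charFun_sum_smul (hξ.measurable_skeletonStep n) (hξ.iIndepFun_skeletonStep n)]
  simp_rw [hξ.map_skeletonStep, hξ.charFun_one_div hn]
  rw [← Complex.exp_sum, Finset.mul_sum]
  congr 1
  exact Finset.sum_congr rfl fun k _ => by ring

end

section

/-! ### The reinforcement noise and its resampling -/

/-- Redrawing one coordinate of an infinite product measure does not change the law. -/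
lemma measurePreserving_update_infinitePi {X : ℕ → Type*} [∀ i, MeasurableSpace (X i)]
    (μ : ∀ i, Measure (X i)) [∀ i, IsProbabilityMeasure (μ i)] (i : ℕ) :
    MeasurePreserving (fun x : (∀ j, X j) × X i => Function.update x.1 i x.2)
      ((Measure.infinitePi μ).prod (μ i)) (Measure.infinitePi μ) := by
  have hm : Measurable (fun x : (∀ j, X j) × X i => Function.update x.1 i x.2) := by
    refine measurable_pi_iff.2 fun j => ?_
    by_cases h : j = i
    · subst h; simpa using measurable_snd
    · simp only [Function.update_of_ne h]; fun_prop
  refine ⟨hm, Measure.eq_infinitePi _ fun s t ht => ?_⟩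
  rw [Measure.map_apply hm (.pi s.countable_toSet fun j _ => ht j)]
  by_cases hi : i ∈ s
  · have : (fun x : (∀ j, X j) × X i => Function.update x.1 i x.2) ⁻¹' (s : Set ℕ).pi t
        = ((s.erase i : Finset ℕ) : Set ℕ).pi t ×ˢ t i := by
      ext ⟨x, y⟩
      simp only [Set.mem_preimage, Set.mem_pi, Finset.mem_coe, Set.mem_prod, Finset.mem_erase]
      refine ⟨fun h => ⟨fun j hj => ?_, by simpa using h i hi⟩, fun h j hj => ?_⟩
      · simpa [Function.update_of_ne hj.1] using h j hj.2
      · by_cases hji : j = i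
        · subst hji; simpa using h.2
        · simpa [Function.update_of_ne hji] using h.1 j ⟨hji, hj⟩
    rw [this, Measure.prod_prod, Measure.infinitePi_pi _ (fun j _ => ht j),
      Finset.prod_erase_mul _ _ hi]
  · have : (fun x : (∀ j, X j) × X i => Function.update x.1 i x.2) ⁻¹' (s : Set ℕ).pi t
        = (s : Set ℕ).pi t ×ˢ Set.univ := by
      ext ⟨x, y⟩
      simp only [Set.mem_preimage, Set.mem_pi, Finset.mem_coe, Set.mem_prod, Set.mem_univ, and_true]
      refine forall₂_congr fun j hj => ?_
      rw [Function.update_of_ne (by rintro rfl; exact hi hj)]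
    rw [this, Measure.prod_prod, Measure.infinitePi_pi _ (fun j _ => ht j), measure_univ, mul_one]

/-- A realization of the inputs of the reinforcement algorithm. -/
abbrev Noise : Type := (ℕ → Bool) × ((k : ℕ) → Fin (k + 1))

/-- The Bernoulli law with parameter `p`. -/
noncomputable def coin (p : ℝ) : Measure Bool :=
  ENNReal.ofReal p • Measure.dirac true + ENNReal.ofReal (1 - p) • Measure.dirac false

/-- The uniform law on the `k + 1` element set `{0, …, k}`. -/
noncomputable def unif (k : ℕ) : Measure (Fin (k + 1)) := ((k : ℝ≥0∞) + 1)⁻¹ • Measure.count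

/-- The law of the inputs of the reinforcement algorithm. -/
noncomputable def noiseMeasure (p : ℝ) : Measure Noise :=
  (Measure.infinitePi fun _ => coin p).prod (Measure.infinitePi unif)

variable {p : ℝ}

instance [hp : Fact (p ∈ Set.Ioo (0 : ℝ) 1)] : IsProbabilityMeasure (coin p) := by
  refine ⟨?_⟩
  have h := hp.out
  simp only [coin, Measure.coe_add, Measure.coe_smul, Pi.add_apply, Pi.smul_apply, measure_univ,
    smul_eq_mul, mul_one]
  rw [← ENNReal.ofReal_add h.1.le (by linarith [h.2])]
  simp

instance (k : ℕ) : IsProbabilityMeasure (unif k) := by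
  refine ⟨?_⟩
  simp only [unif, Measure.coe_smul, Pi.smul_apply, smul_eq_mul, Measure.count_univ]
  simp only [ENat.card_eq_coe_fintype_card, Fintype.card_fin]
  norm_num
  exact ENNReal.inv_mul_cancel (by simp) (by finiteness)

instance [Fact (p ∈ Set.Ioo (0 : ℝ) 1)] : IsProbabilityMeasure (noiseMeasure p) := by
  unfold noiseMeasure; infer_instance

lemma IsReinforcementNoise.map_eq {Ω : Type*} [MeasurableSpace Ω] {P : Measure Ω}
    [IsProbabilityMeasure P] [hp : Fact (p ∈ Set.Ioo (0 : ℝ) 1)]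
    {ε : ℕ → Ω → Bool} {U : (k : ℕ) → Ω → Fin (k + 1)} (h : IsReinforcementNoise p ε U P) :
    P.map (fun ω => (((fun k => ε k ω), (fun k => U k ω)) : Noise)) = noiseMeasure p := by
  have hε := h.measurable_bernoulli
  have hU := h.measurable_uniform
  rw [(indepFun_iff_map_prod_eq_prod_map_map (by fun_prop) (by fun_prop)).1
    h.indep_bernoulli_uniform]
  rw [(iIndepFun_iff_map_fun_eq_infinitePi_map hε).1 h.indep_bernoulli,
    (iIndepFun_iff_map_fun_eq_infinitePi_map hU).1 h.indep_uniform, noiseMeasure]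
  congr 2
  · funext k
    have hpr : IsProbabilityMeasure (P.map (ε k)) :=
      Measure.isProbabilityMeasure_map (hε k).aemeasurable
    have ht : P.map (ε k) {true} = coin p {true} := by
      rw [Measure.map_apply (hε k) (measurableSet_singleton _)]
      simpa [coin, Set.preimage] using h.law_bernoulli k
    have hf : P.map (ε k) {false} = coin p {false} := by
      have : ({false} : Set Bool) = {true}ᶜ := by ext b; cases b <;> simp
      rw [this, prob_compl_eq_one_sub (measurableSet_singleton _),
        prob_compl_eq_one_sub (measurableSet_singleton _), ht]
    refine Measure.ext_of_singleton fun b => ?_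
    cases b
    · exact hf
    · exact ht
  · funext k
    refine Measure.ext_of_singleton fun i => ?_
    rw [Measure.map_apply (hU k) (measurableSet_singleton _)]
    simpa [unif, Set.preimage] using h.law_uniform k i

/-- `w` and `w'` provide the same inputs for the steps with numbers `1, …, k`. -/
def AgreeBelow (k : ℕ) (w w' : Noise) : Prop :=
  ∀ j < k, w.1 (j + 1) = w'.1 (j + 1) ∧ w.2 j = w'.2 j

/-- `f` only depends on the inputs for the steps with numbers `1, …, k`. -/
def DependsBelow {β : Type*} (k : ℕ) (f : Noise → β) : Prop :=
  ∀ w w', AgreeBelow k w w' → f w = f w'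

lemma AgreeBelow.mono {k m : ℕ} (h : k ≤ m) {w w' : Noise} (hw : AgreeBelow m w w') :
    AgreeBelow k w w' := fun j hj => hw j (hj.trans_le h)

/-- A function of finitely many inputs factors through a finite type. -/
lemma DependsBelow.exists_factor {β : Type*} {k : ℕ} {f : Noise → β} (hf : DependsBelow k f) :
    ∃ (π : Noise → (Fin k → Bool) × ((j : Fin k) → Fin (j + 1)))
      (g : (Fin k → Bool) × ((j : Fin k) → Fin (j + 1)) → β), Measurable π ∧ f = g ∘ π := by
  refine ⟨fun w => (fun j => w.1 (j + 1), fun j => w.2 j), fun v => f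
    (fun j => if h : j - 1 < k then v.1 ⟨j - 1, h⟩ else true,
      fun j => if h : j < k then v.2 ⟨j, h⟩ else 0), by fun_prop, ?_⟩
  funext w
  refine hf _ _ fun j hj => ?_
  simp [hj]

lemma DependsBelow.measurable {β : Type*} [MeasurableSpace β] {k : ℕ} {f : Noise → β}
    (hf : DependsBelow k f) : Measurable f := by
  obtain ⟨π, g, hπ, rfl⟩ := hf.exists_factor
  exact (measurable_of_finite g).comp hπ

lemma DependsBelow.integrable [Fact (p ∈ Set.Ioo (0 : ℝ) 1)] {E : Type*} [NormedAddCommGroup E]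
    [MeasurableSpace E] [BorelSpace E] [SecondCountableTopology E]
    {k : ℕ} {f : Noise → E} (hf : DependsBelow k f) :
    Integrable f (noiseMeasure p) := by
  obtain ⟨π, g, hπ, rfl⟩ := hf.exists_factor
  obtain ⟨C, hC⟩ := (Set.finite_range fun v => ‖g v‖).bddAbove
  exact Integrable.of_bound ((measurable_of_finite g).comp hπ).aestronglyMeasurable C
    (ae_of_all _ fun w => hC ⟨π w, rfl⟩)

/-- Replace the inputs for step `k + 1`. -/
def resample (k : ℕ) (w : Noise) (v : Bool × Fin (k + 1)) : Noise :=
  (Function.update w.1 (k + 1) v.1, Function.update w.2 k v.2)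

lemma agreeBelow_resample (k : ℕ) (w : Noise) (v : Bool × Fin (k + 1)) :
    AgreeBelow k (resample k w v) w := fun j hj => by
  simp [resample, hj.ne]

lemma AgreeBelow.resample {n k : ℕ} {w w' : Noise} (h : AgreeBelow n w w') (v : Bool × Fin (k + 1)) :
    AgreeBelow n (resample k w v) (NoiseReinforced.resample k w' v) := fun j hj => by
  by_cases hjk : j = k
  · subst hjk; simp [NoiseReinforced.resample]
  · simp [NoiseReinforced.resample, hjk, h j hj]

lemma resample_resample (k : ℕ) (w : Noise) (v v' : Bool × Fin (k + 1)) :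
    resample k (resample k w v) v' = resample k w v' := by
  simp [resample]

lemma resample_comm {k n : ℕ} (h : k ≠ n) (w : Noise) (v : Bool × Fin (k + 1))
    (v' : Bool × Fin (n + 1)) :
    resample n (resample k w v) v' = resample k (resample n w v') v := by
  unfold resample
  refine Prod.ext ?_ ?_
  · exact Function.update_comm (by omega) _ _ _
  · exact Function.update_comm h _ _ _

lemma DependsBelow.resample {β : Type*} {n k : ℕ} {f : Noise → β} (hf : DependsBelow n f)
    (v : Bool × Fin (k + 1)) : DependsBelow n fun w => f (resample k w v) :=
  fun _ _ h => hf _ _ (h.resample v)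

/-- Redrawing the inputs of one step does not change expectations. -/
lemma integral_resample [Fact (p ∈ Set.Ioo (0 : ℝ) 1)] {n : ℕ} {f : Noise → ℝ}
    (hf : DependsBelow n f) (k : ℕ) :
    ∫ w, f w ∂noiseMeasure p
      = ∫ w, ∫ v, f (resample k w v) ∂(coin p).prod (unif k) ∂noiseMeasure p := by
  have hd1 : ∀ b : Bool, DependsBelow n fun w : Noise => f (Function.update w.1 (k + 1) b, w.2) := by
    intro b w w' h
    refine hf _ _ fun j hj => ⟨?_, (h j hj).2⟩
    by_cases hjk : j = k
    · subst hjk; simp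
    · simp [hjk, (h j hj).1]
  have hd2 : DependsBelow n fun w : Noise => ∫ b, f (Function.update w.1 (k + 1) b, w.2) ∂coin p :=
    fun w w' h => integral_congr_ae (ae_of_all _ fun b => hd1 b w w' h)
  have step1 : ∫ w, f w ∂noiseMeasure p
      = ∫ w, ∫ b, f (Function.update w.1 (k + 1) b, w.2) ∂coin p ∂noiseMeasure p := by
    unfold noiseMeasure
    rw [integral_prod_symm _ hf.integrable, integral_prod_symm _ hd2.integrable]
    refine integral_congr_ae (ae_of_all _ fun u => ?_)
    have hmp := measurePreserving_update_infinitePi (fun _ : ℕ => coin p) (k + 1)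
    have hfm : Measurable f := hf.measurable
    have hfi : ∀ u : (k : ℕ) → Fin (k + 1),
        Integrable (fun e => f (e, u)) (Measure.infinitePi fun _ : ℕ => coin p) := by
      intro u
      obtain ⟨π, g, hπ, rfl⟩ := hf.exists_factor
      obtain ⟨C, hC⟩ := (Set.finite_range fun v => ‖g v‖).bddAbove
      exact Integrable.of_bound (hfm.comp measurable_prodMk_right).aestronglyMeasurable C
        (ae_of_all _ fun w => hC ⟨π (w, u), rfl⟩)
    dsimp only
    conv_lhs => rw [← hmp.map_eq]
    rw [integral_map (f := fun e => f (e, u)) hmp.measurable.aemeasurable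
      (hfm.comp measurable_prodMk_right).aestronglyMeasurable]
    rw [integral_prod]
    exact hmp.integrable_comp_of_integrable (hfi u)
  have step2 : ∀ g : Noise → ℝ, DependsBelow n g → ∫ w, g w ∂noiseMeasure p
      = ∫ w, ∫ v, g (w.1, Function.update w.2 k v) ∂unif k ∂noiseMeasure p := by
    intro g hg
    have hd3 : DependsBelow n fun w : Noise => ∫ v, g (w.1, Function.update w.2 k v) ∂unif k := by
      intro w w' h
      refine integral_congr_ae (ae_of_all _ fun v => hg _ _ fun j hj => ⟨(h j hj).1, ?_⟩)
      by_cases hjk : j = k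
      · subst hjk; simp
      · simp [hjk, (h j hj).2]
    unfold noiseMeasure
    rw [integral_prod _ hg.integrable, integral_prod _ hd3.integrable]
    refine integral_congr_ae (ae_of_all _ fun e => ?_)
    have hmp := measurePreserving_update_infinitePi unif k
    have hgm : Measurable g := hg.measurable
    have hgi : ∀ e : ℕ → Bool, Integrable (fun u => g (e, u)) (Measure.infinitePi unif) := by
      intro e
      obtain ⟨π, g', hπ, rfl⟩ := hg.exists_factor
      obtain ⟨C, hC⟩ := (Set.finite_range fun v => ‖g' v‖).bddAbove
      exact Integrable.of_bound (hgm.comp measurable_prodMk_left).aestronglyMeasurable C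
        (ae_of_all _ fun w => hC ⟨π (e, w), rfl⟩)
    dsimp only
    conv_lhs => rw [← hmp.map_eq]
    rw [integral_map (f := fun u => g (e, u)) hmp.measurable.aemeasurable
      (hgm.comp measurable_prodMk_left).aestronglyMeasurable]
    rw [integral_prod]
    exact hmp.integrable_comp_of_integrable (hgi e)
  rw [step1, step2 _ hd2]
  refine integral_congr_ae (ae_of_all _ fun w => ?_)
  dsimp only
  rw [integral_prod_symm _ Integrable.of_finite]
  rfl

lemma integral_coin_prod_unif [hp : Fact (p ∈ Set.Ioo (0 : ℝ) 1)] (k : ℕ)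
    (H : Bool × Fin (k + 1) → ℝ) :
    ∫ v, H v ∂(coin p).prod (unif k)
      = p / (k + 1) * ∑ u, H (true, u) + (1 - p) / (k + 1) * ∑ u, H (false, u) := by
  have h := hp.out
  have hu : ∀ F : Fin (k + 1) → ℝ, ∫ u, F u ∂unif k = (k + 1 : ℝ)⁻¹ * ∑ u, F u := by
    intro F
    unfold unif
    rw [integral_smul_measure, integral_fintype Integrable.of_finite]
    simp only [Measure.real, Measure.count_singleton, ENNReal.toReal_one, one_mul, smul_eq_mul,
      ENNReal.toReal_inv]
    norm_cast
  rw [integral_prod _ Integrable.of_finite]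
  simp_rw [hu]
  unfold coin
  rw [integral_add_measure (Integrable.of_finite.smul_measure (by finiteness))
    (Integrable.of_finite.smul_measure (by finiteness)), integral_smul_measure,
    integral_smul_measure, integral_dirac, integral_dirac, ENNReal.toReal_ofReal h.1.le,
    ENNReal.toReal_ofReal (by linarith [h.2])]
  simp only [smul_eq_mul]
  ring

end

section

/-! ### Bounded differences -/

variable {p : ℝ}

/-- Variance bound for functions with bounded differences: the inputs are redrawn one step at a
time, from the last one to the first one, and each redrawing accounts for at most `c ^ 2`. -/
lemma variance_le_of_resample [hp : Fact (p ∈ Set.Ioo (0 : ℝ) 1)] {c : ℝ} (n : ℕ) (F : Noise → ℝ)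
    (hF : DependsBelow n F) (hc : ∀ k w v, |F (resample k w v) - F w| ≤ c) :
    ∫ w, (F w - ∫ w', F w' ∂noiseMeasure p) ^ 2 ∂noiseMeasure p ≤ n * c ^ 2 := by
  induction n generalizing F with
  | zero =>
    have : ∀ w w', F w = F w' := fun w w' => hF w w' fun j hj => absurd hj (Nat.not_lt_zero j)
    have h0 : ∀ w, ∫ w', F w' ∂noiseMeasure p = F w := fun w => by
      rw [integral_congr_ae (ae_of_all _ fun w' => this w' w)]; simp
    rw [integral_congr_ae (g := fun _ => (0 : ℝ)) (ae_of_all _ fun w => by rw [h0 w]; ring)]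
    simp
  | succ n ih =>
    set ν := (coin p).prod (unif n)
    set F' : Noise → ℝ := fun w => ∫ v, F (resample n w v) ∂ν with hF'
    set m := ∫ w', F w' ∂noiseMeasure p with hm
    have hm' : ∫ w, F' w ∂noiseMeasure p = m := (integral_resample hF n).symm
    have hdep : DependsBelow n F' := by
      intro w w' h
      refine integral_congr_ae (ae_of_all _ fun v => hF _ _ fun j hj => ?_)
      by_cases hjn : j = n
      · subst hjn; simp [resample]
      · exact (h.resample v) j (by omega)
    have hdiff : ∀ k w v, |F' (resample k w v) - F' w| ≤ c := by
      intro k w v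
      have hc0 : 0 ≤ c := (abs_nonneg _).trans (hc k w v)
      by_cases hk : k = n
      · subst hk; simp [hF', resample_resample, hc0]
      · rw [hF', ← integral_sub Integrable.of_finite Integrable.of_finite]
        have := norm_integral_le_of_norm_le_const (μ := ν) (C := c)
          (f := fun v' => F (resample n (resample k w v) v') - F (resample n w v'))
          (ae_of_all _ fun v' => by
            rw [resample_comm hk, Real.norm_eq_abs]; exact hc k _ v)
        simpa using this
    have hih := ih F' hdep hdiff
    rw [hm'] at hih
    have hsq : DependsBelow (n + 1) fun w => (F w - m) ^ 2 := fun w w' h => by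
      simp only [hF w w' h]
    have hsq' : DependsBelow n fun w => (F' w - m) ^ 2 := fun w w' h => by
      simp only [hdep w w' h]
    rw [integral_resample hsq n]
    have hin : ∀ w, ∫ v, (F (resample n w v) - m) ^ 2 ∂ν ≤ c ^ 2 + (F' w - m) ^ 2 := by
      intro w
      have h1 : ∀ v, |F (resample n w v) - F' w| ≤ c := by
        intro v
        have := norm_integral_le_of_norm_le_const (μ := ν) (C := c)
          (f := fun v' => F (resample n w v) - F (resample n w v'))
          (ae_of_all _ fun v' => by
            rw [← resample_resample n w v v', Real.norm_eq_abs, abs_sub_comm]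
            exact hc n _ v')
        rw [integral_sub Integrable.of_finite Integrable.of_finite] at this
        simpa using this
      have h2 : ∀ v, (F (resample n w v) - m) ^ 2 = (F (resample n w v) - F' w) ^ 2
          + (2 * (F' w - m) * (F (resample n w v) - F' w) + (F' w - m) ^ 2) := fun v => by ring
      simp_rw [h2]
      rw [integral_add Integrable.of_finite Integrable.of_finite,
        integral_add Integrable.of_finite Integrable.of_finite, integral_const_mul,
        integral_sub Integrable.of_finite Integrable.of_finite]
      have h3 : ∫ v, (F (resample n w v) - F' w) ^ 2 ∂ν ≤ c ^ 2 := by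
        calc ∫ v, (F (resample n w v) - F' w) ^ 2 ∂ν ≤ ∫ v, c ^ 2 ∂ν :=
              integral_mono Integrable.of_finite Integrable.of_finite fun v =>
                sq_le_sq' (abs_le.1 (h1 v)).1 (abs_le.1 (h1 v)).2
          _ = c ^ 2 := by simp
      have h4 : ∫ v, F (resample n w v) ∂ν - ∫ v, F' w ∂ν = 0 := by simp [hF']
      rw [h4]
      simpa using h3
    calc ∫ w, ∫ v, (F (resample n w v) - m) ^ 2 ∂ν ∂noiseMeasure p
        ≤ ∫ w, (c ^ 2 + (F' w - m) ^ 2) ∂noiseMeasure p := by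
          refine integral_mono ?_ ((integrable_const _).add hsq'.integrable) hin
          refine DependsBelow.integrable (k := n + 1) fun w w' h => ?_
          exact integral_congr_ae (ae_of_all _ fun v => hsq.resample v w w' h)
      _ = c ^ 2 + ∫ w, (F' w - m) ^ 2 ∂noiseMeasure p := by
          rw [integral_add (integrable_const _) hsq'.integrable]; simp
      _ ≤ (n + 1 : ℕ) * c ^ 2 := by push_cast; linarith

/-- The `L¹` form of the variance bound. -/
lemma integral_abs_sub_le_of_resample [hp : Fact (p ∈ Set.Ioo (0 : ℝ) 1)] {c : ℝ} (n : ℕ)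
    (F : Noise → ℝ) (hF : DependsBelow n F) (hc : ∀ k w v, |F (resample k w v) - F w| ≤ c) :
    ∫ w, |F w - ∫ w', F w' ∂noiseMeasure p| ∂noiseMeasure p ≤ √n * c := by
  set m := ∫ w', F w' ∂noiseMeasure p
  have hc0 : 0 ≤ c := (abs_nonneg _).trans (hc 0 (fun _ => true, fun _ => 0) (true, 0))
  have hv := variance_le_of_resample (p := p) n F hF hc
  have hd : DependsBelow n fun w => |F w - m| := fun w w' h => by simp only [hF w w' h]
  have hd2 : DependsBelow n fun w => (F w - m) ^ 2 := fun w w' h => by simp only [hF w w' h]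
  set A := ∫ w, |F w - m| ∂noiseMeasure p
  have hA : A ^ 2 ≤ ∫ w, (F w - m) ^ 2 ∂noiseMeasure p := by
    have h0 : 0 ≤ ∫ w, (|F w - m| - A) ^ 2 ∂noiseMeasure p := integral_nonneg fun w => sq_nonneg _
    have h1 : ∀ w, (|F w - m| - A) ^ 2 = (F w - m) ^ 2 + (-(2 * A) * |F w - m| + A ^ 2) := fun w => by
      rw [← sq_abs (F w - m)]; ring
    simp_rw [h1] at h0
    have hd3 : Integrable (fun w => -(2 * A) * |F w - m| + A ^ 2) (noiseMeasure p) :=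
      (hd.integrable.const_mul _).add (integrable_const _)
    rw [integral_add hd2.integrable hd3,
      integral_add (hd.integrable.const_mul _) (integrable_const _), integral_const_mul] at h0
    simp only [integral_const, probReal_univ, one_smul] at h0
    nlinarith
  refine abs_le_of_sq_le_sq' (a := A) ?_ (by positivity) |>.2
  rw [mul_pow, Real.sq_sqrt (Nat.cast_nonneg n)]
  exact hA.trans hv

/-! ### Families of repeated steps -/

/-- The number of the fresh step which the reinforced step `k` repeats. -/
def root (w : Noise) : ℕ → ℕ
  | 0 => 0
  | k + 1 => if w.1 (k + 1) = true then root w (w.2 k) else k + 1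
termination_by m => m
decreasing_by exact (w.2 k).isLt

lemma root_zero (w : Noise) : root w 0 = 0 := by rw [root]

lemma root_succ (w : Noise) (k : ℕ) :
    root w (k + 1) = if w.1 (k + 1) = true then root w (w.2 k) else k + 1 := by rw [root]

lemma reinforcedStep_eq (x : ℕ → ℝ) (w : Noise) (k : ℕ) :
    reinforcedStep x w.1 w.2 k = x (root w k) := by
  induction k using Nat.strong_induction_on with
  | _ k ih =>
    cases k with
    | zero => rw [reinforcedStep, root_zero]
    | succ k =>
      rw [reinforcedStep, root_succ]
      split_ifs
      · exact ih _ (w.2 k).isLt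
      · rfl

lemma root_le (w : Noise) (k : ℕ) : root w k ≤ k := by
  induction k using Nat.strong_induction_on with
  | _ k ih =>
    cases k with
    | zero => rw [root_zero]
    | succ k =>
      rw [root_succ]
      split_ifs
      · exact (ih _ (w.2 k).isLt).trans (w.2 k).isLt.le
      · rfl

lemma root_congr {w w' : Noise} {k : ℕ} (h : AgreeBelow k w w') : root w k = root w' k := by
  induction k using Nat.strong_induction_on with
  | _ k ih =>
    cases k with
    | zero => rw [root_zero, root_zero]
    | succ k =>
      rw [root_succ, root_succ, (h k (Nat.lt_succ_self k)).1, (h k (Nat.lt_succ_self k)).2]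
      split_ifs
      · exact ih _ (w'.2 k).isLt (h.mono (w'.2 k).isLt.le)
      · rfl

/-- Redrawing the inputs of step `k + 1` moves a whole subfamily from one root to another one. -/
lemma root_resample (k : ℕ) (w : Noise) (v : Bool × Fin (k + 1)) (m : ℕ) :
    root (resample k w v) m = root w m ∨
      (root w m = root w (k + 1) ∧ root (resample k w v) m = root (resample k w v) (k + 1)) := by
  induction m using Nat.strong_induction_on with
  | _ m ih =>
    cases m with
    | zero => left; rw [root_zero, root_zero]
    | succ m =>
      by_cases hmk : m = k
      · subst hmk; right; exact ⟨rfl, rfl⟩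
      · rw [root_succ w, root_succ (resample k w v)]
        have h1 : (resample k w v).1 (m + 1) = w.1 (m + 1) := by simp [resample, hmk]
        have h2 : (resample k w v).2 m = w.2 m := by simp [resample, hmk]
        rw [h1, h2]
        split_ifs
        · exact ih _ (w.2 m).isLt
        · left; rfl

/-- The number of reinforced steps, among the steps `0, …, m - 1`, which repeat step `i`. -/
def familySize (w : Noise) (i m : ℕ) : ℕ := ((Finset.range m).filter fun k => root w k = i).card

lemma familySize_succ (w : Noise) (i m : ℕ) :
    familySize w i (m + 1) = familySize w i m + if root w m = i then 1 else 0 := by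
  unfold familySize
  rw [Finset.range_add_one, Finset.filter_insert]
  split_ifs
  · rw [Finset.card_insert_of_notMem (by simp)]
  · rfl

lemma familySize_eq_zero {i m : ℕ} (w : Noise) (h : m ≤ i) : familySize w i m = 0 := by
  unfold familySize
  rw [Finset.card_eq_zero, Finset.filter_eq_empty_iff]
  intro k hk
  have := root_le w k
  have := Finset.mem_range.1 hk
  omega

lemma familySize_congr {w w' : Noise} {m : ℕ} (h : AgreeBelow m w w') (i k : ℕ) (hk : k ≤ m + 1) :
    familySize w i k = familySize w' i k := by
  unfold familySize
  congr 1
  refine Finset.filter_congr fun j hj => ?_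
  rw [root_congr (h.mono (by have := Finset.mem_range.1 hj; omega))]

lemma familySize_resample {k : ℕ} {w : Noise} {v : Bool × Fin (k + 1)} {i : ℕ}
    (h1 : i ≠ root w (k + 1)) (h2 : i ≠ root (resample k w v) (k + 1)) (m : ℕ) :
    familySize (resample k w v) i m = familySize w i m := by
  unfold familySize
  congr 1
  refine Finset.filter_congr fun j _ => ?_
  rcases root_resample k w v j with h | ⟨ha, hb⟩
  · rw [h]
  · rw [ha, hb]
    exact ⟨fun h => absurd h.symm h2, fun h => absurd h.symm h1⟩

lemma sum_familySize_mul (x : ℕ → ℝ) (w : Noise) {m n : ℕ} (hm : m ≤ n) :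
    ∑ k ∈ Finset.range m, reinforcedStep x w.1 w.2 k
      = ∑ i ∈ Finset.range n, familySize w i m * x i := by
  simp_rw [reinforcedStep_eq]
  have hmap : ∀ k ∈ Finset.range m, root w k ∈ Finset.range n := fun k hk =>
    Finset.mem_range.2 (((root_le w k).trans_lt (Finset.mem_range.1 hk)).trans_le hm)
  rw [← Finset.sum_fiberwise_of_maps_to hmap]
  refine Finset.sum_congr rfl fun i _ => ?_
  rw [Finset.sum_congr rfl (g := fun _ => x i) fun k hk => by rw [(Finset.mem_filter.1 hk).2]]
  rw [Finset.sum_const, nsmul_eq_mul]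
  rfl

/-- Since redrawing one step only affects two families, sums over the families of a bounded
functional concentrate around their mean. -/
lemma integral_abs_sum_familySize_sub_le [hp : Fact (p ∈ Set.Ioo (0 : ℝ) 1)] {k : ℕ} (n : ℕ)
    (M : Fin k → ℕ) (hM : ∀ j, M j ≤ n) (f : ℕ → (Fin k → ℕ) → ℝ) {B : ℝ} (hB : ∀ i y, |f i y| ≤ B) :
    ∫ w, |∑ i ∈ Finset.range n, f i (fun j => familySize w i (M j))
        - ∫ w', ∑ i ∈ Finset.range n, f i (fun j => familySize w' i (M j)) ∂noiseMeasure p|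
          ∂noiseMeasure p ≤ √n * (4 * B) := by
  refine integral_abs_sub_le_of_resample n _ ?_ ?_
  · intro w w' h
    refine Finset.sum_congr rfl fun i _ => ?_
    congr 1
    funext j
    exact familySize_congr h i _ ((hM j).trans (Nat.le_succ n))
  · intro m w v
    have hB0 : 0 ≤ B := (abs_nonneg _).trans (hB 0 fun _ => 0)
    rw [← Finset.sum_sub_distrib]
    set d : ℕ → ℝ := fun i => f i (fun j => familySize (resample m w v) i (M j))
      - f i (fun j => familySize w i (M j)) with hd
    set S : Finset ℕ := {root w (m + 1), root (resample m w v) (m + 1)}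
    have hd0 : ∀ i, i ∉ S → d i = 0 := by
      intro i hi
      simp only [S, Finset.mem_insert, Finset.mem_singleton, not_or] at hi
      simp only [hd, familySize_resample hi.1 hi.2, sub_self]
    have hd1 : ∀ i, |d i| ≤ 2 * B := fun i => by
      have h1 := abs_sub (f i (fun j => familySize (resample m w v) i (M j)))
        (f i (fun j => familySize w i (M j)))
      have h2 := hB i fun j => familySize (resample m w v) i (M j)
      have h3 := hB i fun j => familySize w i (M j)
      simp only [hd]
      linarith
    calc |∑ i ∈ Finset.range n, d i| ≤ ∑ i ∈ Finset.range n, |d i| := Finset.abs_sum_le_sum_abs _ _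
      _ = ∑ i ∈ Finset.range n ∩ S, |d i| := by
          refine (Finset.sum_subset Finset.inter_subset_left fun i hi hiS => ?_).symm
          rw [hd0 i fun h => hiS (Finset.mem_inter.2 ⟨hi, h⟩), abs_zero]
      _ ≤ ∑ i ∈ S, |d i| :=
          Finset.sum_le_sum_of_subset_of_nonneg Finset.inter_subset_right fun i _ _ => abs_nonneg _
      _ ≤ S.card • (2 * B) := Finset.sum_le_card_nsmul _ _ _ fun i _ => hd1 i
      _ ≤ 4 * B := by
          rw [nsmul_eq_mul]
          have : (S.card : ℝ) ≤ 2 := by exact_mod_cast Finset.card_le_two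
          nlinarith

end

section

/-! ### The growth of one family is a Markov chain -/

variable {p : ℝ}

/-- Given the past, step `k + 1` joins the family of `i ≤ k` with probability `p / (k + 1)` times
the current size of the family. -/
lemma integral_step_eq [hp : Fact (p ∈ Set.Ioo (0 : ℝ) 1)] {i k : ℕ} (hik : i ≤ k)
    (G : Noise → Bool → ℝ) (hG : ∀ b, DependsBelow k fun w => G w b) :
    ∫ w, G w (decide (root w (k + 1) = i)) ∂noiseMeasure p
      = ∫ w, (p * familySize w i (k + 1) / (k + 1 : ℕ) * G w true
          + (1 - p * familySize w i (k + 1) / (k + 1 : ℕ)) * G w false) ∂noiseMeasure p := by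
  have hd : DependsBelow (k + 1) fun w => G w (decide (root w (k + 1) = i)) := fun w w' h => by
    dsimp only
    rw [root_congr h]
    exact hG _ _ _ (h.mono (Nat.le_succ k))
  rw [integral_resample hd k]
  refine integral_congr_ae (ae_of_all _ fun w => ?_)
  beta_reduce
  rw [integral_coin_prod_unif]
  have hGr : ∀ v b, G (resample k w v) b = G w b := fun v b =>
    hG b _ _ (agreeBelow_resample k w v)
  have hrt : ∀ u, root (resample k w (true, u)) (k + 1) = root w u := fun u => by
    rw [root_succ, if_pos (by simp [resample])]
    have : (resample k w (true, u)).2 k = u := by simp [resample]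
    rw [this]
    exact root_congr ((agreeBelow_resample k w (true, u)).mono (by have := u.isLt; omega))
  have hrf : ∀ u, root (resample k w (false, u)) (k + 1) = k + 1 := fun u => by
    rw [root_succ, if_neg (by simp [resample])]
  simp_rw [hGr, hrt, hrf]
  have hne : ¬ (k + 1 = i) := by omega
  have hsum : ∑ u : Fin (k + 1), G w (decide (root w u = i))
      = familySize w i (k + 1) * G w true + ((k + 1 : ℕ) - familySize w i (k + 1)) * G w false := by
    rw [Fin.sum_univ_eq_sum_range (fun u => G w (decide (root w u = i)))]
    have : ∀ u, G w (decide (root w u = i))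
        = (if root w u = i then 1 else 0) * (G w true - G w false) + G w false := fun u => by
      by_cases h : root w u = i <;> simp [h]
    simp_rw [this]
    rw [Finset.sum_add_distrib, ← Finset.sum_mul, Finset.sum_boole, Finset.sum_const,
      Finset.card_range, nsmul_eq_mul]
    unfold familySize
    ring
  rw [hsum]
  simp only [hne, decide_false, Finset.sum_const, Finset.card_univ, Fintype.card_fin, nsmul_eq_mul]
  push_cast
  field_simp
  ring

/-- Step `k + 1` is fresh with probability `1 - p`. -/
lemma integral_fresh_eq [hp : Fact (p ∈ Set.Ioo (0 : ℝ) 1)] (k : ℕ) (G : ℕ → ℝ) :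
    ∫ w, G (familySize w (k + 1) (k + 2)) ∂noiseMeasure p = p * G 0 + (1 - p) * G 1 := by
  have hd : DependsBelow (k + 1) fun w => G (familySize w (k + 1) (k + 2)) := fun w w' h => by
    dsimp only
    rw [familySize_congr h _ _ le_rfl]
  rw [integral_resample hd k]
  have h0 : ∀ w : Noise, familySize w (k + 1) (k + 2) = if root w (k + 1) = k + 1 then 1 else 0 :=
    fun w => by rw [familySize_succ, familySize_eq_zero w le_rfl, zero_add]
  have ht : ∀ w u, familySize (resample k w (true, u)) (k + 1) (k + 2) = 0 := fun w u => by
    have hr : root (resample k w (true, u)) (k + 1)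
        = root (resample k w (true, u)) ((resample k w (true, u)).2 k) := by
      rw [root_succ, if_pos (by simp [resample])]
    rw [h0, hr, if_neg]
    have := root_le (resample k w (true, u)) ((resample k w (true, u)).2 k)
    have := ((resample k w (true, u)).2 k).isLt
    omega
  have hf : ∀ w u, familySize (resample k w (false, u)) (k + 1) (k + 2) = 1 := fun w u => by
    have hr : root (resample k w (false, u)) (k + 1) = k + 1 := by
      rw [root_succ, if_neg (by simp [resample])]
    rw [h0, hr, if_pos rfl]
  simp_rw [integral_coin_prod_unif, ht, hf]
  simp only [Finset.sum_const, Finset.card_univ, Fintype.card_fin, nsmul_eq_mul, integral_const,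
    probReal_univ, one_smul]
  push_cast
  field_simp

/-- The expected value of `g` at the end of `f` steps of the chain which, at time `m` and in state
`a`, jumps to `a + 1` with probability `p a / m`; the vector `y` records the states at the
observation times `M j`, and stays up to date with the chain until these are reached. -/
noncomputable def chainValue (p : ℝ) {k : ℕ} (M : Fin k → ℕ) (g : (Fin k → ℕ) → ℝ) :
    ℕ → ℕ → ℕ → (Fin k → ℕ) → ℝ
  | 0, _, _, y => g y
  | f + 1, a, m, y =>
      p * a / m * chainValue p M g f (a + 1) (m + 1) (fun j => y j + if m + 1 ≤ M j then 1 else 0)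
        + (1 - p * a / m) * chainValue p M g f a (m + 1) y

/-- An empty family stays empty. -/
lemma chainValue_zero_state {k : ℕ} (M : Fin k → ℕ) (g : (Fin k → ℕ) → ℝ) (f m : ℕ)
    (y : Fin k → ℕ) : chainValue p M g f 0 m y = g y := by
  induction f generalizing m with
  | zero => rfl
  | succ f ih => simp [chainValue, ih]

/-- The states at the observation times, recorded up to time `m`. -/
def recorded {k : ℕ} (M : Fin k → ℕ) (w : Noise) (i m : ℕ) (j : Fin k) : ℕ :=
  familySize w i (min m (M j))

lemma recorded_congr {k : ℕ} {M : Fin k → ℕ} {w w' : Noise} {m : ℕ} (h : AgreeBelow m w w')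
    (i : ℕ) : recorded M w i (m + 1) = recorded M w' i (m + 1) := by
  funext j
  exact familySize_congr h i _ (min_le_left _ _)

lemma recorded_succ {k : ℕ} (M : Fin k → ℕ) (w : Noise) (i m : ℕ) :
    recorded M w i (m + 1)
      = fun j => recorded M w i m j + if root w m = i then (if m + 1 ≤ M j then 1 else 0) else 0 := by
  funext j
  unfold recorded
  rcases le_or_gt (m + 1) (M j) with h | h
  · rw [min_eq_left h, min_eq_left (by omega), familySize_succ, if_pos h]
  · rw [min_eq_right (by omega), min_eq_right (by omega),
      if_neg (c := m + 1 ≤ M j) (by omega)]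
    simp

/-- Backward induction with the Markov property: the conditional expectation of a functional of
the recorded states is the value of the chain. -/
lemma integral_chainValue_recorded [hp : Fact (p ∈ Set.Ioo (0 : ℝ) 1)] {k : ℕ} (M : Fin k → ℕ)
    (g : (Fin k → ℕ) → ℝ) {i m : ℕ} (hi : i ≤ m) (f : ℕ) :
    ∫ w, chainValue p M g f (familySize w i (m + 1)) (m + 1) (recorded M w i (m + 1)) ∂noiseMeasure p
      = ∫ w, g (recorded M w i (m + 1 + f)) ∂noiseMeasure p := by
  induction f generalizing m with
  | zero => rfl
  | succ f ih =>
    have hstep := integral_step_eq (p := p) hi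
      (fun w b => chainValue p M g f (familySize w i (m + 1) + if b then 1 else 0) (m + 1 + 1)
        (fun j => recorded M w i (m + 1) j + if b then (if m + 1 + 1 ≤ M j then 1 else 0) else 0))
      (fun b w w' h => by
        dsimp only
        rw [familySize_congr h _ _ le_rfl, recorded_congr h])
    have hih := ih (m := m + 1) (by omega)
    rw [show m + 1 + (f + 1) = m + 1 + 1 + f by ring, ← hih]
    refine Eq.trans ?_ (hstep.symm.trans ?_)
    · simp [chainValue]
    · refine integral_congr_ae (ae_of_all _ fun w => ?_)
      beta_reduce
      rw [familySize_succ w i (m + 1), recorded_succ M w i (m + 1)]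
      simp

/-- The law of the family of a step `i ≥ 1`: it is empty with probability `p`, and otherwise
follows the chain started at time `i + 1` from state `1`. -/
lemma integral_familySize_eq [hp : Fact (p ∈ Set.Ioo (0 : ℝ) 1)] {k : ℕ} (M : Fin k → ℕ)
    (g : (Fin k → ℕ) → ℝ) {i f n : ℕ} (hi : 1 ≤ i) (hn : i + 1 + f = n) (hM : ∀ j, M j ≤ n) :
    ∫ w, g (fun j => familySize w i (M j)) ∂noiseMeasure p
      = p * g (fun _ => 0) + (1 - p) * chainValue p M g f 1 (i + 1)
          (fun j => if i + 1 ≤ M j then 1 else 0) := by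
  obtain ⟨i, rfl⟩ : ∃ i', i = i' + 1 := ⟨i - 1, by omega⟩
  have h1 := integral_chainValue_recorded (p := p) M g (le_refl (i + 1)) f
  rw [hn] at h1
  have h2 : ∀ w, recorded M w (i + 1) n = fun j => familySize w (i + 1) (M j) := fun w => by
    funext j
    rw [recorded, min_eq_right (hM j)]
  simp_rw [h2] at h1
  rw [← h1]
  have h3 : ∀ w, recorded M w (i + 1) (i + 1 + 1)
      = fun j => if i + 1 + 1 ≤ M j then familySize w (i + 1) (i + 2) else 0 := fun w => by
    funext j
    unfold recorded
    split_ifs with h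
    · rw [min_eq_left h]
    · rw [familySize_eq_zero _ (by omega)]
  have h4 := integral_fresh_eq (p := p) i (fun N => chainValue p M g f N (i + 1 + 1)
    (fun j => if i + 1 + 1 ≤ M j then N else 0))
  rw [show i + 2 = i + 1 + 1 from rfl] at h3 h4
  simp_rw [h3]
  rw [h4, chainValue_zero_state]
  simp

/-! ### Moments of the family sizes -/

/-- The function with `φ 0 = 0`, `φ 1 = 1` and `φ (N + 1) = φ N (1 + γ / N)`, that is
`Γ (N + γ) / (Γ N Γ (1 + γ))`: it is a multiple of an eigenfunction of the chain of family sizes,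
and is of the order of `N ^ γ`. -/
noncomputable def gammaMoment (γ : ℝ) : ℕ → ℝ
  | 0 => 0
  | N + 1 => ∏ j ∈ Finset.range N, (1 + γ / (j + 1 : ℕ))

lemma gammaMoment_nonneg {γ : ℝ} (hγ : 0 ≤ γ) (N : ℕ) : 0 ≤ gammaMoment γ N := by
  cases N with
  | zero => exact le_rfl
  | succ N => exact Finset.prod_nonneg fun j _ => by positivity

lemma gammaMoment_one (γ : ℝ) : gammaMoment γ 1 = 1 := by simp [gammaMoment]

lemma gammaMoment_succ {γ : ℝ} {N : ℕ} (hN : 1 ≤ N) :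
    gammaMoment γ (N + 1) = gammaMoment γ N * (1 + γ / N) := by
  obtain ⟨N, rfl⟩ : ∃ N', N = N' + 1 := ⟨N - 1, by omega⟩
  simp only [gammaMoment]
  rw [Finset.prod_range_succ]

lemma gammaMoment_step {γ c : ℝ} (N : ℕ) :
    c * N * gammaMoment γ (N + 1) + (1 - c * N) * gammaMoment γ N
      = (1 + c * γ) * gammaMoment γ N := by
  rcases Nat.eq_zero_or_pos N with rfl | hN
  · simp [gammaMoment]
  · rw [gammaMoment_succ hN]
    have : (N : ℝ) ≠ 0 := by positivity
    field_simp
    ring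

/-- `N ^ γ` is dominated by `gammaMoment γ N`. -/
lemma rpow_le_gammaMoment {γ : ℝ} (hγ : 0 < γ) (N : ℕ) :
    (N : ℝ) ^ γ ≤ (1 + γ) ^ γ * gammaMoment γ N := by
  rcases Nat.eq_zero_or_pos N with rfl | hN
  · simp [gammaMoment, hγ.ne']
  have key : ((N : ℝ) + γ) ^ γ ≤ (1 + γ) ^ γ * gammaMoment γ N := by
    induction N, hN using Nat.le_induction with
    | base => simp [gammaMoment_one]
    | succ N hN ih =>
      have hN' : (0 : ℝ) < N := by exact_mod_cast hN
      rw [gammaMoment_succ hN, ← mul_assoc]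
      have h1 : (((N + 1 : ℕ) : ℝ) + γ) ^ γ ≤ ((N : ℝ) + γ) ^ γ * (1 + γ / N) := by
        have hpos : (0 : ℝ) < N + γ := by positivity
        have h2 : ((N + 1 : ℕ) : ℝ) + γ = (N + γ) * (1 + 1 / (N + γ)) := by
          push_cast; field_simp; ring
        rw [h2, Real.mul_rpow hpos.le (by positivity)]
        refine mul_le_mul_of_nonneg_left ?_ (by positivity)
        rw [Real.rpow_def_of_pos (by positivity), ← Real.le_log_iff_exp_le (by positivity)]
        calc Real.log (1 + 1 / (N + γ)) * γ ≤ 1 / (N + γ) * γ := by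
              refine mul_le_mul_of_nonneg_right ?_ hγ.le
              have := Real.log_le_sub_one_of_pos (by positivity : 0 < 1 + 1 / ((N : ℝ) + γ))
              linarith
          _ = 1 - (1 + γ / N)⁻¹ := by field_simp; ring
          _ ≤ Real.log (1 + γ / N) := Real.one_sub_inv_le_log_of_pos (by positivity)
      exact h1.trans (mul_le_mul_of_nonneg_right ih (by positivity))
  exact (Real.rpow_le_rpow (by positivity) (by linarith) hγ.le).trans key

/-- The total of the moments of order `γ` grows at most linearly as long as `p γ < 1`. -/
lemma sum_integral_gammaMoment_le [hp : Fact (p ∈ Set.Ioo (0 : ℝ) 1)] {γ : ℝ} (hγ : 0 ≤ γ)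
    (hpγ : p * γ < 1) (m : ℕ) :
    ∑ i ∈ Finset.range m, ∫ w, gammaMoment γ (familySize w i m) ∂noiseMeasure p
      ≤ (1 - p * γ)⁻¹ * m := by
  have hC : 1 ≤ (1 - p * γ)⁻¹ := by
    rw [one_le_inv₀ (by linarith)]
    nlinarith [hp.out.1]
  induction m with
  | zero => simp
  | succ m ih =>
    have hlast : ∫ w, gammaMoment γ (familySize w m (m + 1)) ∂noiseMeasure p ≤ 1 := by
      have : ∀ w : Noise, gammaMoment γ (familySize w m (m + 1)) ≤ 1 := fun w => by
        rw [familySize_succ, familySize_eq_zero w le_rfl]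
        split_ifs
        · simp [gammaMoment_one]
        · simp [gammaMoment]
      have hd : DependsBelow m fun w => gammaMoment γ (familySize w m (m + 1)) := fun w w' h => by
        dsimp only
        rw [familySize_congr h _ _ le_rfl]
      calc _ ≤ ∫ _, (1 : ℝ) ∂noiseMeasure p := integral_mono hd.integrable (integrable_const _) this
        _ = 1 := by simp
    rw [Finset.sum_range_succ]
    rcases Nat.eq_zero_or_pos m with rfl | hm
    · simpa using hlast.trans hC
    obtain ⟨m, rfl⟩ : ∃ m', m = m' + 1 := ⟨m - 1, by omega⟩
    have hstep : ∀ i ∈ Finset.range (m + 1),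
        ∫ w, gammaMoment γ (familySize w i (m + 1 + 1)) ∂noiseMeasure p
          = (1 + p / (m + 1 : ℕ) * γ) * ∫ w, gammaMoment γ (familySize w i (m + 1)) ∂noiseMeasure p := by
      intro i hi
      have h := integral_step_eq (p := p) (Nat.lt_succ_iff.1 (Finset.mem_range.1 hi))
        (fun w b => gammaMoment γ (familySize w i (m + 1) + if b then 1 else 0))
        (fun b w w' h => by
          dsimp only
          rw [familySize_congr h _ _ le_rfl])
      rw [← integral_const_mul]
      refine Eq.trans ?_ (h.trans ?_)
      · refine integral_congr_ae (ae_of_all _ fun w => ?_)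
        beta_reduce
        rw [familySize_succ w i (m + 1)]
        simp
      · refine integral_congr_ae (ae_of_all _ fun w => ?_)
        have := gammaMoment_step (γ := γ) (c := p / (m + 1 : ℕ)) (familySize w i (m + 1))
        beta_reduce
        rw [← this]
        simp only [if_true, Bool.false_eq_true, if_false, add_zero]
        ring
    rw [Finset.sum_congr rfl hstep, ← Finset.mul_sum]
    have hpos : 0 ≤ 1 + p / (m + 1 : ℕ) * γ := by
      have := hp.out.1
      positivity
    have h1 := mul_le_mul_of_nonneg_left ih hpos
    have h2 : (1 + p / (m + 1 : ℕ) * γ) * ((1 - p * γ)⁻¹ * (m + 1 : ℕ)) + 1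
        = (1 - p * γ)⁻¹ * ((m + 1 + 1 : ℕ) : ℝ) := by
      have : (1 - p * γ) ≠ 0 := by linarith
      push_cast
      field_simp
      ring
    linarith

end

section

/-! ### Exponential holding times -/

/-- The sequence `x, h 0, h 1, …`. -/
def consSeq (x : ℝ) (h : ℕ → ℝ) : ℕ → ℝ
  | 0 => x
  | k + 1 => h k

lemma measurable_consSeq : Measurable fun x : ℝ × (ℕ → ℝ) => consSeq x.1 x.2 := by
  refine measurable_pi_iff.2 fun k => ?_
  cases k with
  | zero => exact measurable_fst
  | succ k => exact (measurable_pi_apply k).comp measurable_snd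

/-- A sequence of independent variables splits into its first term and the remaining ones. -/
lemma measurePreserving_consSeq (μ : ℕ → Measure ℝ) [∀ i, IsProbabilityMeasure (μ i)] :
    MeasurePreserving (fun x : ℝ × (ℕ → ℝ) => consSeq x.1 x.2)
      ((μ 0).prod (Measure.infinitePi fun k => μ (k + 1))) (Measure.infinitePi μ) := by
  classical
  refine ⟨measurable_consSeq, Measure.eq_infinitePi _ fun s t ht => ?_⟩
  rw [Measure.map_apply measurable_consSeq (.pi s.countable_toSet fun j _ => ht j)]
  obtain ⟨N, hN⟩ : ∃ N, s ⊆ Finset.range (N + 1) := by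
    obtain ⟨N, hN⟩ := s.bddAbove
    exact ⟨N, fun i hi => Finset.mem_range.2 (Nat.lt_succ_of_le (hN hi))⟩
  set t' : ℕ → Set ℝ := fun i => if i ∈ s then t i else Set.univ with ht'
  have ht'm : ∀ i, MeasurableSet (t' i) := fun i => by
    simp only [ht']; split_ifs
    · exact ht i
    · exact .univ
  have hpre : (fun x : ℝ × (ℕ → ℝ) => consSeq x.1 x.2) ⁻¹' (s : Set ℕ).pi t
      = t' 0 ×ˢ ((Finset.range N : Finset ℕ) : Set ℕ).pi (fun k => t' (k + 1)) := by
    ext ⟨x, h⟩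
    simp only [Set.mem_preimage, Set.mem_pi, Finset.mem_coe, Set.mem_prod, ht', Finset.mem_range]
    constructor
    · intro H
      refine ⟨?_, fun k _ => ?_⟩
      · split_ifs with h0
        · exact H 0 h0
        · trivial
      · split_ifs with h0
        · exact H (k + 1) h0
        · trivial
    · rintro ⟨H0, H1⟩ i hi
      cases i with
      | zero => simpa [hi, consSeq] using H0
      | succ i =>
        have := H1 i (by have := Finset.mem_range.1 (hN hi); omega)
        simpa [hi, consSeq] using this
  rw [hpre, Measure.prod_prod, Measure.infinitePi_pi _ (fun j _ => ht'm _)]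
  rw [mul_comm, ← Finset.prod_range_succ' (fun i => μ i (t' i)) N]
  symm
  refine (Finset.prod_congr rfl fun i hi => ?_).trans
    (Finset.prod_subset hN fun i _ hi => ?_)
  · simp only [ht', if_pos hi]
  · simp only [ht', if_neg hi, measure_univ]

lemma expMeasure_real_Iic {r : ℝ} (hr : 0 < r) {x : ℝ} (hx : 0 ≤ x) :
    (expMeasure r).real (Set.Iic x) = 1 - Real.exp (-(r * x)) := by
  have := isProbabilityMeasure_expMeasure hr
  rw [← cdf_eq_real, cdf_expMeasure_eq hr, if_pos hx]

/-- The lack of memory of the exponential law. -/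
lemma map_sub_restrict_expMeasure {r c : ℝ} (hr : 0 < r) (hc : 0 ≤ c) :
    ((expMeasure r).restrict (Set.Ioi c)).map (fun x => x - c)
      = ENNReal.ofReal (Real.exp (-(r * c))) • expMeasure r := by
  have := isProbabilityMeasure_expMeasure hr
  have hm : Measurable fun x : ℝ => x - c := by fun_prop
  have hfin : IsFiniteMeasure (((expMeasure r).restrict (Set.Ioi c)).map (fun x => x - c)) :=
    Measure.isFiniteMeasure_map _ _
  refine Measure.ext_of_Iic _ _ fun x => ?_
  rw [Measure.map_apply hm measurableSet_Iic, Measure.restrict_apply (hm measurableSet_Iic)]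
  have hset : (fun x => x - c) ⁻¹' Set.Iic x ∩ Set.Ioi c = Set.Ioc c (c + x) := by
    ext y
    simp only [Set.mem_inter_iff, Set.mem_preimage, Set.mem_Iic, Set.mem_Ioi, Set.mem_Ioc]
    constructor
    · rintro ⟨h1, h2⟩; exact ⟨h2, by linarith⟩
    · rintro ⟨h1, h2⟩; exact ⟨by linarith, h1⟩
  rw [hset, Measure.smul_apply, smul_eq_mul, ← ENNReal.toReal_eq_toReal_iff' (by finiteness) (by finiteness),
    ENNReal.toReal_mul, ENNReal.toReal_ofReal (Real.exp_pos _).le]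
  change (expMeasure r).real _ = _ * (expMeasure r).real _
  rcases le_or_gt 0 x with hx | hx
  · rw [show Set.Ioc c (c + x) = Set.Iic (c + x) \ Set.Iic c by ext; simp [and_comm],
      measureReal_sdiff (Set.Iic_subset_Iic.2 (by linarith)) measurableSet_Iic,
      expMeasure_real_Iic hr hx, expMeasure_real_Iic hr hc, expMeasure_real_Iic hr (by linarith)]
    rw [mul_sub, ← Real.exp_add]
    ring_nf
  · rw [Set.Ioc_eq_empty (by linarith), measureReal_empty, ← cdf_eq_real, cdf_expMeasure_eq hr,
      if_neg (by linarith), mul_zero]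

lemma integral_expMeasure_ite {r c : ℝ} (hr : 0 < r) (hc : 0 ≤ c) (A : ℝ) {B : ℝ → ℝ}
    (hB : Measurable B) {C : ℝ} (hBC : ∀ x, |B x| ≤ C) :
    ∫ x, (if x ≤ c then A else B (x - c)) ∂expMeasure r
      = (1 - Real.exp (-(r * c))) * A + Real.exp (-(r * c)) * ∫ x, B x ∂expMeasure r := by
  have := isProbabilityMeasure_expMeasure hr
  have hm : Measurable fun x => if x ≤ c then A else B (x - c) :=
    Measurable.ite measurableSet_Iic measurable_const (by fun_prop)
  have hi : Integrable (fun x => if x ≤ c then A else B (x - c)) (expMeasure r) :=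
    Integrable.of_bound hm.aestronglyMeasurable (max |A| C) (ae_of_all _ fun x => by
      split_ifs
      · exact le_max_left _ _
      · exact (hBC _).trans (le_max_right _ _))
  rw [← integral_add_compl measurableSet_Iic hi (s := Set.Iic c)]
  congr 1
  · rw [setIntegral_congr_fun (g := fun _ => A) measurableSet_Iic
      (fun x (hx : x ≤ c) => if_pos hx), setIntegral_const, expMeasure_real_Iic hr hc, smul_eq_mul]
  · rw [Set.compl_Iic, setIntegral_congr_fun (g := fun x => B (x - c)) measurableSet_Ioi
      (fun x (hx : c < x) => if_neg (not_le.2 hx))]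
    rw [← integral_map (φ := fun x => x - c) (f := B) (by fun_prop) hB.aestronglyMeasurable,
      map_sub_restrict_expMeasure hr hc, integral_smul_measure,
      ENNReal.toReal_ofReal (Real.exp_pos _).le, smul_eq_mul]

/-- The law of the successive holding times of a Yule process started from `a`. -/
noncomputable def holdingMeasure (a : ℕ) : Measure (ℕ → ℝ) :=
  Measure.infinitePi fun k : ℕ => expMeasure ((k : ℝ) + a)

lemma isProbabilityMeasure_expMeasure_add {a : ℕ} (ha : 1 ≤ a) (k : ℕ) :
    IsProbabilityMeasure (expMeasure ((k : ℝ) + a)) :=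
  isProbabilityMeasure_expMeasure (by positivity)

lemma isProbabilityMeasure_holdingMeasure {a : ℕ} (ha : 1 ≤ a) :
    IsProbabilityMeasure (holdingMeasure a) := by
  have := isProbabilityMeasure_expMeasure_add ha
  unfold holdingMeasure
  infer_instance

lemma measurePreserving_consSeq_holdingMeasure {a : ℕ} (ha : 1 ≤ a) :
    MeasurePreserving (fun x : ℝ × (ℕ → ℝ) => consSeq x.1 x.2)
      ((expMeasure a).prod (holdingMeasure (a + 1))) (holdingMeasure a) := by
  have := isProbabilityMeasure_expMeasure_add ha
  have h := measurePreserving_consSeq fun k : ℕ => expMeasure ((k : ℝ) + a)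
  have h0 : expMeasure (((0 : ℕ) : ℝ) + a) = expMeasure a := by simp
  have h1 : (Measure.infinitePi fun k : ℕ => expMeasure (((k + 1 : ℕ) : ℝ) + a))
      = holdingMeasure (a + 1) := by
    unfold holdingMeasure
    congr 1
    funext k
    congr 1
    push_cast
    ring
  rwa [h0, h1] at h

lemma integral_holdingMeasure {a : ℕ} (ha : 1 ≤ a) {F : (ℕ → ℝ) → ℝ} (hF : Measurable F) {C : ℝ}
    (hC : ∀ h, |F h| ≤ C) :
    ∫ h, F h ∂holdingMeasure a
      = ∫ x, ∫ h, F (consSeq x h) ∂holdingMeasure (a + 1) ∂expMeasure a := by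
  have := isProbabilityMeasure_expMeasure (r := a) (by positivity)
  have := isProbabilityMeasure_holdingMeasure (a := a + 1) (by omega)
  have hmp := measurePreserving_consSeq_holdingMeasure ha
  rw [← hmp.map_eq, integral_map hmp.measurable.aemeasurable hF.aestronglyMeasurable, integral_prod]
  exact Integrable.of_bound (hF.comp hmp.measurable).aestronglyMeasurable C
    (ae_of_all _ fun x => hC _)

/-! ### Coupling the chain of family sizes with exponential holding times -/

/-- The probability that an exponential variable with rate `a` exceeds `clock p a m` is the
probability `1 - p a / m` that the chain stays in state `a` at time `m`. -/
noncomputable def clock (p : ℝ) (a m : ℕ) : ℝ := -Real.log (1 - p * a / m) / a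

/-- The number of jumps, in `f` steps, of the chain in state `a` at time `m` driven by the holding
times `h`: step `m` uses up the amount `clock p a m` of the current holding time `h 0`, and the
chain jumps when nothing is left of it. -/
noncomputable def jumpCount (p : ℝ) : ℕ → ℕ → ℕ → (ℕ → ℝ) → ℕ
  | 0, _, _, _ => 0
  | f + 1, a, m, h =>
      if h 0 ≤ clock p a m then 1 + jumpCount p f (a + 1) (m + 1) (fun k => h (k + 1))
      else jumpCount p f a (m + 1) (consSeq (h 0 - clock p a m) fun k => h (k + 1))

variable {p : ℝ}

lemma measurable_jumpCount (f a m : ℕ) : Measurable (jumpCount p f a m) := by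
  induction f generalizing a m with
  | zero => exact measurable_const
  | succ f ih =>
    have : jumpCount p (f + 1) a m = fun h => if h 0 ≤ clock p a m
        then 1 + jumpCount p f (a + 1) (m + 1) (fun k => h (k + 1))
        else jumpCount p f a (m + 1) (consSeq (h 0 - clock p a m) fun k => h (k + 1)) := by
      funext h; rw [jumpCount]
    rw [this]
    refine Measurable.ite (measurableSet_le (by fun_prop) (by fun_prop)) ?_ ?_
    · exact measurable_const.add ((ih _ _).comp (by fun_prop))
    · exact (ih _ _).comp (measurable_consSeq.comp (g := fun x : ℝ × (ℕ → ℝ) => consSeq x.1 x.2)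
        (f := fun h : ℕ → ℝ => (h 0 - clock p a m, fun k => h (k + 1))) (by fun_prop))

lemma mul_div_lt_one (hp : p ∈ Set.Ioo (0 : ℝ) 1) {a m : ℕ} (ha : 1 ≤ a) (hm : a ≤ m) :
    0 < p * a / m ∧ p * a / m < 1 := by
  have ha' : (0 : ℝ) < a := by exact_mod_cast ha
  have hm' : (a : ℝ) ≤ m := by exact_mod_cast hm
  refine ⟨div_pos (mul_pos hp.1 ha') (by linarith), ?_⟩
  rw [div_lt_one (by linarith)]
  nlinarith [hp.2]

lemma clock_nonneg (hp : p ∈ Set.Ioo (0 : ℝ) 1) {a m : ℕ} (ha : 1 ≤ a) (hm : a ≤ m) :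
    0 ≤ clock p a m := by
  obtain ⟨h1, h2⟩ := mul_div_lt_one hp ha hm
  exact div_nonneg (neg_nonneg.2 (Real.log_nonpos (by linarith) (by linarith))) (Nat.cast_nonneg a)

lemma exp_neg_mul_clock (hp : p ∈ Set.Ioo (0 : ℝ) 1) {a m : ℕ} (ha : 1 ≤ a) (hm : a ≤ m) :
    Real.exp (-(a * clock p a m)) = 1 - p * a / m := by
  obtain ⟨h1, h2⟩ := mul_div_lt_one hp ha hm
  have ha' : (a : ℝ) ≠ 0 := by positivity
  rw [clock, mul_div_cancel₀ _ ha', neg_neg, Real.exp_log (by linarith)]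

lemma min_succ_sub (f m M : ℕ) :
    min (f + 1) (M - m) = if m + 1 ≤ M then min f (M - (m + 1)) + 1 else 0 := by
  split_ifs <;> omega

/-- The chain driven by exponential holding times has the law of the chain of family sizes. -/
lemma integral_jumpCount_eq_chainValue (hp : p ∈ Set.Ioo (0 : ℝ) 1) {k : ℕ} (M : Fin k → ℕ)
    {g : (Fin k → ℕ) → ℝ} {C : ℝ} (hg : ∀ y, |g y| ≤ C) (f : ℕ) {a m : ℕ} (ha : 1 ≤ a) (hm : a ≤ m)
    (y : Fin k → ℕ) :
    ∫ h, g (fun j => y j + jumpCount p (min f (M j - m)) a m h) ∂holdingMeasure a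
      = chainValue p M g f a m y := by
  have hmeas : ∀ (f a m : ℕ) (y : Fin k → ℕ), Measurable fun h : ℕ → ℝ =>
      g (fun j => y j + jumpCount p (min f (M j - m)) a m h) := fun f a m y =>
    (measurable_of_countable g).comp
      (measurable_pi_iff.2 fun j => measurable_const.add (measurable_jumpCount _ _ _))
  induction f generalizing a m y with
  | zero =>
    have := isProbabilityMeasure_holdingMeasure ha
    simp [chainValue, jumpCount]
  | succ f ih =>
    have := isProbabilityMeasure_holdingMeasure (a := a + 1) (by omega)
    set c := clock p a m with hc
    set Φ : (ℕ → ℝ) → ℝ := fun h => g (fun j => y j + jumpCount p (min f (M j - (m + 1))) a (m + 1) h)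
      with hΦ
    rw [integral_holdingMeasure ha (hmeas _ _ _ _) (fun h => hg _)]
    have hin : ∀ x, ∫ h, g (fun j => y j + jumpCount p (min (f + 1) (M j - m)) a m (consSeq x h))
          ∂holdingMeasure (a + 1)
        = if x ≤ c then chainValue p M g f (a + 1) (m + 1)
            (fun j => y j + if m + 1 ≤ M j then 1 else 0)
          else ∫ h, Φ (consSeq (x - c) h) ∂holdingMeasure (a + 1) := by
      intro x
      split_ifs with hx
      · rw [← ih (a := a + 1) (m := m + 1) (by omega) (by omega)]
        refine integral_congr_ae (ae_of_all _ fun h => ?_)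
        beta_reduce
        congr 1
        funext j
        rw [min_succ_sub]
        split_ifs with hj
        · rw [jumpCount, if_pos (show consSeq x h 0 ≤ clock p a m from hx), ← add_assoc]
          rfl
        · have h0 : M j - (m + 1) = 0 := by omega
          simp [jumpCount, h0]
      · refine integral_congr_ae (ae_of_all _ fun h => ?_)
        simp only [hΦ]
        congr 1
        funext j
        rw [min_succ_sub]
        split_ifs with hj
        · rw [jumpCount, if_neg (show ¬ consSeq x h 0 ≤ clock p a m from hx)]
          rfl
        · have h0 : M j - (m + 1) = 0 := by omega
          simp [jumpCount, h0]
    simp_rw [hin]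
    have hΦm : Measurable Φ := hmeas f a (m + 1) y
    have hΦ2 : Measurable fun x => ∫ h, Φ (consSeq x h) ∂holdingMeasure (a + 1) := by
      have : StronglyMeasurable fun x : ℝ × (ℕ → ℝ) => Φ (consSeq x.1 x.2) :=
        (hΦm.comp measurable_consSeq).stronglyMeasurable
      exact this.integral_prod_right.measurable
    rw [integral_expMeasure_ite (C := C) (by positivity) (clock_nonneg hp ha hm) _ hΦ2 (fun x => ?_),
      ← integral_holdingMeasure ha hΦm (fun h => hg _), exp_neg_mul_clock hp ha hm,
      ih ha (by omega) y, chainValue]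
    · ring
    · have := norm_integral_le_of_norm_le_const (μ := holdingMeasure (a + 1)) (C := C)
        (f := fun h => Φ (consSeq x h)) (ae_of_all _ fun h => hg _)
      simpa using this

end

section

/-! ### Convergence of the coupled chain to the Yule process -/

variable {p : ℝ}

lemma clock_le (hp : p ∈ Set.Ioo (0 : ℝ) 1) {a m : ℕ} (ha : 1 ≤ a) (hm : p * a < m) :
    clock p a m ≤ p / (m - p * a) := by
  have ha' : (0 : ℝ) < a := by exact_mod_cast ha
  have hpa : 0 < p * a := mul_pos hp.1 ha'
  have hm' : (0 : ℝ) < m := hpa.trans hm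
  have hx : 0 < 1 - p * a / m := by rw [sub_pos, div_lt_one hm']; exact hm
  have h1 := Real.one_sub_inv_le_log_of_pos hx
  rw [clock, div_le_iff₀ ha']
  have h2 : p / (m - p * a) * a = (1 - p * a / m)⁻¹ - 1 := by
    have : (m : ℝ) - p * a ≠ 0 := by linarith
    field_simp
    ring
  linarith

lemma le_clock (hp : p ∈ Set.Ioo (0 : ℝ) 1) {a m : ℕ} (ha : 1 ≤ a) (hm : a ≤ m) :
    p / m ≤ clock p a m := by
  obtain ⟨h1, h2⟩ := mul_div_lt_one hp ha hm
  have ha' : (0 : ℝ) < a := by exact_mod_cast ha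
  rw [clock, le_div_iff₀ ha']
  have h3 := Real.log_le_sub_one_of_pos (by linarith : 0 < 1 - p * a / m)
  have h4 : p / m * a = p * a / m := by ring
  linarith

/-- If the chain jumps at least `b` times, then the first `b` holding times have been used up. -/
lemma sum_le_of_le_jumpCount (hp : p ∈ Set.Ioo (0 : ℝ) 1) (f : ℕ) {a m b : ℕ} {h : ℕ → ℝ}
    (ha : 1 ≤ a) (hm : p * (a + b) < m) (hb : b ≤ jumpCount p f a m h) :
    ∑ i ∈ Finset.range b, h i ≤ ∑ l ∈ Finset.range f, p / ((m + l : ℕ) - p * (a + b)) := by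
  have hp0 := hp.1
  induction f generalizing a m b h with
  | zero =>
    simp only [jumpCount, Nat.le_zero] at hb
    simp [hb]
  | succ f ih =>
    have hpos : ∀ l : ℕ, 0 ≤ p / (((m + l : ℕ) : ℝ) - p * (a + b)) := fun l => by
      refine div_nonneg hp0.le ?_
      push_cast
      have : (0 : ℝ) ≤ l := Nat.cast_nonneg l
      linarith
    rcases Nat.eq_zero_or_pos b with rfl | hb0
    · simp only [Finset.range_zero, Finset.sum_empty]
      exact Finset.sum_nonneg fun l _ => hpos l
    have hclock : clock p a m ≤ p / (((m + 0 : ℕ) : ℝ) - p * (a + b)) := by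
      have hb' : (0 : ℝ) ≤ b := Nat.cast_nonneg b
      refine (clock_le hp ha (by nlinarith)).trans ?_
      refine div_le_div_of_nonneg_left hp0.le (by push_cast; linarith) ?_
      push_cast
      nlinarith
    rw [Finset.sum_range_succ']
    rw [jumpCount] at hb
    split_ifs at hb with hx
    · obtain ⟨b, rfl⟩ : ∃ b', b = b' + 1 := ⟨b - 1, by omega⟩
      have h1 := ih (a := a + 1) (m := m + 1) (b := b) (h := fun k => h (k + 1)) (by omega)
        (by push_cast at hm ⊢; linarith) (by omega)
      have h2 : ∑ l ∈ Finset.range f, p / (((m + 1 + l : ℕ) : ℝ) - p * ((a + 1 : ℕ) + b))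
          = ∑ l ∈ Finset.range f, p / (((m + (l + 1) : ℕ) : ℝ) - p * (a + (b + 1 : ℕ))) := by
        refine Finset.sum_congr rfl fun l _ => ?_
        push_cast
        ring_nf
      rw [Finset.sum_range_succ']
      linarith
    · have h1 := ih (a := a) (m := m + 1) (b := b) ha (by push_cast; linarith) hb
      have h2 : ∑ l ∈ Finset.range f, p / (((m + 1 + l : ℕ) : ℝ) - p * (a + b))
          = ∑ l ∈ Finset.range f, p / (((m + (l + 1) : ℕ) : ℝ) - p * (a + b)) := by
        refine Finset.sum_congr rfl fun l _ => ?_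
        push_cast
        ring_nf
      obtain ⟨b, rfl⟩ : ∃ b', b = b' + 1 := ⟨b - 1, by omega⟩
      rw [Finset.sum_range_succ'] at h1 ⊢
      simp only [consSeq] at h1
      linarith

/-- If the chain jumps at most `b` times, then the time spent is covered by the first `b + 1`
holding times, up to the part of the last step which is lost at each jump. -/
lemma le_sum_of_jumpCount_le (hp : p ∈ Set.Ioo (0 : ℝ) 1) (f : ℕ) {a m b : ℕ} {h : ℕ → ℝ} {θ : ℝ}
    (ha : 1 ≤ a) (hm : a ≤ m) (hh : ∀ i, 0 ≤ h i) (hθ : p / m ≤ θ) (hb : jumpCount p f a m h ≤ b) :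
    ∑ l ∈ Finset.range f, p / (m + l : ℕ) ≤ ∑ i ∈ Finset.range (b + 1), h i + b * θ := by
  have hp0 := hp.1
  have hm0 : (0 : ℝ) < m := by exact_mod_cast ha.trans hm
  have hθ0 : 0 ≤ θ := (by positivity : 0 ≤ p / m).trans hθ
  induction f generalizing a m b h with
  | zero =>
    simp only [Finset.range_zero, Finset.sum_empty]
    exact add_nonneg (Finset.sum_nonneg fun i _ => hh i) (by positivity)
  | succ f ih =>
    have hθ' : p / (m + 1 : ℕ) ≤ θ := by
      refine le_trans ?_ hθ
      refine div_le_div_of_nonneg_left hp0.le hm0 ?_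
      push_cast; linarith
    have hs : ∑ l ∈ Finset.range (f + 1), p / (m + l : ℕ)
        = ∑ l ∈ Finset.range f, p / (m + 1 + l : ℕ) + p / m := by
      rw [Finset.sum_range_succ']
      simp only [add_zero]
      congr 1
      refine Finset.sum_congr rfl fun l _ => ?_
      push_cast
      ring_nf
    rw [hs]
    rw [jumpCount] at hb
    split_ifs at hb with hx
    · obtain ⟨b, rfl⟩ : ∃ b', b = b' + 1 := ⟨b - 1, by omega⟩
      have h1 := ih (a := a + 1) (m := m + 1) (b := b) (h := fun k => h (k + 1)) (by omega)
        (by omega) (fun i => hh _) hθ' (by omega) (by positivity)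
      rw [Finset.sum_range_succ' _ (b + 1)]
      have h0 := hh 0
      rw [Nat.cast_succ]
      linarith
    · have hc := le_clock hp ha hm
      have h1 := ih (a := a) (m := m + 1) (b := b) ha (by omega) (fun i => by
          cases i with
          | zero => simp only [consSeq]; linarith [not_le.1 hx]
          | succ i => exact hh _) hθ' hb (by positivity)
      rw [Finset.sum_range_succ'] at h1 ⊢
      simp only [consSeq] at h1
      linarith

lemma log_div_le_sum (m f : ℕ) (hm : 0 < m) :
    Real.log ((m + f : ℕ) / m) ≤ ∑ l ∈ Finset.range f, 1 / ((m + l : ℕ) : ℝ) := by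
  have hm' : (0 : ℝ) < m := by exact_mod_cast hm
  induction f with
  | zero => simp [hm'.ne']
  | succ f ih =>
    rw [Finset.sum_range_succ]
    have hmf : (0 : ℝ) < ((m + f : ℕ) : ℝ) := by positivity
    have h1 : (((m + (f + 1) : ℕ) : ℝ)) / m = ((m + f : ℕ) / m) * (1 + 1 / (m + f : ℕ)) := by
      field_simp; push_cast; ring
    rw [h1, Real.log_mul (by positivity) (by positivity)]
    have := Real.log_le_sub_one_of_pos (by positivity : 0 < 1 + 1 / ((m + f : ℕ) : ℝ))
    linarith

lemma sum_le_log_div (m f : ℕ) {c : ℝ} (hm : c + 1 < m) :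
    ∑ l ∈ Finset.range f, 1 / ((m + l : ℕ) - c)
      ≤ Real.log (((m + f : ℕ) - 1 - c) / (m - 1 - c)) := by
  have hm' : 0 < (m : ℝ) - 1 - c := by linarith
  induction f with
  | zero => simp [hm'.ne']
  | succ f ih =>
    rw [Finset.sum_range_succ]
    have hf : (0 : ℝ) ≤ f := Nat.cast_nonneg f
    have hx : 0 < ((m + f : ℕ) : ℝ) - 1 - c := by push_cast; linarith
    have hy : 0 < ((m + f : ℕ) : ℝ) - c := by linarith
    have h1 : (((m + (f + 1) : ℕ) : ℝ) - 1 - c) / (m - 1 - c)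
        = (((m + f : ℕ) : ℝ) - 1 - c) / (m - 1 - c)
          * ((((m + f : ℕ) : ℝ) - c) / (((m + f : ℕ) : ℝ) - 1 - c)) := by
      field_simp; push_cast; ring
    rw [h1, Real.log_mul (by positivity) (by positivity)]
    have h2 := Real.one_sub_inv_le_log_of_pos (div_pos hy hx)
    have h3 : 1 - ((((m + f : ℕ) : ℝ) - c) / (((m + f : ℕ) : ℝ) - 1 - c))⁻¹
        = 1 / (((m + f : ℕ) : ℝ) - c) := by
      field_simp; ring
    linarith

lemma tendsto_floor_add_div {t : ℝ} (ht : 0 ≤ t) (c : ℝ) :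
    Tendsto (fun n : ℕ => ((⌊(n : ℝ) * t⌋₊ : ℝ) + c) / n) atTop (𝓝 t) := by
  have h1 : Tendsto (fun n : ℕ => (⌊t * (n : ℝ)⌋₊ : ℝ) / n) atTop (𝓝 t) :=
    (tendsto_nat_floor_mul_div_atTop ht).comp tendsto_natCast_atTop_atTop
  have h2 : Tendsto (fun n : ℕ => c / (n : ℝ)) atTop (𝓝 0) :=
    tendsto_const_div_atTop_nhds_zero_nat c
  have := h1.add h2
  rw [add_zero] at this
  refine this.congr fun n => ?_
  rw [mul_comm t, add_div]

lemma tendsto_log_floor {t u : ℝ} (hu : 0 < u) (ht : 0 < t) (c d : ℝ) :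
    Tendsto (fun n : ℕ => Real.log (((⌊(n : ℝ) * t⌋₊ : ℝ) + c) / ((⌊(n : ℝ) * u⌋₊ : ℝ) + d))) atTop
      (𝓝 (Real.log t - Real.log u)) := by
  rw [← Real.log_div ht.ne' hu.ne']
  refine ((Real.continuousAt_log (div_pos ht hu).ne').tendsto.comp
    ((tendsto_floor_add_div ht.le c).div (tendsto_floor_add_div hu.le d) hu.ne')).congr' ?_
  filter_upwards [eventually_gt_atTop 0] with n hn
  have : (n : ℝ) ≠ 0 := by positivity
  simp only [Function.comp_apply, Pi.div_apply]
  rw [div_div_div_cancel_right₀ this]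

lemma eventually_le_floor {u : ℝ} (hu : 0 < u) (c : ℝ) :
    ∀ᶠ n : ℕ in atTop, c < (⌊(n : ℝ) * u⌋₊ : ℝ) := by
  have h : Tendsto (fun n : ℕ => (n : ℝ) * u) atTop atTop :=
    tendsto_natCast_atTop_atTop.atTop_mul_const hu
  filter_upwards [h.eventually_gt_atTop (c + 1)] with n hn
  have := Nat.lt_floor_add_one ((n : ℝ) * u)
  linarith

lemma eventually_floor_lt_floor {t u : ℝ} (hu : 0 ≤ u) (hut : u < t) :
    ∀ᶠ n : ℕ in atTop, ⌊(n : ℝ) * u⌋₊ + 1 ≤ ⌊(n : ℝ) * t⌋₊ := by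
  have h1 := eventually_le_floor (sub_pos.2 hut) 2
  filter_upwards [h1] with n hn
  have h2 := Nat.floor_le (by positivity : 0 ≤ (n : ℝ) * u)
  have h3 := Nat.floor_le (mul_nonneg (Nat.cast_nonneg n) (sub_pos.2 hut).le)
  refine Nat.le_floor ?_
  push_cast
  nlinarith

/-- The chain started at time about `n u` has jumped `b` times at time about `n t`, when
`p (log t - log u)` lies strictly between the times of the jumps with numbers `b` and `b + 1`. -/
lemma eventually_jumpCount_eq (hp : p ∈ Set.Ioo (0 : ℝ) 1) {t u : ℝ} (hu : 0 < u) (hut : u < t)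
    {h : ℕ → ℝ} (hh : ∀ i, 0 ≤ h i) {b : ℕ}
    (hb1 : ∑ i ∈ Finset.range b, h i < p * (Real.log t - Real.log u))
    (hb2 : p * (Real.log t - Real.log u) < ∑ i ∈ Finset.range (b + 1), h i) :
    ∀ᶠ n : ℕ in atTop, ⌊(n : ℝ) * u⌋₊ + 1 ≤ ⌊(n : ℝ) * t⌋₊ ∧
      jumpCount p (⌊(n : ℝ) * t⌋₊ - (⌊(n : ℝ) * u⌋₊ + 1)) 1 (⌊(n : ℝ) * u⌋₊ + 1) h = b := by
  have hp0 := hp.1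
  have ht : 0 < t := hu.trans hut
  set c : ℝ := p * (1 + (b + 1 : ℕ)) with hc
  have hE0 := eventually_floor_lt_floor hu.le hut
  have hE1 : ∀ᶠ n : ℕ in atTop,
      p * Real.log (((⌊(n : ℝ) * t⌋₊ : ℝ) + (-1 - c)) / ((⌊(n : ℝ) * u⌋₊ : ℝ) + -c))
        < ∑ i ∈ Finset.range (b + 1), h i :=
    ((tendsto_log_floor hu ht _ _).const_mul p).eventually_lt_const hb2
  have hθ : Tendsto (fun n : ℕ => p / ((⌊(n : ℝ) * u⌋₊ : ℝ) + 1)) atTop (𝓝 0) := by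
    refine Tendsto.div_atTop tendsto_const_nhds (tendsto_atTop_add_const_right _ _ ?_)
    refine tendsto_atTop.2 fun x => (eventually_le_floor hu x).mono fun n hn => hn.le
  have hE2 : ∀ᶠ n : ℕ in atTop,
      ∑ i ∈ Finset.range b, h i <
      p * Real.log (((⌊(n : ℝ) * t⌋₊ : ℝ) + 0) / ((⌊(n : ℝ) * u⌋₊ : ℝ) + 1))
        - b * (p / ((⌊(n : ℝ) * u⌋₊ : ℝ) + 1)) := by
    have := ((tendsto_log_floor hu ht 0 1).const_mul p).sub (hθ.const_mul (b : ℝ))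
    rw [mul_zero, sub_zero] at this
    exact this.eventually_const_lt hb1
  filter_upwards [hE0, hE1, hE2, eventually_le_floor hu c] with n h0 h1 h2 h3
  refine ⟨h0, ?_⟩
  set m := ⌊(n : ℝ) * u⌋₊ + 1 with hm
  set M := ⌊(n : ℝ) * t⌋₊ with hM
  have hmM : m + (M - m) = M := by omega
  have hmR : (m : ℝ) = (⌊(n : ℝ) * u⌋₊ : ℝ) + 1 := by rw [hm]; push_cast; ring
  refine le_antisymm ?_ ?_
  -- `b + 1` jumps would use up `b + 1` holding times
  · by_contra hcon
    have hlt : b + 1 ≤ jumpCount p (M - m) 1 m h := by omega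
    have hs := sum_le_of_le_jumpCount hp (M - m) le_rfl (by
      push_cast at hc ⊢
      rw [← hc, hmR]; linarith) hlt
    have hl := sum_le_log_div m (M - m) (c := c) (by rw [hmR]; linarith)
    rw [hmM] at hl
    have hs2 : ∑ l ∈ Finset.range (M - m), p / (((m + l : ℕ) : ℝ) - p * ((1 : ℕ) + (b + 1 : ℕ)))
        = p * ∑ l ∈ Finset.range (M - m), 1 / (((m + l : ℕ) : ℝ) - c) := by
      rw [Finset.mul_sum]
      refine Finset.sum_congr rfl fun l _ => ?_
      rw [hc, mul_one_div, Nat.cast_one]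
    rw [hs2] at hs
    have hl2 := mul_le_mul_of_nonneg_left hl hp0.le
    have he : ((M : ℝ) - 1 - c) / ((m : ℝ) - 1 - c)
        = ((M : ℝ) + (-1 - c)) / ((⌊(n : ℝ) * u⌋₊ : ℝ) + -c) := by
      rw [hmR]; ring_nf
    rw [he] at hl2
    linarith
  -- fewer than `b` jumps would leave too much time for the first `b` holding times
  · by_contra hcon
    obtain ⟨b, rfl⟩ : ∃ b', b = b' + 1 := ⟨b - 1, by omega⟩
    have hlt : jumpCount p (M - m) 1 m h ≤ b := by omega
    have hs := le_sum_of_jumpCount_le hp (M - m) le_rfl (by omega) hh le_rfl hlt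
    have hl := log_div_le_sum m (M - m) (by omega)
    rw [hmM] at hl
    have hs2 : ∑ l ∈ Finset.range (M - m), p / ((m + l : ℕ) : ℝ)
        = p * ∑ l ∈ Finset.range (M - m), 1 / ((m + l : ℕ) : ℝ) := by
      rw [Finset.mul_sum]
      exact Finset.sum_congr rfl fun l _ => by rw [mul_one_div]
    rw [hs2] at hs
    have hl2 := mul_le_mul_of_nonneg_left hl hp0.le
    rw [add_zero, ← hmR] at h2
    have hpos : 0 ≤ p / (m : ℝ) := by positivity
    push_cast at h2
    linarith

/-! ### Almost sure properties of the holding times -/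

lemma lintegral_exp_neg_expMeasure {r : ℝ} (hr : 0 < r) :
    ∫⁻ x, ENNReal.ofReal (Real.exp (-x)) ∂expMeasure r = ENNReal.ofReal (r / (r + 1)) := by
  have hpdf : ∀ r : ℝ, Measurable (exponentialPDF r) := fun r =>
    (measurable_exponentialPDFReal r).ennreal_ofReal
  have h1 : expMeasure r = volume.withDensity (exponentialPDF r) := rfl
  rw [h1, lintegral_withDensity_eq_lintegral_mul _ (hpdf r) (by fun_prop)]
  have h2 : ∀ x, (exponentialPDF r * fun x => ENNReal.ofReal (Real.exp (-x))) x
      = ENNReal.ofReal (r / (r + 1)) * exponentialPDF (r + 1) x := fun x => by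
    rw [Pi.mul_apply, exponentialPDF_eq, exponentialPDF_eq,
      ← ENNReal.ofReal_mul (by split_ifs <;> positivity), ← ENNReal.ofReal_mul (by positivity)]
    congr 1
    split_ifs
    · rw [mul_assoc, ← Real.exp_add]
      field_simp
      ring_nf
    · simp
  simp_rw [h2]
  rw [lintegral_const_mul _ (hpdf _), lintegral_exponentialPDF_eq_one (by linarith), mul_one]

/-- The Laplace transform at `1` of the `n`-th jump time: the product of the factors
`(a + i) / (a + i + 1)` telescopes. -/
lemma lintegral_exp_neg_sum (n : ℕ) {a : ℕ} (ha : 1 ≤ a) :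
    ∫⁻ h, ENNReal.ofReal (Real.exp (-∑ i ∈ Finset.range n, h i)) ∂holdingMeasure a
      = ENNReal.ofReal (a / (a + n)) := by
  induction n generalizing a with
  | zero =>
    have := isProbabilityMeasure_holdingMeasure ha
    have : (a : ℝ) ≠ 0 := by positivity
    simp [this]
  | succ n ih =>
    have := isProbabilityMeasure_expMeasure (r := a) (by positivity)
    have := isProbabilityMeasure_holdingMeasure (a := a + 1) (by omega)
    have hmp := measurePreserving_consSeq_holdingMeasure ha
    rw [← hmp.map_eq, lintegral_map (by fun_prop) hmp.measurable]
    have h1 : ∀ x : ℝ × (ℕ → ℝ),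
        ENNReal.ofReal (Real.exp (-∑ i ∈ Finset.range (n + 1), consSeq x.1 x.2 i))
        = ENNReal.ofReal (Real.exp (-x.1))
          * ENNReal.ofReal (Real.exp (-∑ i ∈ Finset.range n, x.2 i)) := fun x => by
      rw [← ENNReal.ofReal_mul (Real.exp_pos _).le, ← Real.exp_add, Finset.sum_range_succ']
      simp only [consSeq]
      ring_nf
    simp_rw [h1]
    rw [lintegral_prod_mul (f := fun x => ENNReal.ofReal (Real.exp (-x)))
      (g := fun h : ℕ → ℝ => ENNReal.ofReal (Real.exp (-∑ i ∈ Finset.range n, h i)))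
      (by fun_prop) (by fun_prop), ih (by omega),
      lintegral_exp_neg_expMeasure (by positivity), ← ENNReal.ofReal_mul (by positivity)]
    congr 1
    push_cast
    field_simp
    ring

/-- The Yule process does not explode. -/
lemma ae_exists_lt_sum {a : ℕ} (ha : 1 ≤ a) :
    ∀ᵐ h ∂holdingMeasure a, ∀ K : ℝ, ∃ n, K < ∑ i ∈ Finset.range n, h i := by
  -- Markov's inequality for `exp (-∑ i, h i)`
  have key : ∀ K : ℕ, ∀ᵐ h ∂holdingMeasure a, ∃ n, (K : ℝ) < ∑ i ∈ Finset.range n, h i := by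
    intro K
    rw [ae_iff]
    simp only [not_exists, not_lt]
    have hle : ∀ n : ℕ, holdingMeasure a {h | ∀ n, ∑ i ∈ Finset.range n, h i ≤ (K : ℝ)}
        ≤ ENNReal.ofReal (a / (a + n)) / ENNReal.ofReal (Real.exp (-K)) := by
      intro n
      rw [← lintegral_exp_neg_sum n ha]
      refine le_trans (measure_mono fun h hh => ?_)
        (meas_ge_le_lintegral_div (by fun_prop) (by simp [Real.exp_pos]) (by finiteness))
      exact ENNReal.ofReal_le_ofReal (Real.exp_le_exp.2 (neg_le_neg (hh n)))
    have hlim : Tendsto (fun n : ℕ => ENNReal.ofReal (a / (a + n)) / ENNReal.ofReal (Real.exp (-K)))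
        atTop (𝓝 0) := by
      have h1 : Tendsto (fun n : ℕ => (a : ℝ) / (a + n)) atTop (𝓝 0) :=
        Tendsto.div_atTop tendsto_const_nhds
          (tendsto_atTop_add_const_left _ _ tendsto_natCast_atTop_atTop)
      have h2 := ENNReal.Tendsto.div_const (ENNReal.tendsto_ofReal h1)
        (b := ENNReal.ofReal (Real.exp (-K))) (Or.inr (by simp [Real.exp_pos]))
      simpa using h2
    exact le_antisymm (ge_of_tendsto' hlim hle) bot_le
  filter_upwards [ae_all_iff.2 key] with h hh K
  obtain ⟨N, hN⟩ := exists_nat_ge K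
  obtain ⟨n, hn⟩ := hh N
  exact ⟨n, hN.trans_lt hn⟩

lemma ae_nonneg_holdingMeasure {a : ℕ} (ha : 1 ≤ a) :
    ∀ᵐ h ∂holdingMeasure a, ∀ i, 0 ≤ h i := by
  have := isProbabilityMeasure_expMeasure_add ha
  refine ae_all_iff.2 fun i => ?_
  have hmp := measurePreserving_eval_infinitePi (fun k : ℕ => expMeasure ((k : ℝ) + a)) i
  have h0 : ∀ᵐ x ∂expMeasure ((i : ℝ) + a), 0 ≤ x := by
    rw [ae_iff]
    refine measure_mono_null (t := Set.Iic 0) (fun x hx => (not_le.1 hx).le) ?_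
    have := expMeasure_real_Iic (r := (i : ℝ) + a) (by positivity) (le_refl 0)
    simp only [mul_zero, neg_zero, Real.exp_zero, sub_self] at this
    rwa [measureReal_eq_zero_iff] at this
  exact hmp.quasiMeasurePreserving.ae h0

lemma yule_eq {h : ℕ → ℝ} (hh : ∀ i, 0 ≤ h i) {s : ℝ} {b : ℕ}
    (hb1 : ∑ i ∈ Finset.range b, h i < s) (hb2 : s < ∑ i ∈ Finset.range (b + 1), h i) :
    yule h s = 1 + b := by
  have hmono : Monotone fun n => ∑ i ∈ Finset.range n, h i := fun m n hmn =>
    Finset.sum_le_sum_of_subset_of_nonneg (Finset.range_subset_range.2 hmn) fun i _ _ => hh i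
  have : {n : ℕ | ∑ i ∈ Finset.range (n + 1), h i ≤ s} = (Finset.range b : Set ℕ) := by
    ext n
    simp only [Set.mem_ofPred_eq, Finset.coe_range, Set.mem_Iio]
    constructor
    · intro hn
      by_contra hcon
      have := hmono (by omega : b + 1 ≤ n + 1)
      dsimp only at this
      linarith
    · intro hn
      have := hmono (by omega : n + 1 ≤ b)
      dsimp only at this
      linarith
  rw [yule, this, Set.ncard_coe_finset, Finset.card_range]

lemma yuleSimonMeasure_eq :
    yuleSimonMeasure = ((volume : Measure ℝ).restrict (Set.Icc 0 1)).prod (holdingMeasure 1) := by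
  simp [yuleSimonMeasure, holdingMeasure]

/-- The coupled chain: the family of step `i`, started by a fresh step, at the times `M j`. -/
noncomputable def coupledFamily (p : ℝ) {k : ℕ} (n : ℕ) (M : Fin k → ℕ) (i : ℕ) (h : ℕ → ℝ)
    (j : Fin k) : ℕ :=
  (if i + 1 ≤ M j then 1 else 0) + jumpCount p (min (n - (i + 1)) (M j - (i + 1))) 1 (i + 1) h

lemma floor_mul_le {t : ℝ} (ht : t ≤ 1) (n : ℕ) : ⌊(n : ℝ) * t⌋₊ ≤ n := by
  refine Nat.floor_le_of_le ?_
  have := mul_le_mul_of_nonneg_left ht (Nat.cast_nonneg (α := ℝ) n)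
  linarith

/-- Almost surely no `p (log t - log u)` is a jump time, and the coupled chains are eventually equal
to the Yule-Simon process at the observation times. -/
lemma ae_eventually_coupledFamily_eq (hp : p ∈ Set.Ioo (0 : ℝ) 1) {k : ℕ} {t : Fin k → ℝ}
    (ht1 : ∀ j, t j ≤ 1) :
    ∀ᵐ w ∂yuleSimonMeasure, (∀ j, w.1 ≠ t j) ∧ ∀ᶠ n : ℕ in atTop,
      coupledFamily p n (fun j => ⌊(n : ℝ) * t j⌋₊) ⌊(n : ℝ) * w.1⌋₊ w.2
        = fun j => yuleSimon p (t j) w := by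
  have hpr := isProbabilityMeasure_holdingMeasure (le_refl 1)
  rw [yuleSimonMeasure_eq]
  set ν := ((volume : Measure ℝ).restrict (Set.Icc 0 1))
  have hfst : ∀ᵐ w ∂ν.prod (holdingMeasure 1), 0 < w.1 ∧ ∀ j, w.1 ≠ t j := by
    have h0 : ∀ᵐ u ∂ν, 0 < u ∧ ∀ j, u ≠ t j := by
      have hne : ∀ x : ℝ, ∀ᵐ u ∂ν, u ≠ x := fun x =>
        compl_mem_ae_iff.2 (measure_singleton x)
      filter_upwards [hne 0, ae_all_iff.2 fun j => hne (t j),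
        ae_restrict_mem measurableSet_Icc] with u h1 h2 h3
      exact ⟨lt_of_le_of_ne h3.1 h1.symm, h2⟩
    exact Measure.quasiMeasurePreserving_fst.ae h0
  have hsnd : ∀ᵐ w ∂ν.prod (holdingMeasure 1), (∀ i, 0 ≤ w.2 i) ∧
      ∀ K : ℝ, ∃ n, K < ∑ i ∈ Finset.range n, w.2 i :=
    Measure.quasiMeasurePreserving_snd.ae
      ((ae_nonneg_holdingMeasure le_rfl).and (ae_exists_lt_sum le_rfl))
  -- for fixed holding times, `p (log t - log u)` hits a given jump time for at most one `u > 0`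
  have hties : ∀ᵐ w ∂ν.prod (holdingMeasure 1), ∀ (j : Fin k) (b : ℕ), 0 < w.1 →
      p * (Real.log (t j) - Real.log w.1) ≠ ∑ i ∈ Finset.range b, w.2 i := by
    refine ae_all_iff.2 fun j => ae_all_iff.2 fun b => ?_
    have hms : MeasurableSet {w : ℝ × (ℕ → ℝ) | 0 < w.1 →
        p * (Real.log (t j) - Real.log w.1) ≠ ∑ i ∈ Finset.range b, w.2 i} := by
      have h1 : MeasurableSet {w : ℝ × (ℕ → ℝ) |
          p * (Real.log (t j) - Real.log w.1) = ∑ i ∈ Finset.range b, w.2 i} :=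
        measurableSet_eq_fun (by fun_prop) (by fun_prop)
      have h2 : MeasurableSet {w : ℝ × (ℕ → ℝ) | 0 < w.1} :=
        measurableSet_lt (by fun_prop) (by fun_prop)
      convert (h2.compl.union h1.compl) using 1
      ext w
      simp only [Set.mem_ofPred_eq, Set.mem_union, Set.mem_compl_iff]
      tauto
    have hcol : ∀ᵐ z ∂(holdingMeasure 1).prod ν, 0 < z.2 →
        p * (Real.log (t j) - Real.log z.2) ≠ ∑ i ∈ Finset.range b, z.1 i := by
      refine (Measure.ae_prod_iff_ae_ae (hms.preimage measurable_swap)).2 (ae_of_all _ fun h => ?_)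
      set x := Real.exp (Real.log (t j) - (∑ i ∈ Finset.range b, h i) / p)
      have hne : ∀ᵐ u ∂ν, u ≠ x := compl_mem_ae_iff.2 (measure_singleton x)
      filter_upwards [hne] with u hu hu0 heq
      refine hu ?_
      replace hu0 : 0 < u := hu0
      replace heq : p * (Real.log (t j) - Real.log u) = ∑ i ∈ Finset.range b, h i := heq
      have : Real.log u = Real.log (t j) - (∑ i ∈ Finset.range b, h i) / p := by
        rw [← heq, mul_div_cancel_left₀ _ hp.1.ne']; ring
      rw [← Real.exp_log hu0, this]
    exact (Measure.measurePreserving_swap (μ := ν) (ν := holdingMeasure 1)).quasiMeasurePreserving.ae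
      hcol
  filter_upwards [hfst, hsnd, hties] with w ⟨hu, hne⟩ ⟨hh, hex⟩ hnt
  refine ⟨hne, ?_⟩
  have : ∀ j, ∀ᶠ n : ℕ in atTop,
      coupledFamily p n (fun j => ⌊(n : ℝ) * t j⌋₊) ⌊(n : ℝ) * w.1⌋₊ w.2 j
        = yuleSimon p (t j) w := by
    intro j
    rcases lt_or_gt_of_ne (hne j) with hlt | hgt
    · set s := p * (Real.log (t j) - Real.log w.1) with hs
      have hs0 : 0 < s := mul_pos hp.1 (sub_pos.2 (Real.log_lt_log hu hlt))
      classical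
      have hex' := hex s
      obtain ⟨b, hb⟩ : ∃ b, Nat.find hex' = b + 1 := by
        refine Nat.exists_eq_succ_of_ne_zero fun h0 => ?_
        have := Nat.find_spec hex'
        rw [h0] at this
        simp only [Finset.range_zero, Finset.sum_empty] at this
        linarith
      have hb2 : s < ∑ i ∈ Finset.range (b + 1), w.2 i := hb ▸ Nat.find_spec hex'
      have hb1 : ∑ i ∈ Finset.range b, w.2 i < s :=
        lt_of_le_of_ne (not_lt.1 (Nat.find_min hex' (by omega : b < Nat.find hex')))
          (hnt j b hu).symm
      filter_upwards [eventually_jumpCount_eq hp hu hlt hh hb1 hb2] with n hn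
      have hMn := floor_mul_le (ht1 j) n
      rw [coupledFamily, if_pos hn.1, min_eq_right (by omega), hn.2, yuleSimon, if_pos hlt.le,
        yule_eq hh hb1 hb2]
    · refine Eventually.of_forall fun n => ?_
      have h1 : ⌊(n : ℝ) * t j⌋₊ ≤ ⌊(n : ℝ) * w.1⌋₊ :=
        Nat.floor_mono (mul_le_mul_of_nonneg_left hgt.le (Nat.cast_nonneg n))
      have h2 : ⌊(n : ℝ) * t j⌋₊ - (⌊(n : ℝ) * w.1⌋₊ + 1) = 0 := by omega
      rw [coupledFamily, if_neg (by omega), h2, yuleSimon, if_neg (not_le.2 hgt)]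
      simp [jumpCount]
  filter_upwards [eventually_all.2 this] with n hn
  exact funext hn

end

section

/-! ### Law of large numbers for the families -/

variable {p : ℝ}

/-- A Riemann sum as the integral of a step function. -/
lemma integral_floor_eq {n : ℕ} (hn : 0 < n) (c : ℕ → ℝ) :
    ∫ u in Set.Icc (0 : ℝ) 1, c ⌊(n : ℝ) * u⌋₊ = (n : ℝ)⁻¹ * ∑ i ∈ Finset.range n, c i := by
  have hn' : (0 : ℝ) < n := by exact_mod_cast hn
  have hm : Measurable fun u : ℝ => c ⌊(n : ℝ) * u⌋₊ :=
    (measurable_of_countable c).comp (Nat.measurable_floor.comp (by fun_prop))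
  have hpiece : ∀ i : ℕ, Set.EqOn (fun u : ℝ => c ⌊(n : ℝ) * u⌋₊) (fun _ => c i)
      (Set.Ico ((i : ℝ) / n) (((i + 1 : ℕ) : ℝ) / n)) := by
    intro i u hu
    have h1 : (i : ℝ) ≤ n * u := by have := (div_le_iff₀ hn').1 hu.1; linarith
    have h2 : n * u < (i : ℝ) + 1 := by
      have := (lt_div_iff₀ hn').1 hu.2; push_cast at this; linarith
    have : ⌊(n : ℝ) * u⌋₊ = i :=
      (Nat.floor_eq_iff ((Nat.cast_nonneg i).trans h1)).2 ⟨h1, h2⟩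
    simp only [this]
  have hle : ∀ i : ℕ, (i : ℝ) / n ≤ ((i + 1 : ℕ) : ℝ) / n := fun i => by
    gcongr; omega
  have hint : ∀ i : ℕ, IntervalIntegrable (fun u : ℝ => c ⌊(n : ℝ) * u⌋₊) volume
      ((i : ℝ) / n) (((i + 1 : ℕ) : ℝ) / n) := by
    intro i
    rw [intervalIntegrable_iff_integrableOn_Ico_of_le (hle i)]
    exact (integrableOn_const (C := c i) (by simp)).congr_fun (hpiece i).symm measurableSet_Ico
  have hval : ∀ i : ℕ, ∫ u in ((i : ℝ) / n)..(((i + 1 : ℕ) : ℝ) / n), c ⌊(n : ℝ) * u⌋₊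
      = (n : ℝ)⁻¹ * c i := by
    intro i
    rw [intervalIntegral.integral_of_le (hle i), ← integral_Ico_eq_integral_Ioc,
      setIntegral_congr_fun measurableSet_Ico (hpiece i), setIntegral_const, measureReal_def,
      Real.volume_Ico, smul_eq_mul]
    rw [ENNReal.toReal_ofReal (sub_nonneg.2 (hle i))]
    push_cast
    field_simp
    ring
  have hsum := intervalIntegral.sum_integral_adjacent_intervals
    (f := fun u : ℝ => c ⌊(n : ℝ) * u⌋₊) (μ := volume) (a := fun i : ℕ => (i : ℝ) / n) (n := n)
    fun i _ => hint i
  rw [integral_Icc_eq_integral_Ioc, ← intervalIntegral.integral_of_le zero_le_one]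
  simp only [Nat.cast_zero, zero_div, div_self hn'.ne'] at hsum
  rw [← hsum, Finset.mul_sum]
  exact Finset.sum_congr rfl fun i _ => hval i

/-- The family of step `⌊n u⌋` is born before time `⌊n t⌋`, for large `n`, if and only if `u ≤ t`. -/
lemma eventually_decide_floor_eq {k : ℕ} (t : Fin k → ℝ) {u : ℝ} (hu : 0 ≤ u) (hne : ∀ j, u ≠ t j) :
    ∀ᶠ n : ℕ in atTop, (fun j => decide (⌊(n : ℝ) * u⌋₊ < ⌊(n : ℝ) * t j⌋₊))
      = fun j => decide (u ≤ t j) := by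
  have : ∀ j, ∀ᶠ n : ℕ in atTop, decide (⌊(n : ℝ) * u⌋₊ < ⌊(n : ℝ) * t j⌋₊) = decide (u ≤ t j) := by
    intro j
    rcases lt_or_gt_of_ne (hne j) with hlt | hgt
    · filter_upwards [eventually_floor_lt_floor hu hlt] with n hn
      simp [hlt.le, Nat.lt_of_succ_le hn]
    · refine Eventually.of_forall fun n => ?_
      have h1 : ⌊(n : ℝ) * t j⌋₊ ≤ ⌊(n : ℝ) * u⌋₊ :=
        Nat.floor_mono (mul_le_mul_of_nonneg_left hgt.le (Nat.cast_nonneg n))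
      rw [decide_eq_false (not_lt.2 h1), decide_eq_false (not_le.2 hgt)]
  filter_upwards [eventually_all.2 this] with n hn
  exact funext hn

instance : IsProbabilityMeasure yuleSimonMeasure := by
  have := isProbabilityMeasure_holdingMeasure (le_refl 1)
  rw [yuleSimonMeasure_eq]
  have : IsProbabilityMeasure ((volume : Measure ℝ).restrict (Set.Icc 0 1)) := ⟨by simp⟩
  infer_instance

/-- The limit of the empirical means of `g` over all families: a fraction `p` of the steps is not
fresh and has an empty family, and the family sizes of the other ones follow the Yule-Simon
process. -/
noncomputable def familyLimit (p : ℝ) {k : ℕ} (t : Fin k → ℝ)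
    (g : (Fin k → Bool) → (Fin k → ℕ) → ℝ) : ℝ :=
  p * (∫ u in Set.Icc (0 : ℝ) 1, g (fun j => decide (u ≤ t j)) (fun _ => 0))
    + (1 - p) * ∫ w, g (fun j => decide (w.1 ≤ t j)) (fun j => yuleSimon p (t j) w) ∂yuleSimonMeasure

lemma measurable_coupledFamily_floor {k : ℕ} (n : ℕ) (M : Fin k → ℕ)
    (g : (Fin k → Bool) → (Fin k → ℕ) → ℝ) :
    Measurable fun w : ℝ × (ℕ → ℝ) => g (fun j => decide (⌊(n : ℝ) * w.1⌋₊ < M j))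
      (coupledFamily p n M ⌊(n : ℝ) * w.1⌋₊ w.2) := by
  have h : Measurable fun x : ℕ × (ℕ → ℝ) => g (fun j => decide (x.1 < M j))
      (coupledFamily p n M x.1 x.2) := by
    refine measurable_from_prod_countable_right fun i => ?_
    refine (measurable_of_countable (g fun j => decide (i < M j))).comp
      (measurable_pi_iff.2 fun j => ?_)
    unfold coupledFamily
    exact (measurable_jumpCount (p := p) (min (n - (i + 1)) (M j - (i + 1))) 1 (i + 1)).const_add
      (if i + 1 ≤ M j then 1 else 0)
  exact h.comp (f := fun w : ℝ × (ℕ → ℝ) => (⌊(n : ℝ) * w.1⌋₊, w.2))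
    ((Nat.measurable_floor.comp (by fun_prop)).prodMk measurable_snd)

lemma ae_tendsto_coupledFamily (hp : p ∈ Set.Ioo (0 : ℝ) 1) {k : ℕ} {t : Fin k → ℝ}
    (ht : ∀ j, t j ≤ 1) (g : (Fin k → Bool) → (Fin k → ℕ) → ℝ) :
    ∀ᵐ w ∂yuleSimonMeasure, Tendsto (fun n : ℕ =>
        g (fun j => decide (⌊(n : ℝ) * w.1⌋₊ < ⌊(n : ℝ) * t j⌋₊))
          (coupledFamily p n (fun j => ⌊(n : ℝ) * t j⌋₊) ⌊(n : ℝ) * w.1⌋₊ w.2)) atTop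
      (𝓝 (g (fun j => decide (w.1 ≤ t j)) (fun j => yuleSimon p (t j) w))) := by
  have hpr := isProbabilityMeasure_holdingMeasure (le_refl 1)
  have h0 : ∀ᵐ w ∂yuleSimonMeasure, 0 ≤ w.1 := by
    rw [yuleSimonMeasure_eq]
    refine Measure.quasiMeasurePreserving_fst.ae (p := fun u : ℝ => 0 ≤ u) ?_
    filter_upwards [ae_restrict_mem measurableSet_Icc] with u hu using hu.1
  filter_upwards [h0, ae_eventually_coupledFamily_eq hp ht] with w hw0 ⟨hne, hw⟩
  refine tendsto_const_nhds.congr' ?_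
  filter_upwards [hw, eventually_decide_floor_eq t hw0 hne] with n h1 h2
  rw [h1, h2]

/-- Convergence of the expected empirical means. -/
lemma tendsto_integral_sum_familySize [hp : Fact (p ∈ Set.Ioo (0 : ℝ) 1)] {k : ℕ} {t : Fin k → ℝ}
    (ht : ∀ j, t j ≤ 1) (g : (Fin k → Bool) → (Fin k → ℕ) → ℝ) {B : ℝ} (hB : ∀ x y, |g x y| ≤ B) :
    Tendsto (fun n : ℕ => (n : ℝ)⁻¹ * ∫ w, ∑ i ∈ Finset.range n,
        g (fun j => decide (i < ⌊(n : ℝ) * t j⌋₊)) (fun j => familySize w i ⌊(n : ℝ) * t j⌋₊)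
          ∂noiseMeasure p) atTop (𝓝 (familyLimit p t g)) := by
  have hpr := isProbabilityMeasure_holdingMeasure (le_refl 1)
  have hB0 : 0 ≤ B := (abs_nonneg _).trans (hB (fun _ => true) fun _ => 0)
  set M : ℕ → Fin k → ℕ := fun n j => ⌊(n : ℝ) * t j⌋₊ with hM
  have hMn : ∀ n j, M n j ≤ n := fun n j => floor_mul_le (ht j) n
  set e : ℕ → ℕ → ℝ := fun n i => ∫ w, g (fun j => decide (i < M n j))
    (fun j => familySize w i (M n j)) ∂noiseMeasure p with he
  set E : ℕ → ℕ → ℝ := fun n i => p * g (fun j => decide (i < M n j)) (fun _ => 0)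
    + (1 - p) * ∫ h, g (fun j => decide (i < M n j)) (coupledFamily p n (M n) i h)
        ∂holdingMeasure 1 with hE
  have heE : ∀ n i, 1 ≤ i → i < n → e n i = E n i := by
    intro n i hi hin
    simp only [he, hE]
    rw [integral_familySize_eq (f := n - (i + 1)) (n := n) (M n) (g fun j => decide (i < M n j)) hi
      (by omega) (hMn n),
      ← integral_jumpCount_eq_chainValue hp.out (M n) (hB _) _ le_rfl (by omega)]
    rfl
  have hebound : ∀ n i, |e n i| ≤ B := fun n i => by
    have := norm_integral_le_of_norm_le_const (μ := noiseMeasure p) (C := B)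
      (f := fun w => g (fun j => decide (i < M n j)) (fun j => familySize w i (M n j)))
      (ae_of_all _ fun w => hB _ _)
    simpa using this
  have hEbound : ∀ n i, |E n i| ≤ B := fun n i => by
    have h1 := norm_integral_le_of_norm_le_const (μ := holdingMeasure 1) (C := B)
      (f := fun h => g (fun j => decide (i < M n j)) (coupledFamily p n (M n) i h))
      (ae_of_all _ fun w => hB _ _)
    have h2 := hB (fun j => decide (i < M n j)) (fun _ => 0)
    simp only [probReal_univ, mul_one, Real.norm_eq_abs] at h1
    simp only [hE]
    have hp1 := hp.out.1
    have hp2 := hp.out.2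
    rw [abs_le] at *
    constructor <;> nlinarith
  -- replacing `e` by `E` only affects the step `0`, which is always fresh
  have hdiff : Tendsto (fun n : ℕ => (n : ℝ)⁻¹ * ∑ i ∈ Finset.range n, e n i
      - (n : ℝ)⁻¹ * ∑ i ∈ Finset.range n, E n i) atTop (𝓝 0) := by
    refine squeeze_zero_norm' (a := fun n : ℕ => 2 * B / n) ?_
      (tendsto_const_div_atTop_nhds_zero_nat _)
    filter_upwards [eventually_gt_atTop 0] with n hn
    rw [← mul_sub, ← Finset.sum_sub_distrib, norm_mul, norm_inv, RCLike.norm_natCast]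
    rw [Finset.sum_eq_single_of_mem 0 (Finset.mem_range.2 hn) fun i hi h0 => by
      rw [heE n i (by omega) (Finset.mem_range.1 hi), sub_self]]
    have h1 := norm_sub_le (e n 0) (E n 0)
    have h2 := hebound n 0
    have h3 := hEbound n 0
    rw [inv_mul_eq_div]
    refine div_le_div_of_nonneg_right ?_ (Nat.cast_nonneg n)
    simp only [Real.norm_eq_abs] at h1 ⊢
    linarith
  have hmain : Tendsto (fun n : ℕ => (n : ℝ)⁻¹ * ∑ i ∈ Finset.range n, E n i) atTop
      (𝓝 (familyLimit p t g)) := by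
    have h1 : Tendsto (fun n : ℕ => ∫ u in Set.Icc (0 : ℝ) 1,
        g (fun j => decide (⌊(n : ℝ) * u⌋₊ < M n j)) (fun _ => 0)) atTop
        (𝓝 (∫ u in Set.Icc (0 : ℝ) 1, g (fun j => decide (u ≤ t j)) (fun _ => 0))) := by
      refine tendsto_integral_of_dominated_convergence (fun _ => B) (fun n => ?_)
        (integrable_const _) (fun n => ae_of_all _ fun u => hB _ _) ?_
      · exact ((measurable_of_countable fun i : ℕ => g (fun j => decide (i < M n j))
          (fun _ => 0)).comp (Nat.measurable_floor.comp (by fun_prop))).aestronglyMeasurable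
      · have hne : ∀ᵐ u ∂(volume : Measure ℝ).restrict (Set.Icc 0 1), ∀ j, u ≠ t j :=
          ae_all_iff.2 fun j => compl_mem_ae_iff.2 (measure_singleton (t j))
        filter_upwards [hne, ae_restrict_mem measurableSet_Icc] with u hu hu0
        refine tendsto_const_nhds.congr' ?_
        filter_upwards [eventually_decide_floor_eq t hu0.1 hu] with n hn
        rw [hn]
    have h2 : Tendsto (fun n : ℕ => ∫ w, g (fun j => decide (⌊(n : ℝ) * w.1⌋₊ < M n j))
        (coupledFamily p n (M n) ⌊(n : ℝ) * w.1⌋₊ w.2) ∂yuleSimonMeasure) atTop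
        (𝓝 (∫ w, g (fun j => decide (w.1 ≤ t j)) (fun j => yuleSimon p (t j) w)
          ∂yuleSimonMeasure)) := by
      refine tendsto_integral_of_dominated_convergence (fun _ => B) (fun n => ?_)
        (integrable_const _) (fun n => ae_of_all _ fun u => hB _ _)
        (ae_tendsto_coupledFamily hp.out ht g)
      exact (measurable_coupledFamily_floor n (M n) g).aestronglyMeasurable
    unfold familyLimit
    refine ((h1.const_mul p).add (h2.const_mul (1 - p))).congr' ?_
    filter_upwards [eventually_gt_atTop 0] with n hn
    rw [← integral_floor_eq hn]
    simp only [hE]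
    have hi1 : Integrable (fun u : ℝ => g (fun j => decide (⌊(n : ℝ) * u⌋₊ < M n j)) (fun _ => 0))
        (volume.restrict (Set.Icc (0 : ℝ) 1)) :=
      Integrable.of_bound ((measurable_of_countable fun i : ℕ => g (fun j => decide (i < M n j))
          (fun _ => 0)).comp (Nat.measurable_floor.comp (by fun_prop))).aestronglyMeasurable B
        (ae_of_all _ fun u => hB _ _)
    have hi2 : Integrable (fun w : ℝ × (ℕ → ℝ) => g (fun j => decide (⌊(n : ℝ) * w.1⌋₊ < M n j))
        (coupledFamily p n (M n) ⌊(n : ℝ) * w.1⌋₊ w.2))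
        (((volume : Measure ℝ).restrict (Set.Icc 0 1)).prod (holdingMeasure 1)) :=
      Integrable.of_bound (measurable_coupledFamily_floor n (M n) g).aestronglyMeasurable B
        (ae_of_all _ fun u => hB _ _)
    rw [integral_add (hi1.const_mul p) (hi2.integral_prod_left.const_mul (1 - p)),
      integral_const_mul, integral_const_mul, yuleSimonMeasure_eq, integral_prod _ hi2]
  have := hdiff.add hmain
  rw [zero_add] at this
  refine this.congr fun n => ?_
  rw [sub_add_cancel]
  congr 1
  simp only [he]
  rw [integral_finsetSum]
  intro i hi
  refine DependsBelow.integrable (k := n) fun w w' h => ?_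
  congr 1
  funext j
  exact familySize_congr h i _ ((hMn n j).trans (Nat.le_succ n))

/-- The empirical means of a bounded functional over all families converge in `L¹`. -/
lemma tendsto_integral_abs_sum_familySize [hp : Fact (p ∈ Set.Ioo (0 : ℝ) 1)] {k : ℕ}
    {t : Fin k → ℝ} (ht : ∀ j, t j ≤ 1) (g : (Fin k → Bool) → (Fin k → ℕ) → ℝ) {B : ℝ}
    (hB : ∀ x y, |g x y| ≤ B) :
    Tendsto (fun n : ℕ => ∫ w, |(n : ℝ)⁻¹ * ∑ i ∈ Finset.range n,
        g (fun j => decide (i < ⌊(n : ℝ) * t j⌋₊)) (fun j => familySize w i ⌊(n : ℝ) * t j⌋₊)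
          - familyLimit p t g| ∂noiseMeasure p) atTop (𝓝 0) := by
  set M : ℕ → Fin k → ℕ := fun n j => ⌊(n : ℝ) * t j⌋₊ with hM
  have hMn : ∀ n j, M n j ≤ n := fun n j => floor_mul_le (ht j) n
  set S : ℕ → Noise → ℝ := fun n w => ∑ i ∈ Finset.range n,
    g (fun j => decide (i < M n j)) (fun j => familySize w i (M n j)) with hS
  have hSd : ∀ n, DependsBelow n (S n) := fun n w w' h => by
    refine Finset.sum_congr rfl fun i _ => ?_
    congr 1
    funext j
    exact familySize_congr h i _ ((hMn n j).trans (Nat.le_succ n))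
  have hmean : Tendsto (fun n : ℕ => (n : ℝ)⁻¹ * ∫ w, S n w ∂noiseMeasure p) atTop
      (𝓝 (familyLimit p t g)) := tendsto_integral_sum_familySize ht g hB
  have h1 : Tendsto (fun n : ℕ => |(n : ℝ)⁻¹ * ∫ w, S n w ∂noiseMeasure p - familyLimit p t g|)
      atTop (𝓝 0) := by
    have := (hmean.sub_const (familyLimit p t g)).abs
    simpa using this
  have h2 : Tendsto (fun n : ℕ => (4 * B) * (√(n : ℝ))⁻¹) atTop (𝓝 0) := by
    have := (tendsto_inv_atTop_zero.comp
      (Real.tendsto_sqrt_atTop.comp (tendsto_natCast_atTop_atTop (R := ℝ)))).const_mul (4 * B)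
    simpa using this
  have h3 := h2.add h1
  rw [add_zero] at h3
  refine squeeze_zero' (Eventually.of_forall fun n => integral_nonneg fun w => abs_nonneg _) ?_ h3
  filter_upwards [eventually_gt_atTop 0] with n hn
  have hn' : (0 : ℝ) < n := by exact_mod_cast hn
  have hconc := integral_abs_sum_familySize_sub_le (p := p) n (M n) (hMn n)
    (fun i => g fun j => decide (i < M n j)) (fun i y => hB _ y)
  set m := ∫ w, S n w ∂noiseMeasure p
  have hd1 : DependsBelow n fun w => |S n w - m| := fun w w' h => by simp only [hSd n w w' h]
  have hd2 : DependsBelow n fun w => |(n : ℝ)⁻¹ * S n w - familyLimit p t g| := fun w w' h => by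
    simp only [hSd n w w' h]
  calc ∫ w, |(n : ℝ)⁻¹ * S n w - familyLimit p t g| ∂noiseMeasure p
      ≤ ∫ w, ((n : ℝ)⁻¹ * |S n w - m| + |(n : ℝ)⁻¹ * m - familyLimit p t g|) ∂noiseMeasure p := by
        refine integral_mono hd2.integrable
          ((hd1.integrable.const_mul _).add (integrable_const _)) fun w => ?_
        have : (n : ℝ)⁻¹ * S n w - familyLimit p t g
            = (n : ℝ)⁻¹ * (S n w - m) + ((n : ℝ)⁻¹ * m - familyLimit p t g) := by ring
        beta_reduce
        rw [this]
        refine (abs_add_le _ _).trans ?_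
        rw [abs_mul, abs_of_pos (inv_pos.2 hn')]
    _ = (n : ℝ)⁻¹ * ∫ w, |S n w - m| ∂noiseMeasure p + |(n : ℝ)⁻¹ * m - familyLimit p t g| := by
        rw [integral_add (hd1.integrable.const_mul _) (integrable_const _), integral_const_mul]
        simp
    _ ≤ (n : ℝ)⁻¹ * (√n * (4 * B)) + |(n : ℝ)⁻¹ * m - familyLimit p t g| := by
        gcongr
    _ = (4 * B) * (√(n : ℝ))⁻¹ + |(n : ℝ)⁻¹ * m - familyLimit p t g| := by
        congr 1
        have hs : √(n : ℝ) ≠ 0 := (Real.sqrt_pos.2 hn').ne'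
        have : (n : ℝ)⁻¹ = (√(n : ℝ))⁻¹ * (√(n : ℝ))⁻¹ := by
          rw [← mul_inv, Real.mul_self_sqrt hn'.le]
        rw [this]; field_simp

end

section

/-! ### Truncation and unbounded functionals -/

variable {p : ℝ}

lemma sum_integral_gammaMoment_familySize_le [hp : Fact (p ∈ Set.Ioo (0 : ℝ) 1)] {γ : ℝ}
    (hγ : 0 ≤ γ) (hpγ : p * γ < 1) {m n : ℕ} (hmn : m ≤ n) :
    ∑ i ∈ Finset.range n, ∫ w, gammaMoment γ (familySize w i m) ∂noiseMeasure p
      ≤ (1 - p * γ)⁻¹ * n := by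
  have h1 : ∑ i ∈ Finset.range n, ∫ w, gammaMoment γ (familySize w i m) ∂noiseMeasure p
      = ∑ i ∈ Finset.range m, ∫ w, gammaMoment γ (familySize w i m) ∂noiseMeasure p := by
    refine (Finset.sum_subset (Finset.range_subset_range.2 hmn) fun i _ hi => ?_).symm
    have : ∀ w : Noise, familySize w i m = 0 := fun w =>
      familySize_eq_zero w (not_lt.1 fun h => hi (Finset.mem_range.2 h))
    simp [this, gammaMoment]
  rw [h1]
  refine (sum_integral_gammaMoment_le hγ hpγ m).trans ?_
  have : 0 ≤ (1 - p * γ)⁻¹ := inv_nonneg.2 (by linarith)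
  gcongr

/-- The sum of the moments of the components of `y`. -/
noncomputable def momentSum (γ : ℝ) {k : ℕ} (y : Fin k → ℕ) : ℝ := ∑ j, gammaMoment γ (y j)

lemma momentSum_nonneg {γ : ℝ} (hγ : 0 ≤ γ) {k : ℕ} (y : Fin k → ℕ) : 0 ≤ momentSum γ y :=
  Finset.sum_nonneg fun _ _ => gammaMoment_nonneg hγ _

lemma dependsBelow_familySize {β : Type*} {k n : ℕ} {M : Fin k → ℕ} (hM : ∀ j, M j ≤ n) (i : ℕ)
    (g : (Fin k → ℕ) → β) : DependsBelow n fun w => g fun j => familySize w i (M j) := by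
  intro w w' h
  dsimp only
  congr 1
  funext j
  exact familySize_congr h i _ ((hM j).trans (Nat.le_succ n))

lemma sum_integral_momentSum_le [hp : Fact (p ∈ Set.Ioo (0 : ℝ) 1)] {γ : ℝ}
    (hγ : 0 ≤ γ) (hpγ : p * γ < 1) {k n : ℕ} {M : Fin k → ℕ} (hM : ∀ j, M j ≤ n) :
    ∑ i ∈ Finset.range n, ∫ w, momentSum γ (fun j => familySize w i (M j)) ∂noiseMeasure p
      ≤ k * (1 - p * γ)⁻¹ * n := by
  have h1 : ∀ i, ∫ w, momentSum γ (fun j => familySize w i (M j)) ∂noiseMeasure p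
      = ∑ j, ∫ w, gammaMoment γ (familySize w i (M j)) ∂noiseMeasure p := fun i => by
    unfold momentSum
    rw [integral_finsetSum]
    intro j _
    exact (dependsBelow_familySize hM i fun y => gammaMoment γ (y j)).integrable
  simp_rw [h1]
  rw [Finset.sum_comm]
  calc _ ≤ ∑ _j : Fin k, (1 - p * γ)⁻¹ * n :=
        Finset.sum_le_sum fun j _ => sum_integral_gammaMoment_familySize_le hγ hpγ (hM j)
    _ = k * (1 - p * γ)⁻¹ * n := by simp; ring

lemma aemeasurable_yuleSimon_functional (hp : p ∈ Set.Ioo (0 : ℝ) 1) {k : ℕ} {t : Fin k → ℝ}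
    (ht : ∀ j, t j ≤ 1) (g : (Fin k → Bool) → (Fin k → ℕ) → ℝ) :
    AEMeasurable (fun w => g (fun j => decide (w.1 ≤ t j)) (fun j => yuleSimon p (t j) w))
      yuleSimonMeasure :=
  aemeasurable_of_tendsto_metrizable_ae atTop
    (fun n => (measurable_coupledFamily_floor n _ g).aemeasurable) (ae_tendsto_coupledFamily hp ht g)

/-- Only finitely many arguments `(x, y)` have components of `y` at most `K`. -/
lemma exists_bound_of_le {k : ℕ} (g : (Fin k → Bool) → (Fin k → ℕ) → ℝ) (K : ℕ) :
    ∃ B, ∀ x y, (∀ j, y j ≤ K) → |g x y| ≤ B := by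
  have hfin : (Set.univ ×ˢ {y : Fin k → ℕ | ∀ j, y j ≤ K} :
      Set ((Fin k → Bool) × (Fin k → ℕ))).Finite := by
    refine Set.finite_univ.prod ?_
    have := Set.Finite.pi' (t := fun _ : Fin k => Set.Iic K) fun _ => Set.finite_Iic K
    exact this
  obtain ⟨B, hB⟩ := (hfin.image fun z => |g z.1 z.2|).bddAbove
  exact ⟨B, fun x y hy => hB ⟨(x, y), ⟨trivial, hy⟩, rfl⟩⟩

open Classical in
/-- `g` restricted to vectors with components at most `K`. -/
noncomputable def truncated {E : Type*} [Zero E] {k : ℕ} (K : ℕ)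
    (g : (Fin k → Bool) → (Fin k → ℕ) → E) (x : Fin k → Bool) (y : Fin k → ℕ) : E :=
  if ∀ j, y j ≤ K then g x y else 0

lemma exists_bound_truncated {k : ℕ} (g : (Fin k → Bool) → (Fin k → ℕ) → ℝ) (K : ℕ) :
    ∃ B, ∀ x y, |truncated K g x y| ≤ B := by
  obtain ⟨B, hB⟩ := exists_bound_of_le g K
  refine ⟨max B 0, fun x y => ?_⟩
  unfold truncated
  split_ifs with h
  · exact (hB x y h).trans (le_max_left _ _)
  · simp

/-- Moments of the Yule-Simon process, by Fatou's lemma from those of the family sizes. -/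
lemma integrable_momentSum_yuleSimon [hp : Fact (p ∈ Set.Ioo (0 : ℝ) 1)] {γ : ℝ}
    (hγ : 0 ≤ γ) (hpγ : p * γ < 1) {k : ℕ} {t : Fin k → ℝ} (ht : ∀ j, t j ≤ 1) :
    Integrable (fun w => momentSum γ fun j => yuleSimon p (t j) w) yuleSimonMeasure ∧
      (1 - p) * ∫ w, momentSum γ (fun j => yuleSimon p (t j) w) ∂yuleSimonMeasure
        ≤ k * (1 - p * γ)⁻¹ := by
  have hp1 : 0 < 1 - p := by linarith [hp.out.2]
  set D : ℝ := k * (1 - p * γ)⁻¹ with hD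
  have hD0 : 0 ≤ D := mul_nonneg (Nat.cast_nonneg k) (inv_nonneg.2 (by linarith))
  set G : (Fin k → Bool) → (Fin k → ℕ) → ℝ := fun _ y => momentSum γ y with hG
  have hG0 : ∀ K x y, 0 ≤ truncated K G x y := fun K x y => by
    unfold truncated; split_ifs
    · exact momentSum_nonneg hγ y
    · exact le_rfl
  have hGle : ∀ K x y, truncated K G x y ≤ momentSum γ y := fun K x y => by
    unfold truncated; split_ifs
    · exact le_rfl
    · exact momentSum_nonneg hγ y
  set Y : ℝ × (ℕ → ℝ) → Fin k → ℕ := fun w j => yuleSimon p (t j) w with hY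
  set x : ℝ × (ℕ → ℝ) → Fin k → Bool := fun w j => decide (w.1 ≤ t j) with hx
  have hbound : ∀ K, ∫ w, truncated K G (x w) (Y w) ∂yuleSimonMeasure ≤ D / (1 - p) := by
    intro K
    obtain ⟨B, hB⟩ := exists_bound_truncated G K
    have hlim := tendsto_integral_sum_familySize (p := p) ht (truncated K G) hB
    have hle : familyLimit p t (truncated K G) ≤ D := by
      refine le_of_tendsto hlim ?_
      filter_upwards [eventually_gt_atTop 0] with n hn
      have hn' : (0 : ℝ) < n := by exact_mod_cast hn
      have hM : ∀ j, ⌊(n : ℝ) * t j⌋₊ ≤ n := fun j => floor_mul_le (ht j) n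
      rw [inv_mul_le_iff₀ hn', integral_finsetSum _ fun i _ =>
        (dependsBelow_familySize hM i _).integrable]
      calc _ ≤ ∑ i ∈ Finset.range n,
            ∫ w, momentSum γ (fun j => familySize w i ⌊(n : ℝ) * t j⌋₊) ∂noiseMeasure p := by
            refine Finset.sum_le_sum fun i _ => ?_
            exact integral_mono (dependsBelow_familySize hM i _).integrable
              (dependsBelow_familySize hM i _).integrable fun w => hGle _ _ _
        _ ≤ D * n := sum_integral_momentSum_le hγ hpγ hM
        _ = n * D := mul_comm _ _
    have h0 : ∀ x, truncated K G x (fun _ => 0) = 0 := fun x => by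
      simp [truncated, hG, momentSum, gammaMoment]
    unfold familyLimit at hle
    simp only [h0, integral_zero, mul_zero, zero_add] at hle
    rw [le_div_iff₀ hp1]
    linarith
  have hmeas : ∀ g : (Fin k → Bool) → (Fin k → ℕ) → ℝ,
      AEMeasurable (fun w => g (x w) (Y w)) yuleSimonMeasure :=
    aemeasurable_yuleSimon_functional hp.out ht
  have hlint : ∫⁻ w, ENNReal.ofReal (momentSum γ (Y w)) ∂yuleSimonMeasure
      ≤ ENNReal.ofReal (D / (1 - p)) := by
    have hconv : ∀ w, Tendsto (fun K : ℕ => ENNReal.ofReal (truncated K G (x w) (Y w))) atTop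
        (𝓝 (ENNReal.ofReal (momentSum γ (Y w)))) := by
      intro w
      refine tendsto_const_nhds.congr' ?_
      filter_upwards [eventually_ge_atTop (∑ j, Y w j)] with K hK
      rw [truncated, if_pos]
      exact fun j => (Finset.single_le_sum (fun _ _ => Nat.zero_le _) (Finset.mem_univ j)).trans hK
    calc ∫⁻ w, ENNReal.ofReal (momentSum γ (Y w)) ∂yuleSimonMeasure
        = ∫⁻ w, liminf (fun K : ℕ => ENNReal.ofReal (truncated K G (x w) (Y w))) atTop
            ∂yuleSimonMeasure := by
          refine lintegral_congr fun w => (hconv w).liminf_eq.symm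
      _ ≤ liminf (fun K : ℕ => ∫⁻ w, ENNReal.ofReal (truncated K G (x w) (Y w))
            ∂yuleSimonMeasure) atTop :=
          lintegral_liminf_le' fun K => (hmeas (truncated K G)).ennreal_ofReal
      _ ≤ ENNReal.ofReal (D / (1 - p)) := by
          refine liminf_le_of_frequently_le' (Frequently.of_forall fun K => ?_)
          obtain ⟨B, hB⟩ := exists_bound_truncated G K
          rw [← ofReal_integral_eq_lintegral_ofReal
            (Integrable.of_bound (hmeas _).aestronglyMeasurable B (ae_of_all _ fun w => hB _ _))
            (ae_of_all _ fun w => hG0 _ _ _)]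
          exact ENNReal.ofReal_le_ofReal (hbound K)
  have hint : Integrable (fun w => momentSum γ (Y w)) yuleSimonMeasure := by
    refine ⟨(hmeas G).aestronglyMeasurable, ?_⟩
    rw [hasFiniteIntegral_iff_ofReal (ae_of_all _ fun w => momentSum_nonneg hγ _)]
    exact hlint.trans_lt ENNReal.ofReal_lt_top
  refine ⟨hint, ?_⟩
  rw [mul_comm, ← le_div_iff₀ hp1]
  rw [← ofReal_integral_eq_lintegral_ofReal hint (ae_of_all _ fun w => momentSum_nonneg hγ _)] at hlint
  exact (ENNReal.ofReal_le_ofReal_iff (by positivity)).1 hlint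

/-- The coefficient of an increment in the linear combination `∑ j, (l j S + b j Ŝ)` of the walk and
its reinforced version, when `x j` tells whether the walk at time `j` contains it, and `y j` is the
number of times it appears in the reinforced walk. -/
noncomputable def coefficient {k : ℕ} (l b : Fin k → ℝ) (x : Fin k → Bool) (y : Fin k → ℕ) : ℝ :=
  ∑ j, (l j * (if x j = true then 1 else 0) + b j * y j)

lemma abs_coefficient_le {k : ℕ} (l b : Fin k → ℝ) (x : Fin k → Bool) {y : Fin k → ℕ} {m : ℕ}
    (hy : ∀ j, y j ≤ m) (hm : 1 ≤ m) :
    |coefficient l b x y| ≤ (∑ j, (|l j| + |b j|)) * m := by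
  have hm' : (1 : ℝ) ≤ m := by exact_mod_cast hm
  unfold coefficient
  rw [Finset.sum_mul]
  refine (Finset.abs_sum_le_sum_abs _ _).trans (Finset.sum_le_sum fun j _ => ?_)
  refine (abs_add_le _ _).trans ?_
  rw [add_mul, abs_mul, abs_mul, Nat.abs_cast]
  have h1 : |if x j = true then (1 : ℝ) else 0| ≤ m := by split_ifs <;> simp [hm']
  have h2 : (y j : ℝ) ≤ m := by exact_mod_cast hy j
  gcongr

/-- A function of growth of order `γ < γ'` is negligible compared with moments of order `γ'`, for
large families. -/
lemma exists_truncation {ψ : ℝ → ℂ} {γ γ' C : ℝ} (hγ : 0 < γ) (hγγ' : γ < γ') (hC : 0 ≤ C)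
    (hψ : ∀ z, ‖ψ z‖ ≤ C * (1 + |z| ^ γ)) {k : ℕ} (l b : Fin k → ℝ) {δ : ℝ} (hδ : 0 < δ) :
    ∃ K : ℕ, ∀ x y, ¬ (∀ j, y j ≤ K) → ‖ψ (coefficient l b x y)‖ ≤ δ * momentSum γ' y := by
  have hγ' : 0 < γ' := hγ.trans hγγ'
  set R := ∑ j, (|l j| + |b j|) with hR
  have hR0 : 0 ≤ R := Finset.sum_nonneg fun j _ => by positivity
  set A := C * (1 + R ^ γ) * (1 + γ') ^ γ' with hA
  have hA0 : 0 ≤ A := by positivity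
  -- `|coefficient l b x y| ≤ R m` with `m` the largest component of `y`, and
  -- `m ^ γ ≤ K ^ (γ - γ') m ^ γ'` as soon as `m > K`
  have hlim : Tendsto (fun K : ℕ => A * (K : ℝ) ^ (-(γ' - γ))) atTop (𝓝 0) := by
    have := ((tendsto_rpow_neg_atTop (sub_pos.2 hγγ')).comp
      (tendsto_natCast_atTop_atTop (R := ℝ))).const_mul A
    simpa using this
  obtain ⟨K, hK, hK1⟩ := ((hlim.eventually_lt_const hδ).and (eventually_ge_atTop 1)).exists
  refine ⟨K, fun x y hy => ?_⟩
  push Not at hy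
  obtain ⟨j₁, hj₁⟩ := hy
  have : Nonempty (Fin k) := ⟨j₁⟩
  obtain ⟨j₀, hj₀⟩ := Finite.exists_max y
  set m := y j₀ with hm
  have hKm : K < m := hj₁.trans_le (hj₀ j₁)
  have hK' : (1 : ℝ) ≤ K := by exact_mod_cast hK1
  have hKm' : (K : ℝ) ≤ m := by exact_mod_cast hKm.le
  have hm0 : (0 : ℝ) < m := by linarith
  have h1 : |coefficient l b x y| ^ γ ≤ R ^ γ * (m : ℝ) ^ γ := by
    rw [← Real.mul_rpow hR0 hm0.le]
    exact Real.rpow_le_rpow (abs_nonneg _) (abs_coefficient_le l b x hj₀ (by omega)) hγ.le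
  have h2 : 1 ≤ (m : ℝ) ^ γ := Real.one_le_rpow (by linarith) hγ.le
  have h3 : (m : ℝ) ^ γ ≤ (K : ℝ) ^ (-(γ' - γ)) * (m : ℝ) ^ γ' := by
    have : (m : ℝ) ^ γ = (m : ℝ) ^ (-(γ' - γ)) * (m : ℝ) ^ γ' := by
      rw [← Real.rpow_add hm0]; ring_nf
    rw [this]
    exact mul_le_mul_of_nonneg_right
      (Real.rpow_le_rpow_of_nonpos (by linarith) hKm' (by linarith)) (by positivity)
  have h4 : gammaMoment γ' m ≤ momentSum γ' y :=
    Finset.single_le_sum (f := fun j => gammaMoment γ' (y j))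
      (fun j _ => gammaMoment_nonneg hγ'.le _) (Finset.mem_univ j₀)
  have hms := momentSum_nonneg hγ'.le y
  calc ‖ψ (coefficient l b x y)‖ ≤ C * (1 + |coefficient l b x y| ^ γ) := hψ _
    _ ≤ C * ((1 + R ^ γ) * (m : ℝ) ^ γ) := by
        gcongr
        linarith
    _ ≤ C * ((1 + R ^ γ) * ((K : ℝ) ^ (-(γ' - γ)) * ((1 + γ') ^ γ' * momentSum γ' y))) := by
        gcongr
        refine h3.trans ?_
        gcongr
        refine (rpow_le_gammaMoment hγ' m).trans ?_
        gcongr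
    _ = A * (K : ℝ) ^ (-(γ' - γ)) * momentSum γ' y := by rw [hA]; ring
    _ ≤ δ * momentSum γ' y := by gcongr

/-- The limit `p E[ψ(…)] + (1 - p) E[ψ(…)]` of the empirical means of `ψ` over all increments. -/
noncomputable def exponentLimit (p : ℝ) (ψ : ℝ → ℂ) {k : ℕ} (l b t : Fin k → ℝ) : ℂ :=
  p * (∫ u in Set.Icc (0 : ℝ) 1, ψ (coefficient l b (fun j => decide (u ≤ t j)) (fun _ => 0)))
    + (1 - p) * ∫ w, ψ (coefficient l b (fun j => decide (w.1 ≤ t j))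
        (fun j => yuleSimon p (t j) w)) ∂yuleSimonMeasure

/-- The empirical mean of `ψ` over the coefficients of all `n` increments. -/
noncomputable def empiricalExponent (ψ : ℝ → ℂ) {k : ℕ} (l b t : Fin k → ℝ) (n : ℕ) (w : Noise) : ℂ :=
  (n : ℂ)⁻¹ * ∑ i ∈ Finset.range n, ψ (coefficient l b (fun j => decide (i < ⌊(n : ℝ) * t j⌋₊))
    (fun j => familySize w i ⌊(n : ℝ) * t j⌋₊))

lemma integrable_discarded {ψ : ℝ → ℂ} (hψc : Continuous ψ) {k : ℕ} (l b t : Fin k → ℝ) :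
    Integrable (fun u : ℝ => ψ (coefficient l b (fun j => decide (u ≤ t j)) (fun _ => 0)))
      ((volume : Measure ℝ).restrict (Set.Icc 0 1)) := by
  obtain ⟨B, hB⟩ := exists_bound_of_le (fun x y => ‖ψ (coefficient l b x y)‖) 0
  have hm : Measurable fun u : ℝ => coefficient l b (fun j => decide (u ≤ t j)) (fun _ => 0) := by
    unfold coefficient
    refine Finset.measurable_sum _ fun j _ => Measurable.add (Measurable.mul measurable_const ?_)
      measurable_const
    simp only [decide_eq_true_eq]
    exact Measurable.ite measurableSet_Iic measurable_const measurable_const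
  refine Integrable.of_bound (hψc.measurable.comp hm).aestronglyMeasurable B (ae_of_all _ fun u => ?_)
  have := hB (fun j => decide (u ≤ t j)) (fun _ => 0) fun _ => le_rfl
  rwa [abs_norm] at this

lemma aestronglyMeasurable_shared (hp : p ∈ Set.Ioo (0 : ℝ) 1)
    {k : ℕ} {t : Fin k → ℝ} (ht : ∀ j, t j ≤ 1) (g : (Fin k → Bool) → (Fin k → ℕ) → ℂ) :
    AEStronglyMeasurable (fun w => g (fun j => decide (w.1 ≤ t j)) (fun j => yuleSimon p (t j) w))
      yuleSimonMeasure := by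
  have h1 := aemeasurable_yuleSimon_functional hp ht fun x y => (g x y).re
  have h2 := aemeasurable_yuleSimon_functional hp ht fun x y => (g x y).im
  have := (Complex.measurable_ofReal.comp_aemeasurable h1).add
    ((Complex.measurable_ofReal.comp_aemeasurable h2).mul_const Complex.I)
  refine (this.congr (ae_of_all _ fun w => ?_)).aestronglyMeasurable
  exact Complex.re_add_im _

lemma integrable_shared [hp : Fact (p ∈ Set.Ioo (0 : ℝ) 1)] {ψ : ℝ → ℂ} {γ C : ℝ} (hγ : 0 < γ)
    (hpγ : p * γ < 1) (hC : 0 ≤ C) (hψ : ∀ z, ‖ψ z‖ ≤ C * (1 + |z| ^ γ))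
    {k : ℕ} (l b : Fin k → ℝ) {t : Fin k → ℝ} (ht : ∀ j, t j ≤ 1) :
    Integrable (fun w => ψ (coefficient l b (fun j => decide (w.1 ≤ t j))
      (fun j => yuleSimon p (t j) w))) yuleSimonMeasure := by
  -- moments of an order `γ'` slightly larger than `γ` dominate the tails
  obtain ⟨γ', h1, h2⟩ : ∃ γ', γ < γ' ∧ p * γ' < 1 := by
    have : γ < 1 / p := by rw [lt_div_iff₀ hp.out.1, mul_comm]; exact hpγ
    obtain ⟨γ', h1, h2⟩ := exists_between this
    exact ⟨γ', h1, by rw [lt_div_iff₀ hp.out.1] at h2; linarith⟩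
  obtain ⟨K, hK⟩ := exists_truncation hγ h1 hC hψ l b one_pos
  obtain ⟨B, hB⟩ := exists_bound_of_le (fun x y => ‖ψ (coefficient l b x y)‖) K
  have hmom := (integrable_momentSum_yuleSimon (p := p) (hγ.trans h1).le h2 ht).1
  refine ((integrable_const |B|).add hmom).mono' (aestronglyMeasurable_shared hp.out ht fun x y =>
    ψ (coefficient l b x y)) (ae_of_all _ fun w => ?_)
  have hm0 := momentSum_nonneg (hγ.trans h1).le fun j => yuleSimon p (t j) w
  simp only [Pi.add_apply]
  by_cases h : ∀ j, yuleSimon p (t j) w ≤ K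
  · have := hB (fun j => decide (w.1 ≤ t j)) _ h
    rw [abs_norm] at this
    linarith [le_abs_self B]
  · have := hK (fun j => decide (w.1 ≤ t j)) _ h
    linarith [abs_nonneg B]

/-- The empirical means of `ψ` over the coefficients of all increments converge in `L¹`. -/
lemma tendsto_integral_norm_empiricalExponent_sub [hp : Fact (p ∈ Set.Ioo (0 : ℝ) 1)] {ψ : ℝ → ℂ}
    (hψc : Continuous ψ) {γ C : ℝ} (hγ : 0 < γ)
    (hpγ : p * γ < 1) (hC : 0 ≤ C) (hψ : ∀ z, ‖ψ z‖ ≤ C * (1 + |z| ^ γ))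
    {k : ℕ} (l b : Fin k → ℝ) {t : Fin k → ℝ} (ht : ∀ j, t j ≤ 1) :
    Tendsto (fun n : ℕ => ∫ w, ‖empiricalExponent ψ l b t n w - exponentLimit p ψ l b t‖
      ∂noiseMeasure p) atTop (𝓝 0) := by
  -- moments of an order `γ'` slightly larger than `γ` dominate the tails
  obtain ⟨γ', h1, h2⟩ : ∃ γ', γ < γ' ∧ p * γ' < 1 := by
    have : γ < 1 / p := by rw [lt_div_iff₀ hp.out.1, mul_comm]; exact hpγ
    obtain ⟨γ', h1, h2⟩ := exists_between this
    exact ⟨γ', h1, by rw [lt_div_iff₀ hp.out.1] at h2; linarith⟩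
  have hγ' : 0 ≤ γ' := (hγ.trans h1).le
  have hp1 : 0 < 1 - p := by linarith [hp.out.2]
  set D : ℝ := k * (1 - p * γ')⁻¹ with hD
  have hD0 : 0 ≤ D := mul_nonneg (Nat.cast_nonneg k) (inv_nonneg.2 (by linarith))
  obtain ⟨hmom, hmomle⟩ := integrable_momentSum_yuleSimon (p := p) hγ' h2 ht
  set G : (Fin k → Bool) → (Fin k → ℕ) → ℂ := fun x y => ψ (coefficient l b x y) with hG
  set x : ℕ → ℕ → Fin k → Bool := fun n i j => decide (i < ⌊(n : ℝ) * t j⌋₊) with hx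
  set y : ℕ → ℕ → Noise → Fin k → ℕ := fun n i w j => familySize w i ⌊(n : ℝ) * t j⌋₊ with hy
  have hM : ∀ (n : ℕ) j, ⌊(n : ℝ) * t j⌋₊ ≤ n := fun n j => floor_mul_le (ht j) n
  rw [Metric.tendsto_atTop]
  intro ε hε
  -- the two truncation errors and the two `L¹` distances add up to `δ (2 D + 2)`
  set δ := ε / (2 * D + 2) with hδ
  have hδ0 : 0 < δ := by positivity
  obtain ⟨K, hK⟩ := exists_truncation hγ h1 hC hψ l b hδ0
  have hKe : ∀ x y, ‖G x y - truncated K G x y‖ ≤ δ * momentSum γ' y := by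
    intro x y
    unfold truncated
    split_ifs with h
    · rw [sub_self, norm_zero]; exact mul_nonneg hδ0.le (momentSum_nonneg hγ' y)
    · rw [sub_zero]; exact hK x y h
  have hre : ∀ x y, (truncated K G x y).re = truncated K (fun x y => (G x y).re) x y := fun x y => by
    unfold truncated; split_ifs <;> simp
  have him : ∀ x y, (truncated K G x y).im = truncated K (fun x y => (G x y).im) x y := fun x y => by
    unfold truncated; split_ifs <;> simp
  obtain ⟨B₁, hB₁⟩ := exists_bound_truncated (fun x y => (G x y).re) K
  obtain ⟨B₂, hB₂⟩ := exists_bound_truncated (fun x y => (G x y).im) K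
  set L₁ := familyLimit p t (truncated K fun x y => (G x y).re) with hL₁
  set L₂ := familyLimit p t (truncated K fun x y => (G x y).im) with hL₂
  have hconv := (tendsto_integral_abs_sum_familySize (p := p) ht _ hB₁).add
    (tendsto_integral_abs_sum_familySize (p := p) ht _ hB₂)
  rw [add_zero] at hconv
  -- the truncated functional and the limit of its empirical means
  have hT : ∀ x y, ‖truncated K G x y‖ ≤ B₁ + B₂ := fun x y => by
    refine (Complex.norm_le_abs_re_add_abs_im _).trans ?_
    rw [hre, him]
    exact add_le_add (hB₁ x y) (hB₂ x y)
  have hLK : ‖((L₁ : ℂ) + L₂ * Complex.I) - exponentLimit p ψ l b t‖ ≤ δ * D := by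
    set Y : ℝ × (ℕ → ℝ) → Fin k → ℕ := fun w j => yuleSimon p (t j) w with hY
    set X : ℝ × (ℕ → ℝ) → Fin k → Bool := fun w j => decide (w.1 ≤ t j) with hX
    have hTint : Integrable (fun w => truncated K G (X w) (Y w)) yuleSimonMeasure :=
      Integrable.of_bound (aestronglyMeasurable_shared hp.out ht (truncated K G)) (B₁ + B₂)
        (ae_of_all _ fun w => hT _ _)
    have hGint : Integrable (fun w => G (X w) (Y w)) yuleSimonMeasure :=
      integrable_shared hγ hpγ hC hψ l b ht
    have hdint := integrable_discarded hψc l b t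
    have h0 : ∀ x, truncated K G x (fun _ => 0) = G x fun _ => 0 := fun x => by simp [truncated]
    have hsplit : ((L₁ : ℂ) + L₂ * Complex.I)
        = p * (∫ u in Set.Icc (0 : ℝ) 1, G (fun j => decide (u ≤ t j)) (fun _ => 0))
          + (1 - p) * ∫ w, truncated K G (X w) (Y w) ∂yuleSimonMeasure := by
      rw [hL₁, hL₂]
      unfold familyLimit
      simp_rw [← hre, ← him, h0]
      rw [← integral_re_add_im hdint, ← integral_re_add_im hTint]
      simp only [Complex.coe_algebraMap, RCLike.re_to_complex, RCLike.im_to_complex, RCLike.I_to_complex]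
      push_cast
      ring
    have hdiff : ((L₁ : ℂ) + L₂ * Complex.I) - exponentLimit p ψ l b t
        = ((1 - p : ℝ) : ℂ) * ∫ w, (truncated K G (X w) (Y w) - G (X w) (Y w)) ∂yuleSimonMeasure := by
      rw [hsplit, integral_sub hTint hGint]
      unfold exponentLimit
      push_cast
      ring
    rw [hdiff, norm_mul, Complex.norm_real, Real.norm_eq_abs, abs_of_pos hp1]
    calc (1 - p) * ‖∫ w, (truncated K G (X w) (Y w) - G (X w) (Y w)) ∂yuleSimonMeasure‖
        ≤ (1 - p) * ∫ w, δ * momentSum γ' (Y w) ∂yuleSimonMeasure := by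
          refine mul_le_mul_of_nonneg_left ?_ hp1.le
          refine norm_integral_le_of_norm_le (hmom.const_mul δ) (ae_of_all _ fun w => ?_)
          rw [norm_sub_rev]
          exact hKe _ _
      _ = δ * ((1 - p) * ∫ w, momentSum γ' (Y w) ∂yuleSimonMeasure) := by
          rw [integral_const_mul]; ring
      _ ≤ δ * D := by gcongr
  obtain ⟨N, hN⟩ := (Metric.tendsto_atTop.1 hconv) δ hδ0
  refine ⟨N + 1, fun n hn => ?_⟩
  have hn0 : 0 < n := by omega
  have hn' : (0 : ℝ) < n := by exact_mod_cast hn0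
  have hNn := hN n (by omega)
  rw [Real.dist_eq, sub_zero] at hNn ⊢
  rw [abs_of_nonneg (integral_nonneg fun w => norm_nonneg _)]
  have hNn' := (le_abs_self _).trans_lt hNn
  have hd1 : ∀ i, Integrable (fun w => momentSum γ' (y n i w)) (noiseMeasure p) := fun i =>
    (dependsBelow_familySize (hM n) i (momentSum γ')).integrable
  set R : Noise → ℝ := fun w => (n : ℝ)⁻¹ * ∑ i ∈ Finset.range n,
    truncated K (fun x y => (G x y).re) (x n i) (y n i w) with hR
  set S : Noise → ℝ := fun w => (n : ℝ)⁻¹ * ∑ i ∈ Finset.range n,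
    truncated K (fun x y => (G x y).im) (x n i) (y n i w) with hS
  have hsumd : ∀ (g : (Fin k → Bool) → (Fin k → ℕ) → ℝ), DependsBelow n fun w : Noise =>
      (n : ℝ)⁻¹ * ∑ i ∈ Finset.range n, g (x n i) (y n i w) := fun g w w' h => by
    dsimp only
    congr 1
    exact Finset.sum_congr rfl fun i _ => dependsBelow_familySize (hM n) i (g (x n i)) w w' h
  have hRi : Integrable (fun w => |R w - L₁|) (noiseMeasure p) :=
    DependsBelow.integrable (k := n) fun w w' h => by simp only [hR, hsumd _ w w' h]
  have hSi : Integrable (fun w => |S w - L₂|) (noiseMeasure p) :=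
    DependsBelow.integrable (k := n) fun w w' h => by simp only [hS, hsumd _ w w' h]
  have hmean : Integrable (fun w => (n : ℝ)⁻¹ * ∑ i ∈ Finset.range n, δ * momentSum γ' (y n i w))
      (noiseMeasure p) := (integrable_finsetSum _ fun i _ => (hd1 i).const_mul δ).const_mul _
  have hpt : ∀ w, ‖empiricalExponent ψ l b t n w - exponentLimit p ψ l b t‖
      ≤ (n : ℝ)⁻¹ * ∑ i ∈ Finset.range n, δ * momentSum γ' (y n i w)
        + (|R w - L₁| + |S w - L₂|) + δ * D := by
    intro w
    have e1 : empiricalExponent ψ l b t n w - exponentLimit p ψ l b t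
        = (n : ℂ)⁻¹ * ∑ i ∈ Finset.range n, (G (x n i) (y n i w) - truncated K G (x n i) (y n i w))
          + (((R w - L₁ : ℝ) : ℂ) + ((S w - L₂ : ℝ) : ℂ) * Complex.I)
          + (((L₁ : ℂ) + L₂ * Complex.I) - exponentLimit p ψ l b t) := by
      have e2 : (n : ℂ)⁻¹ * ∑ i ∈ Finset.range n, truncated K G (x n i) (y n i w)
          = ((R w : ℝ) : ℂ) + ((S w : ℝ) : ℂ) * Complex.I := by
        have : ∀ i, truncated K G (x n i) (y n i w)
            = ((truncated K (fun x y => (G x y).re) (x n i) (y n i w) : ℝ) : ℂ)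
              + ((truncated K (fun x y => (G x y).im) (x n i) (y n i w) : ℝ) : ℂ) * Complex.I :=
          fun i => by rw [← hre, ← him, Complex.re_add_im]
        simp_rw [this, Finset.sum_add_distrib, ← Finset.sum_mul]
        simp only [hR, hS]
        push_cast
        ring
      rw [Finset.sum_sub_distrib, mul_sub, e2]
      unfold empiricalExponent
      simp only [hG, hx, hy]
      push_cast
      ring
    rw [e1]
    refine (norm_add_le _ _).trans (add_le_add ((norm_add_le _ _).trans (add_le_add ?_ ?_)) hLK)
    · rw [norm_mul, norm_inv, Complex.norm_natCast]
      refine mul_le_mul_of_nonneg_left ?_ (inv_nonneg.2 hn'.le)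
      exact (norm_sum_le _ _).trans (Finset.sum_le_sum fun i _ => hKe _ _)
    · refine (norm_add_le _ _).trans (le_of_eq ?_)
      rw [norm_mul, Complex.norm_I, mul_one, Complex.norm_real, Complex.norm_real,
        Real.norm_eq_abs, Real.norm_eq_abs]
  have hmeanle : ∫ w, (n : ℝ)⁻¹ * ∑ i ∈ Finset.range n, δ * momentSum γ' (y n i w) ∂noiseMeasure p
      ≤ δ * D := by
    rw [integral_const_mul, integral_finsetSum _ fun i _ => (hd1 i).const_mul δ]
    simp_rw [integral_const_mul]
    rw [← Finset.mul_sum, inv_mul_le_iff₀ hn']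
    have := sum_integral_momentSum_le (p := p) hγ' h2 (hM n)
    calc _ ≤ δ * (D * n) := by gcongr
      _ = n * (δ * D) := by ring
  calc ∫ w, ‖empiricalExponent ψ l b t n w - exponentLimit p ψ l b t‖ ∂noiseMeasure p
      ≤ ∫ w, ((n : ℝ)⁻¹ * ∑ i ∈ Finset.range n, δ * momentSum γ' (y n i w)
        + (|R w - L₁| + |S w - L₂|) + δ * D) ∂noiseMeasure p :=
        integral_mono_of_nonneg (ae_of_all _ fun w => norm_nonneg _)
          ((hmean.add (hRi.add hSi)).add (integrable_const _)) (ae_of_all _ hpt)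
    _ = ∫ w, (n : ℝ)⁻¹ * ∑ i ∈ Finset.range n, δ * momentSum γ' (y n i w) ∂noiseMeasure p
        + (∫ w, |R w - L₁| ∂noiseMeasure p + ∫ w, |S w - L₂| ∂noiseMeasure p) + δ * D := by
        have hRS : Integrable (fun w => |R w - L₁| + |S w - L₂|) (noiseMeasure p) := hRi.add hSi
        have h3 : Integrable (fun w => (n : ℝ)⁻¹ * ∑ i ∈ Finset.range n, δ * momentSum γ' (y n i w)
          + (|R w - L₁| + |S w - L₂|)) (noiseMeasure p) := hmean.add hRS
        rw [integral_add h3 (integrable_const _), integral_add hmean hRS, integral_add hRi hSi]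
        simp
    _ < δ * D + δ + δ * D + δ := by linarith
    _ = ε := by rw [hδ]; field_simp; ring

end

section

/-! ### Convergence of the characteristic functions -/

variable {p : ℝ}

lemma one_le_yuleSimon_iff {s : ℝ} {w : ℝ × (ℕ → ℝ)} : 1 ≤ yuleSimon p s w ↔ w.1 ≤ s := by
  unfold yuleSimon yule
  split_ifs with h <;> simp [h]

lemma sharedArg_eq_coefficient {k : ℕ} (l b s : Fin k → ℝ) (w : ℝ × (ℕ → ℝ)) :
    sharedArg p l b s w
      = coefficient l b (fun j => decide (w.1 ≤ s j)) (fun j => yuleSimon p (s j) w) := by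
  simp [sharedArg, coefficient, one_le_yuleSimon_iff]

lemma discardedArg_eq_coefficient {k : ℕ} (l b s : Fin k → ℝ) (u : ℝ) :
    discardedArg l s u = coefficient l b (fun j => decide (u ≤ s j)) (fun _ => 0) := by
  simp [discardedArg, coefficient]

lemma jointCharFun_one {a q : ℝ} {Λ : Measure ℝ} {k : ℕ} (l b : Fin k → ℝ) (t : Fin k → ℝ≥0) :
    jointCharFun a q Λ p l b t 1
      = Complex.exp (exponentLimit p (levyExponent a q Λ) l b fun j => (t j : ℝ)) := by
  simp [jointCharFun, exponentLimit, sharedArg_eq_coefficient, discardedArg_eq_coefficient l b]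

/-- The exponential is `1`-Lipschitz on the left half plane. -/
lemma norm_exp_sub_exp_le {z w : ℂ} (hz : z.re ≤ 0) (hw : w.re ≤ 0) :
    ‖Complex.exp z - Complex.exp w‖ ≤ ‖z - w‖ := by
  have := (convex_halfSpace_re_le (0 : ℝ)).norm_image_sub_le_of_norm_hasDerivWithin_le
    (𝕜 := ℂ) (f := Complex.exp) (f' := Complex.exp) (C := 1) (x := w) (y := z)
    (fun x _ => (Complex.hasDerivAt_exp x).hasDerivWithinAt)
    (fun x hx => by
      rw [Complex.norm_exp]
      exact Real.exp_le_one_iff.2 hx) hw hz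
  rwa [one_mul] at this

lemma re_empiricalExponent_nonpos {ψ : ℝ → ℂ} (hψ : ∀ z, (ψ z).re ≤ 0) {k : ℕ} (l b t : Fin k → ℝ)
    (n : ℕ) (w : Noise) : (empiricalExponent ψ l b t n w).re ≤ 0 := by
  unfold empiricalExponent
  rw [← Complex.ofReal_natCast, ← Complex.ofReal_inv, Complex.re_ofReal_mul, Complex.re_sum]
  exact mul_nonpos_of_nonneg_of_nonpos (by positivity) (Finset.sum_nonpos fun i _ => hψ _)

lemma re_integral_nonpos {α : Type*} [MeasurableSpace α] {μ : Measure α} {f : α → ℂ}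
    (hf : Integrable f μ) (h : ∀ x, (f x).re ≤ 0) : (∫ x, f x ∂μ).re ≤ 0 := by
  have := integral_re hf
  simp only [RCLike.re_to_complex] at this
  rw [← this]
  exact integral_nonpos h

lemma re_exponentLimit_nonpos [hp : Fact (p ∈ Set.Ioo (0 : ℝ) 1)] {ψ : ℝ → ℂ}
    (hψc : Continuous ψ) (hre : ∀ z, (ψ z).re ≤ 0) {γ C : ℝ} (hγ : 0 < γ)
    (hpγ : p * γ < 1) (hC : 0 ≤ C) (hψ : ∀ z, ‖ψ z‖ ≤ C * (1 + |z| ^ γ))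
    {k : ℕ} (l b : Fin k → ℝ) {t : Fin k → ℝ} (ht : ∀ j, t j ≤ 1) :
    (exponentLimit p ψ l b t).re ≤ 0 := by
  have h1 := re_integral_nonpos (integrable_discarded hψc l b t) fun _ => hre _
  have h2 := re_integral_nonpos (integrable_shared (p := p) hγ hpγ hC hψ l b ht) fun _ => hre _
  have hp0 := hp.out.1
  have hp1 : 0 ≤ 1 - p := by linarith [hp.out.2]
  unfold exponentLimit
  rw [Complex.add_re, ← Complex.ofReal_one, ← Complex.ofReal_sub, Complex.re_ofReal_mul,
    Complex.re_ofReal_mul]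
  exact add_nonpos (mul_nonpos_of_nonneg_of_nonpos hp0.le h1)
    (mul_nonpos_of_nonneg_of_nonpos hp1 h2)

lemma natFloor_coe_mul (n : ℕ) (t : ℝ≥0) : ⌊(n : ℝ) * (t : ℝ)⌋₊ = ⌊(n : ℝ≥0) * t⌋₊ := by
  refine eq_of_forall_le_iff fun m => ?_
  rw [Nat.le_floor_iff (by positivity), Nat.le_floor_iff zero_le, ← NNReal.coe_le_coe]
  push_cast
  rfl

/-- Given the noise, linear combinations of the two walks are linear combinations of the increments
of the skeleton. -/
lemma sum_walks_eq {Ω : Type*} {ξ : ℝ≥0 → Ω → ℝ} {ε : ℕ → Ω → Bool}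
    {U : (k : ℕ) → Ω → Fin (k + 1)} {k : ℕ} (l b : Fin k → ℝ)
    {n : ℕ} {M : Fin k → ℕ} (hM : ∀ j, M j ≤ n) (ω : Ω) :
    ∑ j, (l j * skeletonWalk ξ n (M j) ω + b j * reinforcedWalk ξ ε U n (M j) ω)
      = ∑ i ∈ Finset.range n, coefficient l b (fun j => decide (i < M j))
          (fun j => familySize ((fun k => ε k ω, fun k => U k ω) : Noise) i (M j))
            * skeletonStep ξ n i ω := by
  unfold coefficient
  simp_rw [Finset.sum_mul]
  rw [Finset.sum_comm]
  refine Finset.sum_congr rfl fun j _ => ?_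
  have h1 : skeletonWalk ξ n (M j) ω
      = ∑ i ∈ Finset.range n, (if i < M j then 1 else 0) * skeletonStep ξ n i ω := by
    simp_rw [ite_mul, one_mul, zero_mul]
    rw [← Finset.sum_filter]
    refine Finset.sum_congr ?_ fun _ _ => rfl
    ext i
    have := hM j
    simp only [Finset.mem_range, Finset.mem_filter]
    omega
  have h2 := sum_familySize_mul (fun i => skeletonStep ξ n i ω)
    ((fun k => ε k ω, fun k => U k ω) : Noise) (hM j)
  rw [h1, reinforcedWalk, h2, Finset.mul_sum, Finset.mul_sum, ← Finset.sum_add_distrib]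
  refine Finset.sum_congr rfl fun i _ => ?_
  simp only [decide_eq_true_eq]
  ring

variable {Ω : Type*} [MeasurableSpace Ω] {P : Measure Ω} {a q : ℝ} {Λ : Measure ℝ} {ξ : ℝ≥0 → Ω → ℝ}

/-- Given the noise, the increments of the skeleton are still independent, so that the
characteristic function is the mean over the noise of the exponential of an empirical mean. -/
lemma integral_exp_walks [IsProbabilityMeasure P] [Fact (p ∈ Set.Ioo (0 : ℝ) 1)]
    (hξ : IsLevyProcess a q Λ ξ P) {ε : ℕ → Ω → Bool} {U : (k : ℕ) → Ω → Fin (k + 1)}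
    (hnoise : IsReinforcementNoise p ε U P) {n : ℕ} (hn : 0 < n)
    (hindep : IndepFun (fun ω k => skeletonStep ξ n k ω)
      (fun ω => ((fun k => ε k ω), (fun k => U k ω))) P)
    {k : ℕ} (l b : Fin k → ℝ) {t : Fin k → ℝ≥0} (ht : ∀ j, t j ≤ 1) :
    ∫ ω, Complex.exp (Complex.I * ((∑ j, (l j * skeletonWalk ξ n ⌊(n : ℝ≥0) * t j⌋₊ ω
        + b j * reinforcedWalk ξ ε U n ⌊(n : ℝ≥0) * t j⌋₊ ω) : ℝ) : ℂ)) ∂P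
      = ∫ w, Complex.exp (empiricalExponent (levyExponent a q Λ) l b (fun j => (t j : ℝ)) n w)
          ∂noiseMeasure p := by
  have hM : ∀ j, ⌊(n : ℝ≥0) * t j⌋₊ ≤ n := fun j => by
    rw [← natFloor_coe_mul]; exact floor_mul_le (by exact_mod_cast ht j) n
  set c : Noise → ℕ → ℝ := fun w i => coefficient l b (fun j => decide (i < ⌊(n : ℝ≥0) * t j⌋₊))
    (fun j => familySize w i ⌊(n : ℝ≥0) * t j⌋₊) with hc
  have hcm : ∀ i, Measurable fun w => c w i := fun i =>
    (dependsBelow_familySize hM i fun y =>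
      coefficient l b (fun j => decide (i < ⌊(n : ℝ≥0) * t j⌋₊)) y).measurable
  have hε := hnoise.measurable_bernoulli
  have hU := hnoise.measurable_uniform
  have hX := hξ.measurable_skeletonStep n
  have hXm : Measurable fun ω k => skeletonStep ξ n k ω := measurable_pi_iff.2 hX
  have hWm : Measurable fun ω => ((fun k => ε k ω, fun k => U k ω) : Noise) := by fun_prop
  set F : (ℕ → ℝ) × Noise → ℂ := fun z => Complex.exp (Complex.I *
    ((∑ i ∈ Finset.range n, c z.2 i * z.1 i : ℝ) : ℂ)) with hF
  have hFm : Measurable F := by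
    have : Measurable fun z : (ℕ → ℝ) × Noise => ∑ i ∈ Finset.range n, c z.2 i * z.1 i :=
      Finset.measurable_sum _ fun i _ =>
        ((hcm i).comp measurable_snd).mul ((measurable_pi_apply i).comp measurable_fst)
    fun_prop
  have hlaw := (indepFun_iff_map_prod_eq_prod_map_map hXm.aemeasurable hWm.aemeasurable).1 hindep
  rw [hnoise.map_eq] at hlaw
  have hpr : IsProbabilityMeasure (P.map fun ω k => skeletonStep ξ n k ω) :=
    Measure.isProbabilityMeasure_map hXm.aemeasurable
  have hFi : Integrable F ((P.map fun ω k => skeletonStep ξ n k ω).prod (noiseMeasure p)) :=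
    Integrable.of_bound hFm.aestronglyMeasurable 1 (ae_of_all _ fun z => by
      rw [hF]; dsimp only; rw [mul_comm, Complex.norm_exp_ofReal_mul_I])
  calc _ = ∫ ω, F (fun k => skeletonStep ξ n k ω, (fun k => ε k ω, fun k => U k ω)) ∂P := by
        refine integral_congr_ae (ae_of_all _ fun ω => ?_)
        dsimp only
        rw [sum_walks_eq l b hM]
    _ = ∫ z, F z ∂(P.map fun ω k => skeletonStep ξ n k ω).prod (noiseMeasure p) := by
        rw [← hlaw, integral_map (hXm.prodMk hWm).aemeasurable hFm.aestronglyMeasurable]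
    _ = ∫ w, ∫ x, F (x, w) ∂(P.map fun ω k => skeletonStep ξ n k ω) ∂noiseMeasure p :=
        integral_prod_symm _ hFi
    _ = _ := by
        refine integral_congr_ae (ae_of_all _ fun w => ?_)
        dsimp only
        rw [integral_map (f := fun x => F (x, w)) hXm.aemeasurable
          (hFm.comp measurable_prodMk_right).aestronglyMeasurable]
        simp only [hF]
        rw [hξ.charFun_sum_skeletonStep hn, empiricalExponent]
        simp only [hc, natFloor_coe_mul]

/-- The characteristic functions of the two walks converge. -/
lemma tendsto_charFun_walks [IsProbabilityMeasure P] (hp : Admissible p q Λ)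
    (hξ : IsLevyProcess a q Λ ξ P) {ε : ℕ → ℕ → Ω → Bool} {U : ℕ → (k : ℕ) → Ω → Fin (k + 1)}
    (hnoise : ∀ n, IsReinforcementNoise p (ε n) (U n) P)
    (hindep : ∀ n, IndepFun (fun ω k => skeletonStep ξ n k ω)
      (fun ω => ((fun k => ε n k ω), (fun k => U n k ω))) P)
    {k : ℕ} (l b : Fin k → ℝ) {t : Fin k → ℝ≥0} (ht : ∀ j, t j ≤ 1) :
    IntegrableOn (fun u : ℝ => levyExponent a q Λ (discardedArg l (fun j => (t j : ℝ)) u))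
        (Set.Icc 0 1) ∧
      Integrable (fun w => levyExponent a q Λ (sharedArg p l b (fun j => (t j : ℝ)) w))
        yuleSimonMeasure ∧
      Tendsto (fun n : ℕ => ∫ ω, Complex.exp (Complex.I *
          ((∑ j, (l j * skeletonWalk ξ n ⌊(n : ℝ≥0) * t j⌋₊ ω
            + b j * reinforcedWalk ξ (ε n) (U n) n ⌊(n : ℝ≥0) * t j⌋₊ ω) : ℝ) : ℂ)) ∂P)
        atTop (𝓝 (jointCharFun a q Λ p l b t 1)) := by
  have hΛ := hξ.isLevyMeasure
  have : Fact (p ∈ Set.Ioo (0 : ℝ) 1) := ⟨⟨hp.1, hp.2.1⟩⟩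
  obtain ⟨γ, C, hγ, hpγ, hC, hψ⟩ := exists_growth_exponent a q hΛ hp
  have hγ0 : 0 < γ := by linarith
  have hψc := continuous_levyExponent a q hΛ
  have hre := re_levyExponent_nonpos a q hΛ
  have ht' : ∀ j, (t j : ℝ) ≤ 1 := fun j => by exact_mod_cast ht j
  refine ⟨?_, ?_, ?_⟩
  · simp_rw [discardedArg_eq_coefficient l b]
    exact integrable_discarded hψc l b _
  · simp_rw [sharedArg_eq_coefficient]
    exact integrable_shared hγ0 hpγ hC hψ l b ht'
  rw [jointCharFun_one, tendsto_iff_norm_sub_tendsto_zero]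
  refine squeeze_zero' (Eventually.of_forall fun _ => norm_nonneg _) ?_
    (tendsto_integral_norm_empiricalExponent_sub hψc hγ0 hpγ hC hψ l b ht')
  filter_upwards [eventually_gt_atTop 0] with n hn
  rw [integral_exp_walks hξ (hnoise n) hn (hindep n) l b ht]
  have hM : ∀ j, ⌊(n : ℝ) * (t j : ℝ)⌋₊ ≤ n := fun j => floor_mul_le (ht' j) n
  have hd : DependsBelow n
      (empiricalExponent (levyExponent a q Λ) l b (fun j => (t j : ℝ)) n) := fun w w' h => by
    unfold empiricalExponent
    congr 1
    exact Finset.sum_congr rfl fun i _ => dependsBelow_familySize hM i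
      (fun y => levyExponent a q Λ (coefficient l b _ y)) w w' h
  have h1 : Integrable (fun w => Complex.exp
      (empiricalExponent (levyExponent a q Λ) l b (fun j => (t j : ℝ)) n w)) (noiseMeasure p) :=
    DependsBelow.integrable (k := n) fun w w' h => by simp only [hd w w' h]
  have h2 : Integrable (fun w => ‖empiricalExponent (levyExponent a q Λ) l b (fun j => (t j : ℝ)) n w
      - exponentLimit p (levyExponent a q Λ) l b fun j => (t j : ℝ)‖) (noiseMeasure p) :=
    DependsBelow.integrable (k := n) fun w w' h => by simp only [hd w w' h]
  set L := exponentLimit p (levyExponent a q Λ) l b fun j => (t j : ℝ) with hL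
  have h3 : Complex.exp L = ∫ _w, Complex.exp L ∂noiseMeasure p := by simp
  rw [h3, ← integral_sub h1 (integrable_const _)]
  exact norm_integral_le_of_norm_le h2 (ae_of_all _ fun w =>
    norm_exp_sub_exp_le (re_empiricalExponent_nonpos hre l b _ n w)
      (re_exponentLimit_nonpos hψc hre hγ0 hpγ hC hψ l b ht'))

end

section

/-! ### Convergence of the finite-dimensional distributions -/

/-- A finite family of pairs of real numbers as a point of a Euclidean space, where characteristic
functions are available. -/
def pairsToEuclidean {ι : Type*} (x : ι → ℝ × ℝ) : EuclideanSpace ℝ (ι ⊕ ι) :=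
  WithLp.toLp 2 (Sum.elim (fun i => (x i).1) (fun i => (x i).2))

lemma continuous_pairsToEuclidean {ι : Type*} :
    Continuous (pairsToEuclidean (ι := ι)) := by
  refine (PiLp.continuous_toLp 2 _).comp (continuous_pi fun s => ?_)
  rcases s with i | i
  · exact (continuous_apply i).fst
  · exact (continuous_apply i).snd

lemma charFun_map_pairsToEuclidean {ι : Type*} [Fintype ι] {Ω : Type*} [MeasurableSpace Ω]
    (P : Measure Ω) {X : Ω → ι → ℝ × ℝ} (hX : Measurable X) (v : EuclideanSpace ℝ (ι ⊕ ι)) :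
    charFun (P.map (pairsToEuclidean ∘ X)) v = ∫ ω, Complex.exp (Complex.I *
      ((∑ i, (v (Sum.inl i) * (X ω i).1 + v (Sum.inr i) * (X ω i).2) : ℝ) : ℂ)) ∂P := by
  have hin : ∀ x : ι → ℝ × ℝ, inner ℝ (pairsToEuclidean x) v
      = ∑ i, (v (Sum.inl i) * (x i).1 + v (Sum.inr i) * (x i).2) := by
    intro x
    rw [PiLp.inner_apply, Fintype.sum_sum_type, Finset.sum_add_distrib]
    simp [pairsToEuclidean]
  rw [charFun_apply, integral_map
    (continuous_pairsToEuclidean.measurable.comp hX).aemeasurable (by fun_prop)]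
  simp only [Function.comp_apply, hin]
  simp_rw [mul_comm Complex.I]

/-- Lévy's continuity theorem for vectors of pairs of real random variables. -/
lemma tendstoInDistribution_of_tendsto_charFun {ι : Type*} [Fintype ι] {Ω Ω' : Type*}
    [MeasurableSpace Ω] [MeasurableSpace Ω'] {P : Measure Ω} [IsProbabilityMeasure P]
    {P' : Measure Ω'} [IsProbabilityMeasure P'] {X : ℕ → Ω → ι → ℝ × ℝ} {Z : Ω' → ι → ℝ × ℝ}
    (hX : ∀ n, Measurable (X n)) (hZ : Measurable Z)
    (h : ∀ l b : ι → ℝ, Tendsto (fun n => ∫ ω, Complex.exp (Complex.I *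
        ((∑ i, (l i * (X n ω i).1 + b i * (X n ω i).2) : ℝ) : ℂ)) ∂P) atTop
      (𝓝 (∫ ω, Complex.exp (Complex.I *
        ((∑ i, (l i * (Z ω i).1 + b i * (Z ω i).2) : ℝ) : ℂ)) ∂P'))) :
    TendstoInDistribution X atTop Z (fun _ => P) P' := by
  have he := (continuous_pairsToEuclidean (ι := ι)).measurable
  have hconv : TendstoInDistribution (fun n => pairsToEuclidean ∘ X n) atTop
      (pairsToEuclidean ∘ Z) (fun _ => P) P' := by
    refine ⟨fun n => (he.comp (hX n)).aemeasurable, (he.comp hZ).aemeasurable, ?_⟩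
    refine ProbabilityMeasure.tendsto_iff_tendsto_charFun.2 fun v => ?_
    simp only [ProbabilityMeasure.coe_mk]
    rw [charFun_map_pairsToEuclidean P' hZ]
    simp_rw [charFun_map_pairsToEuclidean P (hX _)]
    exact h _ _
  have hg : Continuous fun (v : EuclideanSpace ℝ (ι ⊕ ι)) (i : ι) =>
      (v (Sum.inl i), v (Sum.inr i)) := by fun_prop
  exact hconv.continuous_comp hg

/-- Terms outside of `T` vanish; the remaining ones are listed in increasing order of their index. -/
lemma sum_eq_sum_orderEmbOfFin {ι M : Type*} [Fintype ι] [LinearOrder ι] [AddCommMonoid M]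
    (T : Finset ι) {f : ι → M} (h : ∀ i, i ∉ T → f i = 0) :
    ∑ i, f i = ∑ j, f (T.orderEmbOfFin rfl j) := by
  rw [← Finset.sum_subset (Finset.subset_univ T) fun i _ hi => h i hi]
  conv_lhs => rw [← T.map_orderEmbOfFin_univ rfl]
  rw [Finset.sum_map]
  rfl

variable {Ω : Type*} [MeasurableSpace Ω] {P : Measure Ω} {a q p : ℝ} {Λ : Measure ℝ}
  {ξ : ℝ≥0 → Ω → ℝ}

lemma IsLevyProcess.measurable_skeletonWalk (hξ : IsLevyProcess a q Λ ξ P) (n m : ℕ) :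
    Measurable (skeletonWalk ξ n m) :=
  Finset.measurable_sum _ fun k _ => hξ.measurable_skeletonStep n k

lemma IsLevyProcess.measurable_reinforcedWalk (hξ : IsLevyProcess a q Λ ξ P)
    {ε : ℕ → Ω → Bool} {U : (k : ℕ) → Ω → Fin (k + 1)} (hnoise : IsReinforcementNoise p ε U P)
    (n m : ℕ) : Measurable (reinforcedWalk ξ ε U n m) := by
  have hε := hnoise.measurable_bernoulli
  have hU := hnoise.measurable_uniform
  have hW : Measurable fun ω => ((fun k => ε k ω, fun k => U k ω) : Noise) := by fun_prop
  have heq : reinforcedWalk ξ ε U n m = fun ω => ∑ i ∈ Finset.range m,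
      familySize ((fun k => ε k ω, fun k => U k ω) : Noise) i m * skeletonStep ξ n i ω :=
    funext fun ω => sum_familySize_mul (fun i => skeletonStep ξ n i ω)
      ((fun k => ε k ω, fun k => U k ω) : Noise) le_rfl
  rw [heq]
  refine Finset.measurable_sum _ fun i _ => ?_
  have hf : Measurable fun w : Noise => (familySize w i m : ℝ) :=
    DependsBelow.measurable (k := m) fun w w' h => by
      rw [familySize_congr h i m (Nat.le_succ m)]
  exact (hf.comp hW).mul (hξ.measurable_skeletonStep n i)

/-- Convergence of the finite-dimensional distributions, from the characteristic functions. -/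
lemma tendstoFDD_walks [IsProbabilityMeasure P] (hp : Admissible p q Λ)
    (hξ : IsLevyProcess a q Λ ξ P) {ε : ℕ → ℕ → Ω → Bool} {U : ℕ → (k : ℕ) → Ω → Fin (k + 1)}
    (hnoise : ∀ n, IsReinforcementNoise p (ε n) (U n) P)
    (hindep : ∀ n, IndepFun (fun ω k => skeletonStep ξ n k ω)
      (fun ω => ((fun k => ε n k ω), (fun k => U n k ω))) P)
    {Ω' : Type*} [MeasurableSpace Ω'] {P' : Measure Ω'} [IsProbabilityMeasure P']
    {ζ ζhat : ℝ≥0 → Ω' → ℝ} (hζ : IsLevyReinforcedPair a q Λ p ζ ζhat P') :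
    TendstoFDD (fun (n : ℕ) (t : Set.Icc (0 : ℝ≥0) 1) ω =>
        (skeletonWalk ξ n ⌊(n : ℝ≥0) * t⌋₊ ω,
          reinforcedWalk ξ (ε n) (U n) n ⌊(n : ℝ≥0) * t⌋₊ ω))
      (fun (t : Set.Icc (0 : ℝ≥0) 1) ω => (ζ t ω, ζhat t ω)) P P' := by
  intro J
  have hζ1 := hζ.measurable_fst
  have hζ2 := hζ.measurable_snd
  refine tendstoInDistribution_of_tendsto_charFun
    (fun n => measurable_pi_iff.2 fun t => (hξ.measurable_skeletonWalk n _).prodMk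
      (hξ.measurable_reinforcedWalk (hnoise n) n _)) (by fun_prop) fun l b => ?_
  -- only the positive times matter, as all processes start from `0`
  set T : Finset J := Finset.univ.filter fun s => 0 < (s : ℝ≥0) with hT
  have hT0 : ∀ s : J, s ∉ T → (s : ℝ≥0) = 0 := fun s hs => by
    simpa [hT] using hs
  set t : Fin T.card → ℝ≥0 := fun j => ((T.orderEmbOfFin rfl j : J) : ℝ≥0) with ht
  set l' : Fin T.card → ℝ := fun j => l (T.orderEmbOfFin rfl j) with hl'
  set b' : Fin T.card → ℝ := fun j => b (T.orderEmbOfFin rfl j) with hb'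
  have ht1 : ∀ j, t j ≤ 1 := fun j => (T.orderEmbOfFin rfl j : J).1.2.2
  have ht0 : ∀ j, 0 < t j := fun j => (Finset.mem_filter.1 (T.orderEmbOfFin_mem rfl j)).2
  have htm : StrictMono t := fun i j hij => (T.orderEmbOfFin rfl).strictMono hij
  have h1 : ∀ n ω, ∑ s : J, (l s * skeletonWalk ξ n ⌊(n : ℝ≥0) * s⌋₊ ω
        + b s * reinforcedWalk ξ (ε n) (U n) n ⌊(n : ℝ≥0) * s⌋₊ ω)
      = ∑ j, (l' j * skeletonWalk ξ n ⌊(n : ℝ≥0) * t j⌋₊ ω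
        + b' j * reinforcedWalk ξ (ε n) (U n) n ⌊(n : ℝ≥0) * t j⌋₊ ω) := fun n ω =>
    sum_eq_sum_orderEmbOfFin T fun s hs => by
      rw [hT0 s hs]
      simp [skeletonWalk, reinforcedWalk]
  have h2 : ∀ᵐ ω ∂P', ∑ s : J, (l s * ζ s ω + b s * ζhat s ω)
      = ∑ j, (l' j * ζ (t j) ω + b' j * ζhat (t j) ω) := by
    filter_upwards [hζ.start] with ω hω
    refine sum_eq_sum_orderEmbOfFin T fun s hs => ?_
    rw [hT0 s hs, hω.1, hω.2]
    simp
  have h3 : ∫ ω, Complex.exp (Complex.I * ((∑ s : J, (l s * ζ s ω + b s * ζhat s ω) : ℝ) : ℂ)) ∂P'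
      = jointCharFun a q Λ p l' b' t 1 := by
    have h4 : ∫ ω, Complex.exp (Complex.I *
          ((∑ s : J, (l s * ζ s ω + b s * ζhat s ω) : ℝ) : ℂ)) ∂P'
        = ∫ ω, Complex.exp (Complex.I *
          ((∑ j, (l' j * ζ (t j) ω + b' j * ζhat (t j) ω) : ℝ) : ℂ)) ∂P' := by
      refine integral_congr_ae ?_
      filter_upwards [h2] with ω hω
      rw [hω]
    rw [h4]
    rcases Nat.eq_zero_or_pos T.card with h0 | h0
    · have : IsEmpty (Fin T.card) := by rw [h0]; infer_instance
      simp [jointCharFun, discardedArg, sharedArg, levyExponent_zero]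
    · exact hζ.charFun_eq _ l' b' t 1 h0 htm ht0 ht1
  simp only [h1, h3]
  exact (tendsto_charFun_walks hp hξ hnoise hindep l' b' ht1).2.2

end

end NoiseReinforced

theorem mainTheorem5 {Ω : Type*} [MeasurableSpace Ω] (P : Measure Ω) [IsProbabilityMeasure P]
    (a q : ℝ) (Λ : Measure ℝ) (p : ℝ)
    (hp : NoiseReinforced.Admissible p q Λ)
    (ξ : ℝ≥0 → Ω → ℝ) (hξ : NoiseReinforced.IsLevyProcess a q Λ ξ P)
    (ε : ℕ → ℕ → Ω → Bool) (U : ℕ → (k : ℕ) → Ω → Fin (k + 1))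
    (hnoise : ∀ n, NoiseReinforced.IsReinforcementNoise p (ε n) (U n) P)
    (hindep : ∀ n, IndepFun (fun ω k => NoiseReinforced.skeletonStep ξ n k ω)
      (fun ω => ((fun k => ε n k ω), (fun k => U n k ω))) P) :
    (∀ (k : ℕ) (l b : Fin k → ℝ) (t : Fin k → ℝ≥0),
      1 ≤ k → StrictMono t → (∀ j, 0 < t j) → (∀ j, t j ≤ 1) →
      IntegrableOn (fun u : ℝ => NoiseReinforced.levyExponent a q Λ
          (NoiseReinforced.discardedArg l (fun j => (t j : ℝ)) u)) (Set.Icc 0 1) ∧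
      Integrable (fun w => NoiseReinforced.levyExponent a q Λ
          (NoiseReinforced.sharedArg p l b (fun j => (t j : ℝ)) w))
        NoiseReinforced.yuleSimonMeasure ∧
      Tendsto (fun n : ℕ => ∫ ω, Complex.exp (Complex.I *
          ((∑ j, (l j * NoiseReinforced.skeletonWalk ξ n ⌊(n : ℝ≥0) * t j⌋₊ ω
            + b j * NoiseReinforced.reinforcedWalk ξ (ε n) (U n) n ⌊(n : ℝ≥0) * t j⌋₊ ω) : ℝ) : ℂ))
          ∂P)
        atTop (𝓝 (NoiseReinforced.jointCharFun a q Λ p l b t 1))) ∧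
    (∀ (Ω' : Type*) [MeasurableSpace Ω'] (P' : Measure Ω') [IsProbabilityMeasure P']
      (ζ ζhat : ℝ≥0 → Ω' → ℝ),
      NoiseReinforced.IsLevyReinforcedPair a q Λ p ζ ζhat P' →
      NoiseReinforced.TendstoFDD
        (fun (n : ℕ) (t : Set.Icc (0 : ℝ≥0) 1) ω =>
          (NoiseReinforced.skeletonWalk ξ n ⌊(n : ℝ≥0) * t⌋₊ ω,
            NoiseReinforced.reinforcedWalk ξ (ε n) (U n) n ⌊(n : ℝ≥0) * t⌋₊ ω))
        (fun (t : Set.Icc (0 : ℝ≥0) 1) ω => (ζ t ω, ζhat t ω)) P P') := by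
  refine ⟨fun k l b t _ _ _ ht => NoiseReinforced.tendsto_charFun_walks hp hξ hnoise hindep l b ht,
    fun Ω' _ P' _ ζ ζhat hζ => NoiseReinforced.tendstoFDD_walks hp hξ hnoise hindep hζ⟩
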